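/- A randomized adaptive algorithm in the vector-matrix-vector query model has access to an unknown matrix $A\in\mathbb{R}^{d\times d}$ only through queries: it chooses vectors $v,w\in\mathbb{R}^d$, which may depend on its random coins and on the answers to its earlier queries, and receives $v^TAw$; finally it outputs True or False. Let $\|A\|_p$ denote the Schatten $p$-norm of $A$, i.e. the $\ell_p$ norm of the vector of its singular values. Such an algorithm is a (two-sided) $(\epsilon,\ell_p)$-tester if for every real symmetric $A\in\mathbb{R}^{d\times d}$ it outputs True with probability at least $2/3$ if $A$ is positive semidefinite, and outputs False with probability at least $2/3$ if $A\ne 0$ and $\lambda_{\min}(A)\le-\epsilon\|A\|_p$. (i) There are absolute constants $C,K$ such that for every $d\ge 1$ and every $\epsilon\in(0,1)$ there is a two-sided adaptive $(\epsilon,\ell_2)$-tester for $d\times d$ matrices in the vector-matrix-vector model that makes at most $\widetilde O(1/\epsilon^2)$ queries, precisely at most $C f(1+\log f)^K$ queries with $f=1/\epsilon^2$ (in particular a number independent of $d$). (ii) There are absolute constants $C,K$ such that for every $p\in[2,\infty]$, every $d\ge1$ and every $\epsilon\in(0,1)$ there is a two-sided adaptive $(\epsilon,\ell_p)$-tester for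 $d\times d$ matrices in the vector-matrix-vector model that makes at most $\widetilde O(\epsilon^{-2}d^{1-2/p})$ queries, precisely at most $C f(1+\log f)^K$ queries with $f=\epsilon^{-2}d^{1-2/p}$ (where $2/\infty=0$). -/

import Mathlib

open MeasureTheory
open scoped ENNReal Matrix

/-- The Schatten `p`-norm of a real square matrix: the `ℓ_p` norm of the vector of its `d` singular
values (the largest singular value if `p = ∞`). -/
noncomputable def schattenNorm {d : ℕ} (p : ℝ≥0∞) (A : Matrix (Fin d) (Fin d) ℝ) : ℝ :=
  ‖WithLp.toLp p (fun i : Fin d => (Matrix.toEuclideanLin A).singularValues i)‖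

/-- A nonzero matrix `A` is `ε‖A‖_p`-far from the PSD cone: it has an eigenvalue, equivalently
its smallest eigenvalue `λ_min(A)` satisfies, `λ ≤ -ε‖A‖_p`.  (The zero matrix is PSD and satisfies
the inequality trivially, so it has to be excluded.) -/
def IsFarFromPSD {d : ℕ} (ε : ℝ) (p : ℝ≥0∞) (A : Matrix (Fin d) (Fin d) ℝ) : Prop :=
  A ≠ 0 ∧ ∃ l : ℝ, Module.End.HasEigenvalue (Matrix.toLin' A) l ∧ l ≤ -ε * schattenNorm p A

/-- A randomized adaptive algorithm in the vector-matrix-vector query model for `d × d` matrices.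
It has random coins `ω` from a probability space `(Ω, μ)` and makes `numQueries` queries;
the pair of vectors `(v, w)` of the `k`-th query is a measurable function of the coins
and of the answers to the previous `k` queries, and the output (`true` / `false`) is a measurable
function of the coins and of all the answers. -/
structure VMVAlgorithm (d : ℕ) where
  /-- the space of random coins -/
  Ω : Type
  [measurableSpace : MeasurableSpace Ω]
  /-- the law of the random coins -/
  μ : Measure Ω
  [isProbabilityMeasure : IsProbabilityMeasure μ]
  /-- the number of queries that the algorithm makes (on every input, for all coins) -/
  numQueries : ℕ
  /-- the next query, given the coins and the answers so far -/
  query : (k : ℕ) → Ω → (Fin k → ℝ) → (Fin d → ℝ) × (Fin d → ℝ)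
  measurable_query : ∀ k, Measurable fun x : Ω × (Fin k → ℝ) => query k x.1 x.2
  /-- the answer of the algorithm, given the coins and the answers to all queries -/
  output : Ω → (Fin numQueries → ℝ) → Bool
  measurable_output : Measurable fun x : Ω × (Fin numQueries → ℝ) => output x.1 x.2

namespace VMVAlgorithm

attribute [instance] VMVAlgorithm.measurableSpace VMVAlgorithm.isProbabilityMeasure

variable {d : ℕ} (T : VMVAlgorithm d)

/-- The answers to the first `k` queries on input `A`, with coins `ω`: the answer to the query
`(v, w)` is `vᵀ A w`. -/
def answers (A : Matrix (Fin d) (Fin d) ℝ) (ω : T.Ω) : (k : ℕ) → (Fin k → ℝ)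
  | 0 => Fin.elim0
  | k + 1 =>
    let a := answers A ω k
    let q := T.query k ω a
    Fin.snoc (α := fun _ => ℝ) a (q.1 ⬝ᵥ (A *ᵥ q.2))

/-- The output of the algorithm on input `A`, with coins `ω`. -/
def run (A : Matrix (Fin d) (Fin d) ℝ) (ω : T.Ω) : Bool :=
  T.output ω (T.answers A ω T.numQueries)

/-- The algorithm is a (two-sided) `(ε, ℓ_p)`-tester: on every symmetric `A`, it outputs `true` with
probability at least `2/3` if `A` is PSD, and `false` with probability at least `2/3` if
`A` is `ε‖A‖_p`-far from the PSD cone. -/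
def IsTester (ε : ℝ) (p : ℝ≥0∞) : Prop :=
  ∀ A : Matrix (Fin d) (Fin d) ℝ, A.IsSymm →
    (A.PosSemidef → 2 / 3 ≤ T.μ.real {ω | T.run A ω = true}) ∧
    (IsFarFromPSD ε p A → 2 / 3 ≤ T.μ.real {ω | T.run A ω = false})

end VMVAlgorithm

/-- `C · f · (1 + log f)^K`; a quantity is `Õ(f)`, for `f ≥ 1`, if it is at most this for some
constants `C` and `K`. -/
noncomputable def softBound (C : ℝ) (K : ℕ) (f : ℝ) : ℝ :=
  C * f * (1 + Real.log f) ^ K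

/-! By `schattenNorm_two_le`, `‖A‖_2 ≤ d^(1/2-1/p) ‖A‖_p` for `p ≥ 2`, so part (ii) is part (i) at
the smaller distance `ε / d^(1/2-1/p)`. Only the Frobenius norm `F = ‖A‖_2` matters from there on.

Dimension reduction. Let `G` be a `d × k` Gaussian matrix with `k` about `ε⁻² log(1/ε)`. The sketch
`GᵀAG` has mean `tr(A) I`. By rotation invariance `A` may be taken diagonal (`exists_diagSketch`).
If `A` is PSD, the centred sketch is bounded below by a multiple of `-√(k log k) F`: the lower tail
of a nonnegative combination of squared Gaussians is subgaussian, and a union bound over a grid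
makes this uniform (`diagSketch_uniform_lower_tail`). If `A` has an eigenvalue at most `-εF`, the
row of `G` belonging to that eigenvalue is itself a direction in which the centred form is at most
`-(εk/4) F` per unit of squared length (`diagSketch_negative_direction`). The second scale dominates
the first once `ε² k` exceeds a multiple of `log k`. With a shift `s` of order `εkF`, where `F` is
estimated from boundedly many queries (`frobSq_estimate_tail`), the shifted sketch `N` has trace
`ks` and is either PSD or has an eigenvalue at most `-2s`; moreover `‖N‖_F² ≤ 10^7 k s²` in the
second case.

Negative direction. Reading all of `N` would cost `k²` queries. Instead a stochastic gradient
iteration `x ↦ x - η (gᵀNx) g` with random sign vectors `g` is run, at one query per step. As `gᵀNg`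
concentrates at `tr N = ks`, a step size `η = c/(ks)` makes every step a descent step for the form
(`quadratic_gradStep_le`). The component of `x` along a bottom eigenvector `u` grows by the factor
`1 + ηl` per step in expectation, with small relative variance (`expect_sq_dot_gradIter_sub_le`).
After about `k log² k` steps this component is so large that one full gradient step, costing `k`
queries, takes the form from at most its initial value to below zero (`expect_gradIter_nonneg_le`).
The output is the sign of the form at the final point, so a PSD `N` is never rejected. -/

open scoped BigOperators

/-- The vector of signs encoded by a Boolean vector. -/
def signVec {ι : Type*} (s : ι → Bool) : ι → ℝ := fun a => if s a then 1 else -1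

/-! ### Moments of quadratic forms in random signs. -/

section Signs
variable {ι : Type*}

lemma signVec_mul_self (s : ι → Bool) (a : ι) : signVec s a * signVec s a = 1 := by
  simp only [signVec]; split_ifs <;> norm_num

variable [DecidableEq ι]

/-- The Boolean vector with the coordinate `a` negated. -/
def flipAt (a : ι) (s : ι → Bool) : ι → Bool := Function.update s a (!(s a))

lemma flipAt_involutive (a : ι) : Function.Involutive (flipAt a) := by
  intro s
  ext b
  by_cases h : b = a
  · subst h; simp [flipAt]
  · simp [flipAt, h]

lemma signVec_flipAt_self (a : ι) (s : ι → Bool) : signVec (flipAt a s) a = -signVec s a := by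
  simp only [signVec, flipAt, Function.update_self]
  cases s a <;> simp

lemma signVec_flipAt_of_ne {a b : ι} (h : b ≠ a) (s : ι → Bool) :
    signVec (flipAt a s) b = signVec s b := by
  simp [signVec, flipAt, h]

variable [Fintype ι]

/-- Negating one coordinate permutes the sign vectors, so the average equals its own negative. -/
lemma expect_eq_zero_of_flipAt (a : ι) (f : (ι → Bool) → ℝ) (h : ∀ s, f (flipAt a s) = -f s) :
    𝔼 s, f s = 0 := by
  have h1 : 𝔼 s, f (flipAt a s) = 𝔼 s, f s :=
    Fintype.expect_equiv (flipAt_involutive a).toPerm _ _ (fun _ => rfl)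
  simp only [h, Finset.expect_neg_distrib] at h1
  linarith

lemma expect_signVec_four_of_ne {a b c d : ι} (hb : b ≠ a) (hc : c ≠ a) (hd : d ≠ a) :
    𝔼 s : ι → Bool, signVec s a * signVec s b * signVec s c * signVec s d = 0 := by
  apply expect_eq_zero_of_flipAt a
  intro s
  rw [signVec_flipAt_self, signVec_flipAt_of_ne hb, signVec_flipAt_of_ne hc,
    signVec_flipAt_of_ne hd]
  ring

lemma expect_signVec_two (a b : ι) :
    𝔼 s : ι → Bool, signVec s a * signVec s b = if a = b then 1 else 0 := by
  split_ifs with h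
  · subst h; simp [signVec_mul_self]
  · apply expect_eq_zero_of_flipAt a
    intro s
    rw [signVec_flipAt_self, signVec_flipAt_of_ne (Ne.symm h)]
    ring

/-- The mean is 1 exactly when the indices pair up. The three pairings are added as for Gaussians;
if all four indices agree they count 3 instead of 1, hence the correction by 2. -/
lemma expect_signVec_four (a b c d : ι) :
    𝔼 s : ι → Bool, signVec s a * signVec s b * (signVec s c * signVec s d) =
      (if a = b then 1 else 0) * (if c = d then 1 else 0) +
      (if a = c then 1 else 0) * (if b = d then 1 else 0) +
      (if a = d then 1 else 0) * (if b = c then 1 else 0) -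
      2 * ((if a = b then 1 else 0) * (if c = d then 1 else 0) * (if a = c then 1 else 0)) := by
  by_cases hab : a = b
  · subst hab
    simp only [signVec_mul_self, one_mul, expect_signVec_two, if_true]
    by_cases hcd : c = d
    · subst hcd; simp; split_ifs <;> norm_num
    · by_cases hac : a = c
      · subst hac; simp [hcd]
      · simp [hac, hcd]
  · by_cases hac : a = c
    · subst hac
      have : ∀ s : ι → Bool, signVec s a * signVec s b * (signVec s a * signVec s d)
          = signVec s b * signVec s d := by
        intro s
        linear_combination (signVec s b * signVec s d) * signVec_mul_self s a
      simp only [this, expect_signVec_two, hab, if_true, if_false]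
      simp [Ne.symm hab]
    · by_cases had : a = d
      · subst had
        have : ∀ s : ι → Bool, signVec s a * signVec s b * (signVec s c * signVec s a)
            = signVec s b * signVec s c := by
          intro s
          linear_combination (signVec s b * signVec s c) * signVec_mul_self s a
        simp only [this, expect_signVec_two, hab, hac, if_true, if_false]
        simp
      · simp only [hab, hac, had, if_false]
        have := expect_signVec_four_of_ne (Ne.symm hab) (Ne.symm hac) (Ne.symm had)
        simp only [mul_assoc] at this ⊢
        rw [this]
        ring

lemma signVec_dotProduct_mulVec (P : Matrix ι ι ℝ) (s : ι → Bool) :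
    signVec s ⬝ᵥ (P *ᵥ signVec s) = ∑ a, ∑ b, P a b * (signVec s a * signVec s b) := by
  simp only [dotProduct, Matrix.mulVec, Finset.mul_sum]
  exact Finset.sum_congr rfl fun a _ => Finset.sum_congr rfl fun b _ => by ring

lemma expect_signVec_quadratic (P : Matrix ι ι ℝ) :
    𝔼 s : ι → Bool, signVec s ⬝ᵥ (P *ᵥ signVec s) = P.trace := by
  simp only [signVec_dotProduct_mulVec, Finset.expect_sum_comm, ← Finset.mul_expect,
    expect_signVec_two]
  simp [Matrix.trace]

lemma expect_signVec_quadratic_mul (P Q : Matrix ι ι ℝ) (hQ : Q.IsSymm) :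
    𝔼 s : ι → Bool, (signVec s ⬝ᵥ (P *ᵥ signVec s)) * (signVec s ⬝ᵥ (Q *ᵥ signVec s)) =
      P.trace * Q.trace + 2 * ∑ a, ∑ b, P a b * Q a b - 2 * ∑ a, P a a * Q a a := by
  have h1 : ∀ s : ι → Bool,
      (signVec s ⬝ᵥ (P *ᵥ signVec s)) * (signVec s ⬝ᵥ (Q *ᵥ signVec s)) =
      ∑ a, ∑ b, ∑ c, ∑ d, P a b * Q c d *
        (signVec s a * signVec s b * (signVec s c * signVec s d)) := by
    intro s
    rw [signVec_dotProduct_mulVec, signVec_dotProduct_mulVec]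
    simp only [Finset.sum_mul]
    simp only [Finset.mul_sum]
    refine Finset.sum_congr rfl fun a _ => Finset.sum_congr rfl fun b _ =>
      Finset.sum_congr rfl fun c _ => Finset.sum_congr rfl fun d _ => by ring
  simp only [h1, Finset.expect_sum_comm, ← Finset.mul_expect, expect_signVec_four]
  have hs : ∀ a b, Q b a = Q a b := fun a b => hQ.apply a b
  simp only [mul_sub, mul_add, Finset.sum_sub_distrib, Finset.sum_add_distrib, mul_ite,
    mul_one, mul_zero, Finset.sum_ite_eq, Finset.mem_univ, if_true, Finset.sum_ite_irrel, Finset.sum_const_zero]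
  have e1 : P.trace * Q.trace = ∑ a, ∑ b, P a a * Q b b := by
    simp [Matrix.trace, Finset.sum_mul_sum]
  have e2 : ∑ a, ∑ b, P a b * Q b a = ∑ a, ∑ b, P a b * Q a b := by simp only [hs]
  rw [e1, e2]
  simp only [← Finset.sum_mul]
  ring

end Signs

/-! ### Frobenius norm and Cauchy–Schwarz bounds. -/

section Frobenius
variable {ι : Type*} [Fintype ι]

/-- The square of the Frobenius norm. -/
def frobSq (N : Matrix ι ι ℝ) : ℝ := ∑ a, ∑ b, N a b ^ 2

lemma frobSq_nonneg (N : Matrix ι ι ℝ) : 0 ≤ frobSq N :=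
  Finset.sum_nonneg fun _ _ => Finset.sum_nonneg fun _ _ => sq_nonneg _

lemma dotProduct_sq_le (x y : ι → ℝ) : (x ⬝ᵥ y) ^ 2 ≤ (x ⬝ᵥ x) * (y ⬝ᵥ y) := by
  have := Finset.sum_mul_sq_le_sq_mul_sq Finset.univ x y
  simpa [dotProduct, sq] using this

lemma dotProduct_self_nonneg' (x : ι → ℝ) : 0 ≤ x ⬝ᵥ x :=
  Finset.sum_nonneg fun _ _ => mul_self_nonneg _

lemma mulVec_dotProduct_self_le (N : Matrix ι ι ℝ) (v : ι → ℝ) :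
    (N *ᵥ v) ⬝ᵥ (N *ᵥ v) ≤ frobSq N * (v ⬝ᵥ v) := by
  rw [frobSq, Finset.sum_mul]
  refine Finset.sum_le_sum fun a _ => ?_
  have := dotProduct_sq_le (N a) v
  rw [sq] at this
  simpa [Matrix.mulVec, dotProduct, sq] using this

lemma quadratic_sq_le (N : Matrix ι ι ℝ) (x y : ι → ℝ) :
    (x ⬝ᵥ (N *ᵥ y)) ^ 2 ≤ frobSq N * (x ⬝ᵥ x) * (y ⬝ᵥ y) := by
  have h1 := dotProduct_sq_le x (N *ᵥ y)
  have h2 := mulVec_dotProduct_self_le N y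
  have h3 := dotProduct_self_nonneg' x
  nlinarith

lemma abs_quadratic_le (N : Matrix ι ι ℝ) (x : ι → ℝ) :
    |x ⬝ᵥ (N *ᵥ x)| ≤ √(frobSq N) * (x ⬝ᵥ x) := by
  apply abs_le_of_sq_le_sq
  · rw [mul_pow, Real.sq_sqrt (frobSq_nonneg N)]
    have := quadratic_sq_le N x x
    nlinarith
  · exact mul_nonneg (Real.sqrt_nonneg _) (dotProduct_self_nonneg' x)

lemma dotProduct_mulVec_symm {N : Matrix ι ι ℝ} (hN : N.IsSymm) (x y : ι → ℝ) :
    x ⬝ᵥ (N *ᵥ y) = (N *ᵥ x) ⬝ᵥ y := by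
  rw [Matrix.dotProduct_mulVec, ← Matrix.mulVec_transpose, hN.eq]

lemma trace_mul_self_eq_frobSq {N : Matrix ι ι ℝ} (hN : N.IsSymm) :
    (N * N).trace = frobSq N := by
  simp only [Matrix.trace, Matrix.diag, Matrix.mul_apply, frobSq]
  exact Finset.sum_congr rfl fun a _ => Finset.sum_congr rfl fun b _ => by
    rw [hN.apply a b, sq]

end Frobenius

/-! ### One step of the stochastic gradient iteration. -/

section Step
variable {ι : Type*} [Fintype ι] [DecidableEq ι]

lemma expect_signVec_dot_mul_dot (u v : ι → ℝ) :
    𝔼 s : ι → Bool, (signVec s ⬝ᵥ u) * (signVec s ⬝ᵥ v) = u ⬝ᵥ v := by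
  have := expect_signVec_quadratic (Matrix.vecMulVec u v)
  rw [Matrix.trace_vecMulVec] at this
  rw [← this]
  refine Finset.expect_congr rfl fun s _ => ?_
  rw [Matrix.vecMulVec_mulVec, dotProduct_smul, dotProduct_comm v]
  simp

lemma quadratic_vecMulVec_self (v x : ι → ℝ) :
    x ⬝ᵥ (Matrix.vecMulVec v v *ᵥ x) = (x ⬝ᵥ v) ^ 2 := by
  rw [Matrix.vecMulVec_mulVec, dotProduct_smul, dotProduct_comm v]
  simp [sq]

lemma expect_signVec_dot_sq_mul_quadratic_le (v : ι → ℝ) (Q : Matrix ι ι ℝ) (hQ : Q.IsSymm)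
    (hd : ∀ a, 0 ≤ Q a a) :
    𝔼 s : ι → Bool, (signVec s ⬝ᵥ v) ^ 2 * (signVec s ⬝ᵥ (Q *ᵥ signVec s)) ≤
      (v ⬝ᵥ v) * Q.trace + 2 * (v ⬝ᵥ (Q *ᵥ v)) := by
  have := expect_signVec_quadratic_mul (Matrix.vecMulVec v v) Q hQ
  simp only [quadratic_vecMulVec_self, Matrix.trace_vecMulVec] at this
  rw [this]
  have h1 : ∑ a, ∑ b, Matrix.vecMulVec v v a b * Q a b = v ⬝ᵥ (Q *ᵥ v) := by
    simp only [dotProduct, Matrix.mulVec, Finset.mul_sum, Matrix.vecMulVec_apply]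
    exact Finset.sum_congr rfl fun a _ => Finset.sum_congr rfl fun b _ => by ring
  have h2 : 0 ≤ ∑ a, Matrix.vecMulVec v v a a * Q a a :=
    Finset.sum_nonneg fun a _ => mul_nonneg (by
      rw [Matrix.vecMulVec_apply]; exact mul_self_nonneg _) (hd a)
  linarith

lemma expect_sq_quadratic_sub_trace_le (N : Matrix ι ι ℝ) (hN : N.IsSymm) :
    𝔼 s : ι → Bool, (signVec s ⬝ᵥ (N *ᵥ signVec s) - N.trace) ^ 2 ≤ 2 * frobSq N := by
  have h : ∀ s : ι → Bool, (signVec s ⬝ᵥ (N *ᵥ signVec s) - N.trace) ^ 2 =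
      (signVec s ⬝ᵥ (N *ᵥ signVec s)) * (signVec s ⬝ᵥ (N *ᵥ signVec s)) -
      2 * N.trace * (signVec s ⬝ᵥ (N *ᵥ signVec s)) + N.trace ^ 2 := fun s => by ring
  simp only [h, Finset.expect_add_distrib, Finset.expect_sub_distrib, ← Finset.mul_expect,
    expect_signVec_quadratic_mul N N hN, expect_signVec_quadratic]
  rw [Finset.expect_const Finset.univ_nonempty]
  have h2 : 0 ≤ ∑ a, N a a * N a a := Finset.sum_nonneg fun a _ => mul_self_nonneg _
  have h3 : ∑ a, ∑ b, N a b * N a b = frobSq N := by simp [frobSq, sq]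
  rw [h3]
  nlinarith

/-- One step of the stochastic gradient iteration for the quadratic form of `N`, in the
direction `g`. -/
def gradStep (N : Matrix ι ι ℝ) (η : ℝ) (x g : ι → ℝ) : ι → ℝ :=
  x - (η * (g ⬝ᵥ (N *ᵥ x))) • g

variable {N : Matrix ι ι ℝ} {η : ℝ}

/-- With `D = gᵀNx`, the new value is `xᵀNx - 2ηD² + η²D² gᵀNg`, and the hypothesis on `g` lets half
of the linear gain absorb the last term. -/
lemma quadratic_gradStep_le (hN : N.IsSymm) (hη : 0 ≤ η) (x g : ι → ℝ)
    (hg : η * (g ⬝ᵥ (N *ᵥ g)) ≤ 1) :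
    gradStep N η x g ⬝ᵥ (N *ᵥ gradStep N η x g) ≤
      x ⬝ᵥ (N *ᵥ x) - η * (g ⬝ᵥ (N *ᵥ x)) ^ 2 := by
  have h1 : x ⬝ᵥ (N *ᵥ g) = g ⬝ᵥ (N *ᵥ x) := by
    rw [dotProduct_mulVec_symm hN, dotProduct_comm]
  simp only [gradStep, Matrix.mulVec_sub, Matrix.mulVec_smul, dotProduct_sub, sub_dotProduct,
    dotProduct_smul, smul_dotProduct, smul_eq_mul, h1]
  have h2 : 0 ≤ η * (g ⬝ᵥ (N *ᵥ x)) ^ 2 := by positivity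
  nlinarith [mul_le_mul_of_nonneg_left hg h2]

/-- Controls the noise of later steps, which is proportional to `‖Nx‖²`. With `v = Nx`, the cross
term is `-2η vᵀNv ≤ 2ηl‖v‖²`; the fourth moment term is at most `η²(‖v‖² tr N² + 2‖Nv‖²) ≤
3η²‖N‖_F²‖v‖²`. -/
lemma expect_mulVec_gradStep_le (hN : N.IsSymm) (hη : 0 ≤ η) {l : ℝ}
    (hl : ∀ x : ι → ℝ, -l * (x ⬝ᵥ x) ≤ x ⬝ᵥ (N *ᵥ x)) (x : ι → ℝ) :
    𝔼 s : ι → Bool, (N *ᵥ gradStep N η x (signVec s)) ⬝ᵥ (N *ᵥ gradStep N η x (signVec s)) ≤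
      (1 + 2 * η * l + 3 * η ^ 2 * frobSq N) * ((N *ᵥ x) ⬝ᵥ (N *ᵥ x)) := by
  set v := N *ᵥ x with hv
  have hQ : (N * N).IsSymm := by
    rw [Matrix.IsSymm, Matrix.transpose_mul, hN.eq]
  have hQd : ∀ a, 0 ≤ (N * N) a a := fun a => by
    rw [Matrix.mul_apply]
    exact Finset.sum_nonneg fun b _ => by rw [hN.apply a b]; exact mul_self_nonneg _
  have hNN : ∀ y, y ⬝ᵥ ((N * N) *ᵥ y) = (N *ᵥ y) ⬝ᵥ (N *ᵥ y) := fun y => by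
    rw [← Matrix.mulVec_mulVec, dotProduct_mulVec_symm hN]
  have h1 : ∀ s : ι → Bool,
      (N *ᵥ gradStep N η x (signVec s)) ⬝ᵥ (N *ᵥ gradStep N η x (signVec s)) =
      v ⬝ᵥ v - 2 * η * ((signVec s ⬝ᵥ v) * (signVec s ⬝ᵥ (N *ᵥ v))) +
      η ^ 2 * ((signVec s ⬝ᵥ v) ^ 2 * (signVec s ⬝ᵥ ((N * N) *ᵥ signVec s))) := by
    intro s
    have e1 : v ⬝ᵥ (N *ᵥ signVec s) = signVec s ⬝ᵥ (N *ᵥ v) := by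
      rw [dotProduct_mulVec_symm hN, dotProduct_comm]
    have e2 : (N *ᵥ signVec s) ⬝ᵥ v = signVec s ⬝ᵥ (N *ᵥ v) := by
      rw [dotProduct_comm, e1]
    rw [hNN]
    simp only [gradStep, ← hv, Matrix.mulVec_sub, Matrix.mulVec_smul, dotProduct_sub,
      sub_dotProduct, dotProduct_smul, smul_dotProduct, smul_eq_mul, e1, e2]
    ring
  simp only [h1, Finset.expect_add_distrib, Finset.expect_sub_distrib, ← Finset.mul_expect,
    expect_signVec_dot_mul_dot]
  rw [Finset.expect_const Finset.univ_nonempty]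
  have h2 := expect_signVec_dot_sq_mul_quadratic_le v (N * N) hQ hQd
  rw [hNN, trace_mul_self_eq_frobSq hN] at h2
  have h3 := mulVec_dotProduct_self_le N v
  have h4 := mul_le_mul_of_nonneg_left (hl v) (by positivity : 0 ≤ 2 * η)
  have h5 : 𝔼 s : ι → Bool, (signVec s ⬝ᵥ v) ^ 2 * (signVec s ⬝ᵥ ((N * N) *ᵥ signVec s)) ≤
      3 * frobSq N * (v ⬝ᵥ v) := by linarith
  have h6 := mul_le_mul_of_nonneg_left h5 (sq_nonneg η)
  linarith

lemma expect_dot_gradStep {l : ℝ} {u : ι → ℝ} (hN : N.IsSymm)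
    (hu : N *ᵥ u = -l • u) (x : ι → ℝ) :
    𝔼 s : ι → Bool, u ⬝ᵥ gradStep N η x (signVec s) = (1 + η * l) * (u ⬝ᵥ x) := by
  have h1 : ∀ s : ι → Bool, u ⬝ᵥ gradStep N η x (signVec s) =
      u ⬝ᵥ x - η * ((signVec s ⬝ᵥ (N *ᵥ x)) * (signVec s ⬝ᵥ u)) := fun s => by
    rw [gradStep, dotProduct_sub, dotProduct_smul, smul_eq_mul, dotProduct_comm u (signVec s)]
    ring
  simp only [h1, Finset.expect_sub_distrib, ← Finset.mul_expect, expect_signVec_dot_mul_dot]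
  rw [Finset.expect_const Finset.univ_nonempty, ← dotProduct_mulVec_symm hN, hu,
    dotProduct_smul, smul_eq_mul, dotProduct_comm x]
  ring

/-- The sign average of `(gᵀv)²(gᵀu)²` is at most `‖v‖² + 2(vᵀu)²`. Since `vᵀu = -l(uᵀx)`, one copy
of the second term completes the square `(1 + ηl)²` and the other is bounded by `‖v‖²`. -/
lemma expect_sq_dot_gradStep_le {l : ℝ} {u : ι → ℝ} (hN : N.IsSymm)
    (hu : N *ᵥ u = -l • u) (hu1 : u ⬝ᵥ u = 1) (x : ι → ℝ) :
    𝔼 s : ι → Bool, (u ⬝ᵥ gradStep N η x (signVec s)) ^ 2 ≤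
      (1 + η * l) ^ 2 * (u ⬝ᵥ x) ^ 2 + 2 * η ^ 2 * ((N *ᵥ x) ⬝ᵥ (N *ᵥ x)) := by
  set v := N *ᵥ x with hv
  have hvu : v ⬝ᵥ u = -l * (u ⬝ᵥ x) := by
    rw [hv, ← dotProduct_mulVec_symm hN, hu, dotProduct_smul, smul_eq_mul, dotProduct_comm x]
  have h1 : ∀ s : ι → Bool, (u ⬝ᵥ gradStep N η x (signVec s)) ^ 2 =
      (u ⬝ᵥ x) ^ 2 - 2 * η * (u ⬝ᵥ x) * ((signVec s ⬝ᵥ v) * (signVec s ⬝ᵥ u)) +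
      η ^ 2 * ((signVec s ⬝ᵥ v) ^ 2 * (signVec s ⬝ᵥ (Matrix.vecMulVec u u *ᵥ signVec s))) :=
    fun s => by
      rw [quadratic_vecMulVec_self]
      rw [gradStep, ← hv, dotProduct_sub, dotProduct_smul, smul_eq_mul,
        dotProduct_comm u (signVec s)]
      ring
  simp only [h1, Finset.expect_add_distrib, Finset.expect_sub_distrib, ← Finset.mul_expect,
    expect_signVec_dot_mul_dot]
  rw [Finset.expect_const Finset.univ_nonempty, hvu]
  have h2 := expect_signVec_dot_sq_mul_quadratic_le v (Matrix.vecMulVec u u)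
    (by rw [Matrix.IsSymm, Matrix.transpose_vecMulVec])
    (fun a => by rw [Matrix.vecMulVec_apply]; exact mul_self_nonneg _)
  rw [quadratic_vecMulVec_self, Matrix.trace_vecMulVec, hu1, hvu] at h2
  have h3 := dotProduct_sq_le v u
  rw [hu1, hvu] at h3
  have h6 := mul_le_mul_of_nonneg_left h2 (sq_nonneg η)
  have h7 := mul_le_mul_of_nonneg_left h3 (sq_nonneg η)
  nlinarith

end Step

/-! ### The iteration: growth along the bottom eigenvector and success probability. -/

section Iterate
variable {ι : Type*} [Fintype ι] [DecidableEq ι]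

/-- The stochastic gradient iteration with the sequence `s` of random sign directions. -/
def gradIter (N : Matrix ι ι ℝ) (η : ℝ) : (n : ℕ) → (Fin n → ι → Bool) → (ι → ℝ) → ι → ℝ
  | 0, _, x => x
  | n + 1, s, x => gradIter N η n (Fin.tail s) (gradStep N η x (signVec (s 0)))

lemma expect_fin_succ {α : Type*} [Fintype α] [Nonempty α] (n : ℕ) (f : (Fin (n + 1) → α) → ℝ) :
    𝔼 s, f s = 𝔼 a : α, 𝔼 s : Fin n → α, f (Fin.cons a s) := by
  rw [← Finset.expect_product' Finset.univ Finset.univ (fun a s => f (Fin.cons a s))]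
  exact (Fintype.expect_equiv (Fin.consEquiv (fun _ => α)) _ _ (fun _ => rfl)).symm

variable {N : Matrix ι ι ℝ} {η : ℝ}

lemma gradIter_cons (n : ℕ) (a : ι → Bool) (s : Fin n → ι → Bool) (x : ι → ℝ) :
    gradIter N η (n + 1) (Fin.cons a s) x = gradIter N η n s (gradStep N η x (signVec a)) := by
  simp [gradIter]

lemma quadratic_gradIter_le (hN : N.IsSymm) (hη : 0 ≤ η) (n : ℕ) (s : Fin n → ι → Bool)
    (x : ι → ℝ) (hs : ∀ t, η * (signVec (s t) ⬝ᵥ (N *ᵥ signVec (s t))) ≤ 1) :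
    gradIter N η n s x ⬝ᵥ (N *ᵥ gradIter N η n s x) ≤ x ⬝ᵥ (N *ᵥ x) := by
  induction n generalizing x with
  | zero => exact le_rfl
  | succ n ih =>
    refine (ih (Fin.tail s) _ fun t => hs t.succ).trans ?_
    refine (quadratic_gradStep_le hN hη x _ (hs 0)).trans ?_
    have : 0 ≤ η * (signVec (s 0) ⬝ᵥ (N *ᵥ x)) ^ 2 := by positivity
    linarith

lemma expect_dot_gradIter {l : ℝ} {u : ι → ℝ} (hN : N.IsSymm) (hu : N *ᵥ u = -l • u) (n : ℕ)
    (x : ι → ℝ) :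
    𝔼 s, u ⬝ᵥ gradIter N η n s x = (1 + η * l) ^ n * (u ⬝ᵥ x) := by
  induction n generalizing x with
  | zero => simp [gradIter]
  | succ n ih =>
    simp only [expect_fin_succ, gradIter_cons, ih, ← Finset.mul_expect, expect_dot_gradStep hN hu]
    ring

/-- Both the squared component and `‖Nx‖²` grow by about `(1 + ηl)²` per step. After dividing this
factor out, each step adds only noise of order `η²‖Nx‖²`, up to the harmless factor `(1 +
3η²‖N‖_F²)^n`. -/
lemma expect_sq_dot_gradIter_le {l : ℝ} {u : ι → ℝ} (hN : N.IsSymm) (hη : 0 ≤ η) (hl0 : 0 ≤ l)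
    (hl : ∀ x : ι → ℝ, -l * (x ⬝ᵥ x) ≤ x ⬝ᵥ (N *ᵥ x))
    (hu : N *ᵥ u = -l • u) (hu1 : u ⬝ᵥ u = 1) (n : ℕ) (x : ι → ℝ) :
    𝔼 s, (u ⬝ᵥ gradIter N η n s x) ^ 2 ≤ (1 + η * l) ^ (2 * n) * ((u ⬝ᵥ x) ^ 2 +
      2 * η ^ 2 * n * (1 + 3 * η ^ 2 * frobSq N) ^ n * ((N *ᵥ x) ⬝ᵥ (N *ᵥ x))) := by
  have hF := frobSq_nonneg N
  set q := 1 + 3 * η ^ 2 * frobSq N with hq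
  have hq1 : 1 ≤ q := by rw [hq]; nlinarith [mul_nonneg (sq_nonneg η) hF]
  set r := 1 + η * l with hr
  have hr1 : 1 ≤ r := by rw [hr]; nlinarith [mul_nonneg hη hl0]
  induction n generalizing x with
  | zero => simp [gradIter]
  | succ n ih =>
    simp only [expect_fin_succ, gradIter_cons]
    refine (Finset.expect_le_expect fun s _ => ih _).trans ?_
    simp only [← Finset.mul_expect, Finset.expect_add_distrib]
    have h1 := expect_sq_dot_gradStep_le (η := η) hN hu hu1 x
    have h2 := expect_mulVec_gradStep_le hN hη hl x
    set W := (N *ᵥ x) ⬝ᵥ (N *ᵥ x) with hW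
    have hW0 : 0 ≤ W := dotProduct_self_nonneg' _
    have h3 : 1 + 2 * η * l + 3 * η ^ 2 * frobSq N ≤ r ^ 2 * q := by
      have : 0 ≤ (r ^ 2 - 1) * (q - 1) := mul_nonneg (by nlinarith) (by linarith)
      nlinarith [sq_nonneg (η * l)]
    have h4 := h2.trans (mul_le_mul_of_nonneg_right h3 hW0)
    rw [← hr] at h1
    have h5 := mul_le_mul_of_nonneg_left h4 (by positivity : 0 ≤ 2 * η ^ 2 * n * q ^ n)
    have h6 : 2 * η ^ 2 * W ≤ r ^ 2 * (2 * η ^ 2 * q ^ (n + 1) * W) := by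
      have : 1 ≤ r ^ 2 * q ^ (n + 1) := by
        have a1 : 1 ≤ r ^ 2 := one_le_pow₀ hr1
        have a2 : 1 ≤ q ^ (n + 1) := one_le_pow₀ hq1
        nlinarith
      have := mul_le_mul_of_nonneg_left this (by positivity : 0 ≤ 2 * η ^ 2 * W)
      linarith
    have h7 : r ^ (2 * (n + 1)) = r ^ (2 * n) * r ^ 2 := by ring
    rw [h7, mul_assoc (r ^ (2 * n)) (r ^ 2)]
    refine mul_le_mul_of_nonneg_left ?_ (pow_nonneg (by linarith) _ : 0 ≤ r ^ (2 * n))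
    push_cast
    rw [pow_succ q] at h6 ⊢
    linarith

lemma expect_sq_dot_gradIter_sub_le {l : ℝ} {u : ι → ℝ} (hN : N.IsSymm) (hη : 0 ≤ η) (hl0 : 0 ≤ l)
    (hl : ∀ x : ι → ℝ, -l * (x ⬝ᵥ x) ≤ x ⬝ᵥ (N *ᵥ x))
    (hu : N *ᵥ u = -l • u) (hu1 : u ⬝ᵥ u = 1) (n : ℕ) (x : ι → ℝ) :
    𝔼 s, (u ⬝ᵥ gradIter N η n s x - (1 + η * l) ^ n * (u ⬝ᵥ x)) ^ 2 ≤
      (1 + η * l) ^ (2 * n) *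
      (2 * η ^ 2 * n * (1 + 3 * η ^ 2 * frobSq N) ^ n * ((N *ᵥ x) ⬝ᵥ (N *ᵥ x))) := by
  have h : ∀ s, (u ⬝ᵥ gradIter N η n s x - (1 + η * l) ^ n * (u ⬝ᵥ x)) ^ 2 =
      (u ⬝ᵥ gradIter N η n s x) ^ 2 -
      2 * ((1 + η * l) ^ n * (u ⬝ᵥ x)) * (u ⬝ᵥ gradIter N η n s x) +
      ((1 + η * l) ^ n * (u ⬝ᵥ x)) ^ 2 := fun s => by ring
  simp only [h, Finset.expect_add_distrib, Finset.expect_sub_distrib, ← Finset.mul_expect,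
    expect_dot_gradIter hN hu]
  rw [Finset.expect_const Finset.univ_nonempty]
  have := expect_sq_dot_gradIter_le hN hη hl0 hl hu hu1 n x
  rw [mul_add] at this
  have e : (1 + η * l) ^ (2 * n) = ((1 + η * l) ^ n) ^ 2 := pow_mul' _ _ _
  rw [e] at this ⊢
  nlinarith

lemma expect_fin_apply {α : Type*} [Fintype α] [Nonempty α] (n : ℕ) (i : Fin n) (f : α → ℝ) :
    𝔼 s : Fin n → α, f (s i) = 𝔼 a, f a := by
  induction n with
  | zero => exact i.elim0
  | succ n ih =>
    rw [expect_fin_succ]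
    refine Fin.cases ?_ (fun j => ?_) i
    · simp only [Fin.cons_zero]
      exact Finset.expect_congr rfl fun a _ => Finset.expect_const Finset.univ_nonempty _
    · simp only [Fin.cons_succ, ih]
      exact Finset.expect_const Finset.univ_nonempty _

/-- The last, deterministic gradient step: it converts a large `‖Nx‖` into a definite decrease of
the form. -/
lemma quadratic_sub_smul_mulVec_le (hN : N.IsSymm) {α : ℝ} (hα0 : 0 ≤ α)
    (hα : α * √(frobSq N) ≤ 1) (x : ι → ℝ) :
    (x - α • (N *ᵥ x)) ⬝ᵥ (N *ᵥ (x - α • (N *ᵥ x))) ≤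
      x ⬝ᵥ (N *ᵥ x) - α * ((N *ᵥ x) ⬝ᵥ (N *ᵥ x)) := by
  set v := N *ᵥ x with hv
  have e1 : x ⬝ᵥ (N *ᵥ v) = v ⬝ᵥ v := dotProduct_mulVec_symm hN _ _
  have h1 := (le_abs_self _).trans (abs_quadratic_le N v)
  have h2 := mul_le_mul_of_nonneg_right hα (dotProduct_self_nonneg' v)
  have h3 := mul_le_mul_of_nonneg_left h1 hα0
  have h4 : α * (α * (v ⬝ᵥ (N *ᵥ v))) ≤ α * (v ⬝ᵥ v) :=
    mul_le_mul_of_nonneg_left (by linarith) hα0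
  simp only [Matrix.mulVec_sub, Matrix.mulVec_smul, dotProduct_sub, sub_dotProduct,
    dotProduct_smul, smul_dotProduct, smul_eq_mul, ← hv, e1]
  linarith

/-- If all sign vectors satisfy `ηgᵀNg ≤ 1`, the form never exceeds its initial value. If also `uᵀz`
is at least half its mean `P` in absolute value, then `‖Nz‖² ≥ l²P²/4`, and the last step pushes the
form below zero by `hbig`. The two summands of the bound are the failure probabilities of these
events. -/
lemma expect_gradIter_nonneg_le {l : ℝ} {u : ι → ℝ} (hN : N.IsSymm) (hη : 0 ≤ η) (hl0 : 0 ≤ l)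
    (hl : ∀ x : ι → ℝ, -l * (x ⬝ᵥ x) ≤ x ⬝ᵥ (N *ᵥ x))
    (hu : N *ᵥ u = -l • u) (hu1 : u ⬝ᵥ u = 1) (n : ℕ) (x : ι → ℝ) {Δ α : ℝ} (hΔ : 0 < Δ)
    (hstep : η * (N.trace + Δ) ≤ 1) (hα0 : 0 ≤ α) (hα : α * √(frobSq N) ≤ 1)
    (hY : u ⬝ᵥ x ≠ 0)
    (hbig : x ⬝ᵥ (N *ᵥ x) < α * (l ^ 2 * (((1 + η * l) ^ n * (u ⬝ᵥ x)) ^ 2 / 4))) :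
    𝔼 s, (if 0 ≤ (gradIter N η n s x - α • (N *ᵥ gradIter N η n s x)) ⬝ᵥ
        (N *ᵥ (gradIter N η n s x - α • (N *ᵥ gradIter N η n s x))) then (1 : ℝ) else 0) ≤
      4 * (2 * η ^ 2 * n * (1 + 3 * η ^ 2 * frobSq N) ^ n * ((N *ᵥ x) ⬝ᵥ (N *ᵥ x))) /
        (u ⬝ᵥ x) ^ 2 + n * (2 * frobSq N / Δ ^ 2) := by
  have hr : 0 < 1 + η * l := by positivity
  set P := (1 + η * l) ^ n * (u ⬝ᵥ x) with hP
  have hP0 : 0 < P ^ 2 := by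
    rw [hP]; positivity
  -- Chebyshev and the union bound in pointwise form: whenever the sign is wrong, one of these
  -- squares is at least 1.
  have key : ∀ s : Fin n → ι → Bool,
      (if 0 ≤ (gradIter N η n s x - α • (N *ᵥ gradIter N η n s x)) ⬝ᵥ
        (N *ᵥ (gradIter N η n s x - α • (N *ᵥ gradIter N η n s x))) then (1 : ℝ) else 0) ≤
      4 / P ^ 2 * (u ⬝ᵥ gradIter N η n s x - P) ^ 2 +
        ∑ t, 1 / Δ ^ 2 * (signVec (s t) ⬝ᵥ (N *ᵥ signVec (s t)) - N.trace) ^ 2 := by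
    intro s
    have hnn : ∀ t ∈ Finset.univ,
        0 ≤ 1 / Δ ^ 2 * (signVec (s t) ⬝ᵥ (N *ᵥ signVec (s t)) - N.trace) ^ 2 :=
      fun t _ => by positivity
    have hnn1 : 0 ≤ 4 / P ^ 2 * (u ⬝ᵥ gradIter N η n s x - P) ^ 2 := by positivity
    split_ifs with h
    · by_contra! hc
      have hD : 4 / P ^ 2 * (u ⬝ᵥ gradIter N η n s x - P) ^ 2 < 1 :=
        lt_of_le_of_lt (le_add_of_nonneg_right (Finset.sum_nonneg hnn)) hc
      have ht : ∀ t, η * (signVec (s t) ⬝ᵥ (N *ᵥ signVec (s t))) ≤ 1 := by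
        intro t
        have h1 := Finset.single_le_sum hnn (Finset.mem_univ t)
        have h2 : 1 / Δ ^ 2 * (signVec (s t) ⬝ᵥ (N *ᵥ signVec (s t)) - N.trace) ^ 2 < 1 := by
          linarith
        rw [one_div, inv_mul_lt_one₀ (by positivity)] at h2
        have h3 := (abs_lt_of_sq_lt_sq h2 hΔ.le)
        have h4 := (le_abs_self _).trans h3.le
        exact (mul_le_mul_of_nonneg_left (by linarith) hη).trans hstep
      have hQ := quadratic_gradIter_le hN hη n s x ht
      have hy := quadratic_sub_smul_mulVec_le hN hα0 hα (gradIter N η n s x)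
      set z := gradIter N η n s x with hz
      have hv : l ^ 2 * (u ⬝ᵥ z) ^ 2 ≤ (N *ᵥ z) ⬝ᵥ (N *ᵥ z) := by
        have := dotProduct_sq_le (N *ᵥ z) u
        rw [← dotProduct_mulVec_symm hN, hu, dotProduct_smul, hu1, smul_eq_mul,
          dotProduct_comm z] at this
        nlinarith
      have hz2 : P ^ 2 / 4 ≤ (u ⬝ᵥ z) ^ 2 := by
        rw [div_mul_eq_mul_div, div_lt_one hP0] at hD
        have h5 : |2 * (u ⬝ᵥ z - P)| < |P| := by
          apply sq_lt_sq.mp; nlinarith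
        have h6 : |P| ≤ |2 * (u ⬝ᵥ z)| := by
          have : |2 * P| ≤ |2 * (u ⬝ᵥ z)| + |2 * (u ⬝ᵥ z - P)| := by
            have := abs_sub (2 * (u ⬝ᵥ z)) (2 * (u ⬝ᵥ z - P))
            rwa [show 2 * (u ⬝ᵥ z) - 2 * (u ⬝ᵥ z - P) = 2 * P by ring] at this
          rw [abs_mul 2 P, abs_two] at this
          linarith
        have := sq_le_sq.mpr h6
        nlinarith
      have h7 : α * (l ^ 2 * (P ^ 2 / 4)) ≤ α * ((N *ᵥ z) ⬝ᵥ (N *ᵥ z)) :=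
        mul_le_mul_of_nonneg_left
          ((mul_le_mul_of_nonneg_left hz2 (sq_nonneg l)).trans hv) hα0
      linarith
    · exact add_nonneg hnn1 (Finset.sum_nonneg hnn)
  refine (Finset.expect_le_expect fun s _ => key s).trans ?_
  rw [Finset.expect_add_distrib, Finset.expect_sum_comm, ← Finset.mul_expect]
  refine add_le_add ?_ ?_
  · have h1 := expect_sq_dot_gradIter_sub_le hN hη hl0 hl hu hu1 n x
    refine (mul_le_mul_of_nonneg_left h1 (by positivity)).trans (le_of_eq ?_)
    rw [hP, pow_mul' _ 2 n]
    field_simp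
  · have h2 : ∀ t : Fin n, 𝔼 s : Fin n → ι → Bool,
        1 / Δ ^ 2 * (signVec (s t) ⬝ᵥ (N *ᵥ signVec (s t)) - N.trace) ^ 2 ≤
        2 * frobSq N / Δ ^ 2 := by
      intro t
      rw [expect_fin_apply n t
        (fun s => 1 / Δ ^ 2 * (signVec s ⬝ᵥ (N *ᵥ signVec s) - N.trace) ^ 2),
        ← Finset.mul_expect]
      refine (mul_le_mul_of_nonneg_left (expect_sq_quadratic_sub_trace_le N hN)
        (by positivity)).trans (le_of_eq (by ring))
    refine (Finset.sum_le_sum fun t _ => h2 t).trans (le_of_eq ?_)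
    simp

end Iterate

open ProbabilityTheory

/-! ### Standard Gaussian vectors: one-dimensional marginals, moments, small balls. -/

section GaussianVector

/-- The law of a vector of independent standard Gaussians. -/
noncomputable def gauss (ι : Type*) [Fintype ι] : Measure (ι → ℝ) :=
  Measure.pi fun _ => gaussianReal 0 1

instance (ι : Type*) [Fintype ι] : IsProbabilityMeasure (gauss ι) := by
  unfold gauss; infer_instance

variable {ι : Type*} [Fintype ι]

lemma gauss_map_dot (u : ι → ℝ) :
    (gauss ι).map (fun x => u ⬝ᵥ x) = gaussianReal 0 (u ⬝ᵥ u).toNNReal := by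
  set L : StrongDual ℝ (EuclideanSpace ℝ ι) := innerSL ℝ (WithLp.toLp 2 u) with hL
  have h1 := IsGaussian.map_eq_gaussianReal (μ := stdGaussian (EuclideanSpace ℝ ι)) L
  rw [integral_strongDual_stdGaussian, variance_dual_stdGaussian, ← map_pi_eq_stdGaussian,
    Measure.map_map (by fun_prop) (by fun_prop)] at h1
  have h2 : ‖L‖ ^ 2 = u ⬝ᵥ u := by
    rw [hL, innerSL_apply_norm, EuclideanSpace.real_norm_sq_eq]
    simp [dotProduct, sq]
  rw [h2] at h1
  rw [← h1, gauss]
  congr 1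
  ext x
  simp [hL, PiLp.inner_apply, dotProduct, mul_comm]

lemma gauss_map_dot' (u : ι → ℝ) :
    (gauss ι).map (fun x => u ⬝ᵥ x) = (gaussianReal 0 1).map (fun z => √(u ⬝ᵥ u) * z) := by
  rw [gauss_map_dot, gaussianReal_map_const_mul, mul_zero]
  congr 1
  ext
  have h := dotProduct_self_nonneg' u
  simp [Real.coe_toNNReal _ h, Real.sq_sqrt h]

lemma measurable_dot (u : ι → ℝ) : Measurable (fun x : ι → ℝ => u ⬝ᵥ x) := by
  unfold dotProduct; fun_prop

lemma integral_comp_dot (u : ι → ℝ) {f : ℝ → ℝ} (hf : Measurable f) :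
    ∫ x, f (u ⬝ᵥ x) ∂(gauss ι) = ∫ z, f (√(u ⬝ᵥ u) * z) ∂(gaussianReal 0 1) := by
  rw [← integral_map (μ := gauss ι) (φ := fun x => u ⬝ᵥ x) (measurable_dot u).aemeasurable
    hf.aestronglyMeasurable, gauss_map_dot', integral_map (by fun_prop) hf.aestronglyMeasurable]

lemma integrable_dot_pow (u : ι → ℝ) (n : ℕ) : Integrable (fun x => (u ⬝ᵥ x) ^ n) (gauss ι) := by
  have h1 : Integrable (fun z : ℝ => z ^ n) ((gauss ι).map (fun x => u ⬝ᵥ x)) := by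
    rw [gauss_map_dot]
    have := (memLp_id_gaussianReal (μ := 0) (v := (u ⬝ᵥ u).toNNReal) n).integrable_norm_pow'
    refine (integrable_norm_iff (by fun_prop)).1 ?_
    simpa using this
  exact h1.comp_measurable (measurable_dot u)

lemma integral_sq_gaussianReal : ∫ z, z ^ 2 ∂(gaussianReal 0 1) = 1 := by
  have := variance_fun_id_gaussianReal (μ := 0) (v := 1)
  rw [variance_eq_integral measurable_id'.aemeasurable] at this
  simpa [integral_id_gaussianReal] using this

lemma integral_pow_four_gaussianReal : ∫ z, z ^ 4 ∂(gaussianReal 0 1) = 3 := by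
  rw [integral_gaussianReal_eq_integral_smul (by norm_num)]
  simp only [gaussianPDFReal, smul_eq_mul, NNReal.coe_one, mul_one, sub_zero]
  have h1 : ∀ x : ℝ, (√(2 * Real.pi))⁻¹ * Real.exp (-x ^ 2 / 2) * x ^ 4 =
      (√(2 * Real.pi))⁻¹ * ((fun y : ℝ => y ^ (4 : ℝ) * Real.exp (-(1 / 2) * y ^ (2 : ℝ))) |x|) := by
    intro x
    have : |x| ^ (4 : ℝ) = x ^ 4 := by
      rw [show (4 : ℝ) = ((4 : ℕ) : ℝ) by norm_num, Real.rpow_natCast]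
      exact (even_two_mul 2).pow_abs x
    simp only [this, Real.rpow_two, sq_abs]
    rw [show -x ^ 2 / 2 = -(1 / 2) * x ^ 2 by ring]
    ring
  simp only [h1]
  rw [integral_const_mul,
    integral_comp_abs (f := fun y : ℝ => y ^ (4 : ℝ) * Real.exp (-(1 / 2) * y ^ (2 : ℝ))),
    integral_rpow_mul_exp_neg_mul_rpow (by norm_num) (by norm_num) (by norm_num)]
  have h2 : Real.Gamma ((4 + 1) / 2) = 3 / 4 * √Real.pi := by
    rw [show ((4 : ℝ) + 1) / 2 = 1 / 2 + 1 + 1 by norm_num, Real.Gamma_add_one (by norm_num),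
      Real.Gamma_add_one (by norm_num), Real.Gamma_one_half_eq]
    ring
  have h3 : ((1 : ℝ) / 2) ^ (-((4 : ℝ) + 1) / 2) = 4 * √2 := by
    rw [show -((4 : ℝ) + 1) / 2 = -(2 + 1 / 2) by norm_num, one_div, Real.inv_rpow (by norm_num),
      ← Real.rpow_neg (by norm_num), neg_neg, Real.rpow_add (by norm_num), Real.sqrt_eq_rpow]
    norm_num
  rw [h2, h3, Real.sqrt_mul (by norm_num)]
  have := Real.pi_pos
  field_simp

lemma integral_dot_sq (u : ι → ℝ) : ∫ x, (u ⬝ᵥ x) ^ 2 ∂(gauss ι) = u ⬝ᵥ u := by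
  rw [integral_comp_dot u (f := fun z => z ^ 2) (by fun_prop)]
  simp only [mul_pow]
  rw [integral_const_mul, integral_sq_gaussianReal, mul_one,
    Real.sq_sqrt (dotProduct_self_nonneg' u)]

lemma integral_dot_pow_four (u : ι → ℝ) : ∫ x, (u ⬝ᵥ x) ^ 4 ∂(gauss ι) = 3 * (u ⬝ᵥ u) ^ 2 := by
  rw [integral_comp_dot u (f := fun z => z ^ 4) (by fun_prop)]
  simp only [mul_pow]
  rw [integral_const_mul, integral_pow_four_gaussianReal,
    show (√(u ⬝ᵥ u)) ^ 4 = ((√(u ⬝ᵥ u)) ^ 2) ^ 2 by ring,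
    Real.sq_sqrt (dotProduct_self_nonneg' u)]
  ring

/-- The density is at most `1/√(2π) ≤ 1/2` and the interval has length `2s`. -/
lemma gaussianReal_real_Icc_le {s : ℝ} (hs : 0 ≤ s) :
    (gaussianReal 0 1).real (Set.Icc (-s) s) ≤ s := by
  rw [Measure.real, gaussianReal_apply_eq_integral 0 (by norm_num)]
  rw [ENNReal.toReal_ofReal (integral_nonneg fun _ => gaussianPDFReal_nonneg _ _ _)]
  have h1 : ∀ x, gaussianPDFReal 0 1 x ≤ 1 / 2 := by
    intro x
    simp only [gaussianPDFReal, NNReal.coe_one, mul_one, sub_zero]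
    have h2 : Real.exp (-x ^ 2 / 2) ≤ 1 := Real.exp_le_one_iff.2 (by nlinarith [sq_nonneg x])
    have h3 : (√(2 * Real.pi))⁻¹ ≤ 1 / 2 := by
      rw [one_div]
      apply inv_anti₀ (by norm_num)
      apply Real.le_sqrt_of_sq_le
      nlinarith [Real.pi_gt_three]
    calc _ ≤ (1 / 2 : ℝ) * 1 := mul_le_mul h3 h2 (Real.exp_pos _).le (by norm_num)
      _ = _ := by norm_num
  calc ∫ x in Set.Icc (-s) s, gaussianPDFReal 0 1 x ≤ ∫ x in Set.Icc (-s) s, (1 / 2 : ℝ) :=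
        setIntegral_mono (integrable_gaussianPDFReal 0 1).integrableOn (by simp) h1
    _ = s := by
      simp [Measure.real, Real.volume_Icc, ENNReal.toReal_ofReal (show 0 ≤ s + s by linarith)]
      ring

lemma gauss_small_ball {u : ι → ℝ} (hu : u ⬝ᵥ u = 1) {s : ℝ} (hs : 0 ≤ s) :
    (gauss ι).real {x | (u ⬝ᵥ x) ^ 2 ≤ s ^ 2} ≤ s := by
  have h1 : {x : ι → ℝ | (u ⬝ᵥ x) ^ 2 ≤ s ^ 2} = (fun x => u ⬝ᵥ x) ⁻¹' Set.Icc (-s) s := by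
    ext x
    simp only [Set.mem_ofPred_eq, Set.mem_preimage, Set.mem_Icc]
    exact (sq_le_sq.trans (by rw [abs_of_nonneg hs])).trans abs_le
  rw [h1, ← map_measureReal_apply (measurable_dot u) measurableSet_Icc, gauss_map_dot, hu]
  simpa using gaussianReal_real_Icc_le hs

end GaussianVector

/-! ### Sums of independent variables; resampling a coordinate. -/

section IndependentSum
variable {E κ : Type*} [MeasurableSpace E] [Fintype κ] {ν : Measure E} [IsProbabilityMeasure ν]

lemma memLp_sum_pi {f : E → ℝ} (hf : MemLp f 2 ν) (c : κ → ℝ) :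
    MemLp (fun x : κ → E => ∑ i, c i * f (x i)) 2 (Measure.pi fun _ => ν) := by
  refine memLp_finsetSum _ fun i _ => ?_
  exact (hf.comp_measurePreserving (measurePreserving_eval (fun _ => ν) i)).const_mul (c i)

lemma integral_sum_pi {f : E → ℝ} (hf : MemLp f 2 ν) (h0 : ∫ x, f x ∂ν = 0) (c : κ → ℝ) :
    ∫ x : κ → E, ∑ i, c i * f (x i) ∂(Measure.pi fun _ => ν) = 0 := by
  rw [integral_finsetSum]
  · refine Finset.sum_eq_zero fun i _ => ?_
    rw [integral_const_mul, integral_comp_eval (μ := fun _ => ν) (i := i) hf.aestronglyMeasurable,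
      h0, mul_zero]
  · exact fun i _ => ((hf.comp_measurePreserving
      (measurePreserving_eval (fun _ => ν) i)).integrable (by norm_num)).const_mul (c i)

lemma integral_sq_sum_pi {f : E → ℝ} (hf : MemLp f 2 ν) (h0 : ∫ x, f x ∂ν = 0) (c : κ → ℝ) :
    ∫ x : κ → E, (∑ i, c i * f (x i)) ^ 2 ∂(Measure.pi fun _ => ν) =
      (∑ i, c i ^ 2) * ∫ x, f x ^ 2 ∂ν := by
  have h1 := variance_sum_pi (μ := fun _ : κ => ν) (X := fun i x => c i * f x)
    (fun i => hf.const_mul (c i))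
  have h2 : (∑ i, fun ω : κ → E => c i * f (ω i)) = fun ω => ∑ i, c i * f (ω i) := by
    ext ω; simp
  rw [h2, variance_eq_integral (memLp_sum_pi hf c).aestronglyMeasurable.aemeasurable,
    integral_sum_pi hf h0 c] at h1
  simp only [sub_zero] at h1
  rw [h1, Finset.sum_mul]
  refine Finset.sum_congr rfl fun i _ => ?_
  rw [variance_const_mul, variance_eq_integral hf.aestronglyMeasurable.aemeasurable, h0]
  simp

lemma chebyshev_sum_pi {f : E → ℝ} (hf : MemLp f 2 ν) (h0 : ∫ x, f x ∂ν = 0) (c : κ → ℝ)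
    {v t : ℝ} (hv : ∫ x, f x ^ 2 ∂ν ≤ v) (ht : 0 < t) :
    (Measure.pi fun _ : κ => ν).real {x | t ≤ |∑ i, c i * f (x i)|} ≤
      v * (∑ i, c i ^ 2) / t ^ 2 := by
  have h1 := mul_meas_ge_le_integral_of_nonneg
    (μ := Measure.pi fun _ : κ => ν) (f := fun x => (∑ i, c i * f (x i)) ^ 2)
    (Filter.Eventually.of_forall fun x => sq_nonneg _) (memLp_sum_pi hf c).integrable_sq (t ^ 2)
  rw [integral_sq_sum_pi hf h0 c] at h1
  have h2 : {x : κ → E | t ^ 2 ≤ (∑ i, c i * f (x i)) ^ 2} =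
      {x | t ≤ |∑ i, c i * f (x i)|} := by
    ext x
    simp only [Set.mem_ofPred_eq]
    rw [sq_le_sq, abs_of_pos ht]
  rw [h2] at h1
  rw [le_div_iff₀ (by positivity), mul_comm]
  refine h1.trans ?_
  rw [mul_comm]
  exact mul_le_mul_of_nonneg_right hv (Finset.sum_nonneg fun _ _ => sq_nonneg _)

/-- Replacing one coordinate by a fresh copy keeps the product law. This makes a chosen row of the
Gaussian matrix explicitly independent of the others. -/
lemma measurePreserving_update_pi [DecidableEq κ] (i : κ) :
    MeasurePreserving (fun p : E × (κ → E) => Function.update p.2 i p.1)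
      (ν.prod (Measure.pi fun _ => ν)) (Measure.pi fun _ => ν) := by
  have hm : Measurable (fun p : E × (κ → E) => Function.update p.2 i p.1) := by
    refine measurable_pi_lambda _ fun j => ?_
    by_cases h : j = i
    · subst h; simpa using measurable_fst
    · simp only [Function.update_of_ne h]
      exact (measurable_pi_apply j).comp measurable_snd
  refine ⟨hm, (Measure.pi_eq fun s hs => ?_).symm⟩
  rw [Measure.map_apply hm (MeasurableSet.univ_pi hs)]
  have h1 : (fun p : E × (κ → E) => Function.update p.2 i p.1) ⁻¹' (Set.univ.pi s) =
      s i ×ˢ Set.univ.pi (Function.update s i Set.univ) := by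
    ext p
    simp only [Set.mem_preimage, Set.mem_pi, Set.mem_univ, forall_true_left, Set.mem_prod]
    constructor
    · intro h
      refine ⟨by simpa using h i, fun j => ?_⟩
      by_cases hj : j = i
      · subst hj; simp
      · simpa [hj] using h j
    · rintro ⟨h1, h2⟩ j
      by_cases hj : j = i
      · subst hj; simpa using h1
      · simpa [hj] using h2 j
  rw [h1, Measure.prod_prod, Measure.pi_pi, ← Finset.mul_prod_erase _ _ (Finset.mem_univ i),
    ← Finset.mul_prod_erase (a := i) (s := Finset.univ) _ (Finset.mem_univ i)]
  simp only [Function.update_self, measure_univ, one_mul]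
  congr 1
  refine Finset.prod_congr rfl fun j hj => ?_
  rw [Function.update_of_ne (Finset.ne_of_mem_erase hj)]

end IndependentSum

/-- Conditioning on the first factor: outside the bad set `B` every section is small. Since `B` need
not be measurable, its measurable hull is used in the integral. -/
lemma measureReal_prod_le {α β : Type*} [MeasurableSpace α] [MeasurableSpace β] {μ : Measure α}
    {ν : Measure β} [IsProbabilityMeasure μ] [IsProbabilityMeasure ν] {S : Set (α × β)}
    (hS : MeasurableSet S) {B : Set α} {a b : ℝ} (hb0 : 0 ≤ b) (hB : μ.real B ≤ a)
    (hb : ∀ x ∉ B, ν.real {y | (x, y) ∈ S} ≤ b) : (μ.prod ν).real S ≤ a + b := by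
  have h1 : (μ.prod ν) S ≤ μ B + ENNReal.ofReal b := by
    rw [Measure.prod_apply hS]
    calc ∫⁻ x, ν (Prod.mk x ⁻¹' S) ∂μ
        ≤ ∫⁻ x, ((toMeasurable μ B).indicator (fun _ => 1) x + ENNReal.ofReal b) ∂μ := by
          refine lintegral_mono fun x => ?_
          by_cases hx : x ∈ toMeasurable μ B
          · simp only [hx, Set.indicator_of_mem]
            exact le_add_right prob_le_one
          · have hx' : x ∉ B := fun h => hx (subset_toMeasurable μ B h)
            simp only [hx, not_false_eq_true, Set.indicator_of_notMem, zero_add]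
            rw [← ofReal_measureReal]
            exact ENNReal.ofReal_le_ofReal (hb x hx')
      _ = μ B + ENNReal.ofReal b := by
          rw [lintegral_add_right _ measurable_const,
            lintegral_indicator (measurableSet_toMeasurable μ B)]
          simp
  have h2 : (μ.prod ν).real S ≤ (μ B + ENNReal.ofReal b).toReal :=
    ENNReal.toReal_mono (by simp [measure_ne_top]) h1
  rw [ENNReal.toReal_add (measure_ne_top _ _) ENNReal.ofReal_ne_top,
    ENNReal.toReal_ofReal hb0] at h2
  exact h2.trans (add_le_add_left hB _)

/-! ### Mixed second and fourth moments of Gaussian linear forms. -/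

section GaussianRows
variable {ι : Type*} [Fintype ι]

lemma memLp_dot_sq (u : ι → ℝ) : MemLp (fun x => (u ⬝ᵥ x) ^ 2) 2 (gauss ι) := by
  rw [memLp_two_iff_integrable_sq (integrable_dot_pow u 2).aestronglyMeasurable]
  simpa [← pow_mul] using integrable_dot_pow u 4

lemma memLp_dot_sq_sub (u : ι → ℝ) :
    MemLp (fun x => (u ⬝ᵥ x) ^ 2 - u ⬝ᵥ u) 2 (gauss ι) :=
  (memLp_dot_sq u).sub (memLp_const _)

lemma integral_dot_sq_sub (u : ι → ℝ) : ∫ x, ((u ⬝ᵥ x) ^ 2 - u ⬝ᵥ u) ∂(gauss ι) = 0 := by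
  rw [integral_sub (integrable_dot_pow u 2) (integrable_const _), integral_dot_sq]
  simp

lemma integral_sq_dot_sq_sub (u : ι → ℝ) :
    ∫ x, ((u ⬝ᵥ x) ^ 2 - u ⬝ᵥ u) ^ 2 ∂(gauss ι) = 2 * (u ⬝ᵥ u) ^ 2 := by
  have h : ∀ x : ι → ℝ, ((u ⬝ᵥ x) ^ 2 - u ⬝ᵥ u) ^ 2 =
      (u ⬝ᵥ x) ^ 4 - 2 * (u ⬝ᵥ u) * (u ⬝ᵥ x) ^ 2 + (u ⬝ᵥ u) ^ 2 := fun x => by ring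
  simp only [h]
  have hi : Integrable (fun x => (u ⬝ᵥ x) ^ 4 - 2 * (u ⬝ᵥ u) * (u ⬝ᵥ x) ^ 2) (gauss ι) :=
    (integrable_dot_pow u 4).sub ((integrable_dot_pow u 2).const_mul _)
  rw [integral_add hi (integrable_const _), integral_sub (integrable_dot_pow u 4)
    ((integrable_dot_pow u 2).const_mul _), integral_const_mul, integral_dot_sq,
    integral_dot_pow_four]
  simp
  ring

lemma integrable_dot_mul_dot (u v : ι → ℝ) :
    Integrable (fun x => (u ⬝ᵥ x) * (v ⬝ᵥ x)) (gauss ι) := by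
  have h : (fun x : ι → ℝ => (u ⬝ᵥ x) * (v ⬝ᵥ x)) =
      fun x => (((u + v) ⬝ᵥ x) ^ 2 - ((u - v) ⬝ᵥ x) ^ 2) / 4 := by
    ext x; simp only [add_dotProduct, sub_dotProduct]; ring
  rw [h]
  exact ((integrable_dot_pow _ 2).sub (integrable_dot_pow _ 2)).div_const _

lemma integral_dot_mul_dot (u v : ι → ℝ) :
    ∫ x, (u ⬝ᵥ x) * (v ⬝ᵥ x) ∂(gauss ι) = u ⬝ᵥ v := by
  have h : (fun x : ι → ℝ => (u ⬝ᵥ x) * (v ⬝ᵥ x)) =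
      fun x => (((u + v) ⬝ᵥ x) ^ 2 - ((u - v) ⬝ᵥ x) ^ 2) / 4 := by
    ext x; simp only [add_dotProduct, sub_dotProduct]; ring
  rw [h, integral_div, integral_sub (integrable_dot_pow _ 2) (integrable_dot_pow _ 2),
    integral_dot_sq, integral_dot_sq]
  simp only [add_dotProduct, sub_dotProduct, dotProduct_add, dotProduct_sub, dotProduct_comm v u]
  ring

lemma measurable_dot_mul_dot (u v : ι → ℝ) :
    Measurable (fun x : ι → ℝ => (u ⬝ᵥ x) * (v ⬝ᵥ x)) :=
  (measurable_dot u).mul (measurable_dot v)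

lemma integrable_dot_sq_mul_dot_sq (u v : ι → ℝ) :
    Integrable (fun x => (u ⬝ᵥ x) ^ 2 * (v ⬝ᵥ x) ^ 2) (gauss ι) := by
  refine (((integrable_dot_pow u 4).add (integrable_dot_pow v 4)).div_const 2).mono'
    (((measurable_dot u).pow_const 2).mul ((measurable_dot v).pow_const 2)).aestronglyMeasurable
    (Filter.Eventually.of_forall fun x => ?_)
  rw [Real.norm_of_nonneg (by positivity)]
  simp only [Pi.add_apply]
  nlinarith [sq_nonneg ((u ⬝ᵥ x) ^ 2 - (v ⬝ᵥ x) ^ 2)]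

lemma integral_dot_sq_mul_dot_sq_le (u v : ι → ℝ) :
    ∫ x, (u ⬝ᵥ x) ^ 2 * (v ⬝ᵥ x) ^ 2 ∂(gauss ι) ≤ 3 * ((u ⬝ᵥ u) * (v ⬝ᵥ v)) := by
  have hu := dotProduct_self_nonneg' u
  have hv := dotProduct_self_nonneg' v
  rcases hu.eq_or_lt with h0 | hu'
  · have : u = 0 := dotProduct_self_eq_zero.1 h0.symm
    subst this; simp
  rcases hv.eq_or_lt with h0 | hv'
  · have : v = 0 := dotProduct_self_eq_zero.1 h0.symm
    subst this; simp
  set a := u ⬝ᵥ u with ha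
  set b := v ⬝ᵥ v with hb
  -- AM–GM with weights `b/a` and `a/b`, so that the two fourth moments `3a²` and `3b²` balance to
  -- `3ab`.
  have h1 : ∀ x : ι → ℝ, (u ⬝ᵥ x) ^ 2 * (v ⬝ᵥ x) ^ 2 ≤
      (b / a * (u ⬝ᵥ x) ^ 4 + a / b * (v ⬝ᵥ x) ^ 4) / 2 := by
    intro x
    have e : (b / a * (u ⬝ᵥ x) ^ 4 + a / b * (v ⬝ᵥ x) ^ 4) / 2 - (u ⬝ᵥ x) ^ 2 * (v ⬝ᵥ x) ^ 2 =
      (b * (u ⬝ᵥ x) ^ 2 - a * (v ⬝ᵥ x) ^ 2) ^ 2 / (2 * a * b) := by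
      field_simp; ring
    have : 0 ≤ (b * (u ⬝ᵥ x) ^ 2 - a * (v ⬝ᵥ x) ^ 2) ^ 2 / (2 * a * b) := by positivity
    linarith
  have hi : Integrable (fun x => (b / a * (u ⬝ᵥ x) ^ 4 + a / b * (v ⬝ᵥ x) ^ 4) / 2) (gauss ι) :=
    (((integrable_dot_pow u 4).const_mul _).add ((integrable_dot_pow v 4).const_mul _)).div_const 2
  refine (integral_mono (integrable_dot_sq_mul_dot_sq u v) hi h1).trans (le_of_eq ?_)
  rw [integral_div, integral_add ((integrable_dot_pow u 4).const_mul _)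
    ((integrable_dot_pow v 4).const_mul _), integral_const_mul, integral_const_mul,
    integral_dot_pow_four, integral_dot_pow_four, ← ha, ← hb]
  field_simp; ring

end GaussianRows

/-! ### Gaussian matrices, rotation invariance and the bilinear sketch. -/

section Sketch
variable {ι κ : Type*} [Fintype ι] [Fintype κ]

/-- The law of a matrix of independent standard Gaussians, as the vector of its rows. -/
noncomputable def gaussRows (κ ι : Type*) [Fintype κ] [Fintype ι] : Measure (κ → ι → ℝ) :=
  Measure.pi fun _ => gauss ι

instance (κ ι : Type*) [Fintype κ] [Fintype ι] : IsProbabilityMeasure (gaussRows κ ι) := by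
  unfold gaussRows; infer_instance

lemma gauss_map_curry : (gauss (κ × ι)).map Function.curry = gaussRows κ ι := by
  have h1 : (gaussRows κ ι).map Function.uncurry = gauss (κ × ι) := by
    refine (Measure.pi_eq fun s hs => ?_).symm
    rw [Measure.map_apply measurable_uncurry (MeasurableSet.univ_pi hs)]
    have h2 : Function.uncurry ⁻¹' (Set.univ.pi s) =
        Set.univ.pi fun i : κ => Set.univ.pi fun a : ι => s (i, a) := by
      ext x
      simp [Set.mem_pi, Function.uncurry]
    rw [h2, gaussRows, Measure.pi_pi]
    simp only [gauss, Measure.pi_pi]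
    rw [Fintype.prod_prod_type]
  rw [← h1, Measure.map_map measurable_curry measurable_uncurry]
  exact Measure.map_id

lemma gauss_map_of_dotProduct_self {f : (ι → ℝ) →ₗ[ℝ] (ι → ℝ)}
    (hf : ∀ x, f x ⬝ᵥ f x = x ⬝ᵥ x) : (gauss ι).map f = gauss ι := by
  let g : EuclideanSpace ℝ ι →ₗᵢ[ℝ] EuclideanSpace ℝ ι :=
    { toLinearMap := (WithLp.linearEquiv 2 ℝ (ι → ℝ)).symm.toLinearMap ∘ₗ f ∘ₗ
        (WithLp.linearEquiv 2 ℝ (ι → ℝ)).toLinearMap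
      norm_map' := fun x => by
        have h1 : ∀ y : EuclideanSpace ℝ ι, ‖y‖ = √(WithLp.ofLp y ⬝ᵥ WithLp.ofLp y) := fun y => by
          rw [EuclideanSpace.norm_eq]; simp [dotProduct, sq]
        rw [h1, h1]
        congr 1
        exact hf (WithLp.ofLp x) }
  have h1 := stdGaussian_map (g.toLinearIsometryEquiv rfl)
  rw [← map_pi_eq_stdGaussian, Measure.map_map (by fun_prop) (by fun_prop)] at h1
  have h2 := congrArg (Measure.map (WithLp.ofLp (p := 2) (V := ι → ℝ))) h1
  rw [Measure.map_map (by fun_prop) (by fun_prop),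
    Measure.map_map (by fun_prop) (by fun_prop)] at h2
  have e1 : (WithLp.ofLp (p := 2) (V := ι → ℝ)) ∘ (WithLp.toLp 2) = id := rfl
  have e2 : (WithLp.ofLp (p := 2) (V := ι → ℝ)) ∘
      ((g.toLinearIsometryEquiv rfl : EuclideanSpace ℝ ι → EuclideanSpace ℝ ι) ∘
        (WithLp.toLp 2)) = f := rfl
  rw [e1, e2, Measure.map_id] at h2
  exact h2

variable [DecidableEq κ]

/-- Left multiplication by `O` rotates every column, hence is an isometry of the space of all
entries, and the standard Gaussian law is invariant under isometries. -/
lemma measurePreserving_gaussRows (O : Matrix κ κ ℝ) (hO : Oᵀ * O = 1) :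
    MeasurePreserving (fun (G : κ → ι → ℝ) i a => ∑ j, O i j * G j a)
      (gaussRows κ ι) (gaussRows κ ι) := by
  have hm : Measurable (fun (G : κ → ι → ℝ) (i : κ) (a : ι) => ∑ j, O i j * G j a) := by fun_prop
  refine ⟨hm, ?_⟩
  let f : (κ × ι → ℝ) →ₗ[ℝ] (κ × ι → ℝ) :=
    { toFun := fun x p => ∑ j, O p.1 j * x (j, p.2)
      map_add' := fun x y => by ext p; simp [mul_add, Finset.sum_add_distrib]
      map_smul' := fun c x => by
        ext p; simp [Finset.mul_sum, mul_left_comm] }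
  have hf : ∀ x, f x ⬝ᵥ f x = x ⬝ᵥ x := by
    intro x
    have h1 : ∀ y : κ × ι → ℝ, y ⬝ᵥ y = ∑ a, (fun i => y (i, a)) ⬝ᵥ (fun i => y (i, a)) := by
      intro y
      simp only [dotProduct]
      rw [Fintype.sum_prod_type, Finset.sum_comm]
    rw [h1, h1]
    refine Finset.sum_congr rfl fun a _ => ?_
    have h2 : (fun i => f x (i, a)) = O *ᵥ (fun i => x (i, a)) := rfl
    rw [h2, Matrix.dotProduct_mulVec, ← Matrix.mulVec_transpose, Matrix.mulVec_mulVec, hO,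
      Matrix.one_mulVec]
  have h3 := gauss_map_of_dotProduct_self hf
  rw [← gauss_map_curry, Measure.map_map hm measurable_curry]
  nth_rewrite 2 [← h3]
  rw [Measure.map_map measurable_curry (by exact (LinearMap.continuous_of_finiteDimensional f).measurable)]
  rfl

/-- The bilinear sketch `Gᵀ A G`. -/
def sketch (A : Matrix κ κ ℝ) (G : κ → ι → ℝ) : Matrix ι ι ℝ :=
  (Matrix.of G)ᵀ * A * Matrix.of G

/-- Reduction to diagonal matrices, by substituting `OG` for `G`. The substitution is set up as a
measurable equivalence because `P` is an arbitrary set. -/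
lemma gaussRows_sketch_eq (O A : Matrix κ κ ℝ) (hO : O * Oᵀ = 1) (P : Set (Matrix ι ι ℝ)) :
    (gaussRows κ ι).real {G | sketch (Oᵀ * A * O) G ∈ P} =
      (gaussRows κ ι).real {G | sketch A G ∈ P} := by
  have hO' : Oᵀ * O = 1 := mul_eq_one_comm.1 hO
  let e : (κ → ι → ℝ) ≃ᵐ (κ → ι → ℝ) :=
    { toFun := fun G i a => ∑ j, O i j * G j a
      invFun := fun G i a => ∑ j, Oᵀ i j * G j a
      left_inv := fun G => by
        have : Oᵀ * (O * Matrix.of G) = Matrix.of G := by rw [← Matrix.mul_assoc, hO', Matrix.one_mul]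
        exact congrArg Matrix.of.symm this
      right_inv := fun G => by
        have : O * (Oᵀ * Matrix.of G) = Matrix.of G := by rw [← Matrix.mul_assoc, hO, Matrix.one_mul]
        exact congrArg Matrix.of.symm this
      measurable_toFun := by
        change Measurable fun (G : κ → ι → ℝ) (i : κ) (a : ι) => ∑ j, O i j * G j a
        fun_prop
      measurable_invFun := by
        change Measurable fun (G : κ → ι → ℝ) (i : κ) (a : ι) => ∑ j, Oᵀ i j * G j a
        fun_prop }
  have he : MeasurePreserving e (gaussRows κ ι) (gaussRows κ ι) := measurePreserving_gaussRows O hO'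
  have h1 : {G : κ → ι → ℝ | sketch (Oᵀ * A * O) G ∈ P} = e ⁻¹' {G | sketch A G ∈ P} := by
    ext G
    have : sketch A (e G) = sketch (Oᵀ * A * O) G := by
      have h2 : Matrix.of (e G) = O * Matrix.of G := rfl
      rw [sketch, sketch, h2, Matrix.transpose_mul]
      simp only [Matrix.mul_assoc]
    simp [this]
  rw [h1, Measure.real, he.measure_preimage_equiv, Measure.real]

end Sketch

/-! ### Deviations of the sketch of a diagonal matrix. -/

section DiagonalSketch
variable {ι κ : Type*} [Fintype ι] [DecidableEq ι] [Fintype κ] [DecidableEq κ]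

/-- The centred bilinear sketch of a diagonal matrix. -/
def diagSketch (lam : κ → ℝ) (G : κ → ι → ℝ) : Matrix ι ι ℝ :=
  sketch (Matrix.diagonal lam) G - (∑ i, lam i) • 1

lemma sketch_diagonal_apply (lam : κ → ℝ) (G : κ → ι → ℝ) (a b : ι) :
    sketch (Matrix.diagonal lam) G a b = ∑ i, lam i * (G i a * G i b) := by
  rw [sketch, Matrix.mul_apply]
  simp only [Matrix.mul_diagonal, Matrix.transpose_apply, Matrix.of_apply]
  exact Finset.sum_congr rfl fun i _ => by ring

lemma diagSketch_apply (lam : κ → ℝ) (G : κ → ι → ℝ) (a b : ι) :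
    diagSketch lam G a b = ∑ i, lam i * ((Pi.single a 1 ⬝ᵥ G i) * (Pi.single b 1 ⬝ᵥ G i) -
      Pi.single a (1 : ℝ) ⬝ᵥ Pi.single b 1) := by
  rw [diagSketch, Matrix.sub_apply, sketch_diagonal_apply, Matrix.smul_apply, smul_eq_mul,
    Finset.sum_mul, ← Finset.sum_sub_distrib]
  refine Finset.sum_congr rfl fun i _ => ?_
  simp only [single_one_dotProduct, Matrix.one_apply, Pi.single_apply]
  ring

lemma quadratic_diagSketch (lam : κ → ℝ) (G : κ → ι → ℝ) (x : ι → ℝ) :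
    x ⬝ᵥ (diagSketch lam G *ᵥ x) = ∑ i, lam i * ((x ⬝ᵥ G i) ^ 2 - x ⬝ᵥ x) := by
  have h1 : sketch (Matrix.diagonal lam) G *ᵥ x =
      (Matrix.of G)ᵀ *ᵥ (Matrix.diagonal lam *ᵥ (Matrix.of G *ᵥ x)) := by
    rw [sketch, Matrix.mulVec_mulVec, Matrix.mulVec_mulVec, Matrix.mul_assoc]
  rw [diagSketch, Matrix.sub_mulVec, dotProduct_sub, h1, Matrix.dotProduct_mulVec,
    Matrix.vecMul_transpose, Matrix.smul_mulVec, Matrix.one_mulVec, dotProduct_smul, smul_eq_mul]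
  simp only [mul_sub, Finset.sum_sub_distrib, ← Finset.sum_mul]
  congr 1
  rw [dotProduct]
  refine Finset.sum_congr rfl fun i _ => ?_
  rw [Matrix.mulVec_diagonal]
  have : (Matrix.of G *ᵥ x) i = x ⬝ᵥ G i := dotProduct_comm _ _
  rw [this]
  ring

lemma memLp_dot_mul_dot_sub (u v : ι → ℝ) :
    MemLp (fun x => (u ⬝ᵥ x) * (v ⬝ᵥ x) - u ⬝ᵥ v) 2 (gauss ι) := by
  refine MemLp.sub ?_ (memLp_const _)
  rw [memLp_two_iff_integrable_sq (measurable_dot_mul_dot u v).aestronglyMeasurable]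
  simpa [mul_pow] using integrable_dot_sq_mul_dot_sq u v

lemma integral_dot_mul_dot_sub (u v : ι → ℝ) :
    ∫ x, ((u ⬝ᵥ x) * (v ⬝ᵥ x) - u ⬝ᵥ v) ∂(gauss ι) = 0 := by
  rw [integral_sub (integrable_dot_mul_dot u v) (integrable_const _), integral_dot_mul_dot]
  simp

lemma integral_sq_dot_mul_dot_sub_le (u v : ι → ℝ) :
    ∫ x, ((u ⬝ᵥ x) * (v ⬝ᵥ x) - u ⬝ᵥ v) ^ 2 ∂(gauss ι) ≤ 3 * ((u ⬝ᵥ u) * (v ⬝ᵥ v)) := by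
  have h : ∀ x : ι → ℝ, ((u ⬝ᵥ x) * (v ⬝ᵥ x) - u ⬝ᵥ v) ^ 2 =
      (u ⬝ᵥ x) ^ 2 * (v ⬝ᵥ x) ^ 2 - 2 * (u ⬝ᵥ v) * ((u ⬝ᵥ x) * (v ⬝ᵥ x)) + (u ⬝ᵥ v) ^ 2 :=
    fun x => by ring
  simp only [h]
  have hi : Integrable (fun x => (u ⬝ᵥ x) ^ 2 * (v ⬝ᵥ x) ^ 2 -
      2 * (u ⬝ᵥ v) * ((u ⬝ᵥ x) * (v ⬝ᵥ x))) (gauss ι) :=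
    (integrable_dot_sq_mul_dot_sq u v).sub ((integrable_dot_mul_dot u v).const_mul _)
  rw [integral_add hi (integrable_const _), integral_sub (integrable_dot_sq_mul_dot_sq u v)
    ((integrable_dot_mul_dot u v).const_mul _), integral_const_mul, integral_dot_mul_dot]
  have := integral_dot_sq_mul_dot_sq_le u v
  simp
  nlinarith [sq_nonneg (u ⬝ᵥ v)]

/-- Markov: each of the `k²` entries is a sum of independent centred terms with second moment at
most `3 Σ λ_i²`. -/
lemma frobSq_diagSketch_tail (lam : κ → ℝ) {t : ℝ} (ht : 0 < t) :
    (gaussRows κ ι).real {G | t ≤ frobSq (diagSketch lam G)} ≤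
      3 * (Fintype.card ι : ℝ) ^ 2 * (∑ i, lam i ^ 2) / t := by
  have hab : ∀ a b : ι, Integrable (fun G : κ → ι → ℝ => diagSketch lam G a b ^ 2)
      (gaussRows κ ι) ∧
      ∫ G, diagSketch lam G a b ^ 2 ∂(gaussRows κ ι) ≤ 3 * ∑ i, lam i ^ 2 := by
    intro a b
    simp only [diagSketch_apply]
    have hm := memLp_dot_mul_dot_sub (Pi.single a (1 : ℝ)) (Pi.single b (1 : ℝ) : ι → ℝ)
    refine ⟨(memLp_sum_pi hm lam).integrable_sq, ?_⟩
    have h1 := integral_sq_sum_pi hm (integral_dot_mul_dot_sub _ _) lam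
    have h2 := integral_sq_dot_mul_dot_sub_le (Pi.single a (1 : ℝ)) (Pi.single b (1 : ℝ) : ι → ℝ)
    rw [gaussRows, h1, mul_comm]
    refine mul_le_mul_of_nonneg_right (h2.trans ?_) (Finset.sum_nonneg fun _ _ => sq_nonneg _)
    simp
  have h1 := mul_meas_ge_le_integral_of_nonneg (μ := gaussRows κ ι)
    (f := fun G => frobSq (diagSketch lam G))
    (Filter.Eventually.of_forall fun G => frobSq_nonneg _)
    (integrable_finsetSum _ fun a _ => integrable_finsetSum _ fun b _ => (hab a b).1) t
  rw [le_div_iff₀ ht, mul_comm]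
  refine h1.trans ?_
  simp only [frobSq]
  rw [integral_finsetSum _ fun a _ => integrable_finsetSum _ fun b _ => (hab a b).1]
  have h2 : ∀ a ∈ (Finset.univ : Finset ι),
      ∫ G, ∑ b, diagSketch lam G a b ^ 2 ∂(gaussRows κ ι) ≤
      Fintype.card ι * (3 * ∑ i, lam i ^ 2) := by
    intro a _
    rw [integral_finsetSum _ fun b _ => (hab a b).1]
    refine (Finset.sum_le_sum fun b _ => (hab a b).2).trans (le_of_eq ?_)
    simp
  refine (Finset.sum_le_sum h2).trans (le_of_eq ?_)
  simp
  ring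

lemma exp_neg_le_quadratic {y : ℝ} (hy : 0 ≤ y) : Real.exp (-y) ≤ 1 - y + y ^ 2 / 2 := by
  have h1 := Real.quadratic_le_exp_of_nonneg hy
  have h2 : 0 < 1 + y + y ^ 2 / 2 := by positivity
  rw [Real.exp_neg]
  refine (inv_anti₀ h2 h1).trans ?_
  rw [inv_le_iff_one_le_mul₀ h2]
  nlinarith [sq_nonneg (y ^ 2)]

/-- For a negative exponent the quadratic Taylor polynomial is an upper bound, so second and fourth
moments suffice and no restriction on `c` from above is needed. -/
lemma integral_exp_neg_dot_sq_le (u : ι → ℝ) {c : ℝ} (hc : 0 ≤ c) :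
    ∫ x, Real.exp (-(c * (u ⬝ᵥ x) ^ 2)) ∂(gauss ι) ≤
      Real.exp (-(c * (u ⬝ᵥ u)) + 3 / 2 * (c * (u ⬝ᵥ u)) ^ 2) := by
  have hi : Integrable (fun x => 1 - c * (u ⬝ᵥ x) ^ 2 + c ^ 2 / 2 * (u ⬝ᵥ x) ^ 4) (gauss ι) :=
    ((integrable_const _).sub ((integrable_dot_pow u 2).const_mul _)).add
      ((integrable_dot_pow u 4).const_mul _)
  have hi' : Integrable (fun x => 1 - c * (u ⬝ᵥ x) ^ 2) (gauss ι) :=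
    (integrable_const _).sub ((integrable_dot_pow u 2).const_mul _)
  calc ∫ x, Real.exp (-(c * (u ⬝ᵥ x) ^ 2)) ∂(gauss ι)
      ≤ ∫ x, (1 - c * (u ⬝ᵥ x) ^ 2 + c ^ 2 / 2 * (u ⬝ᵥ x) ^ 4) ∂(gauss ι) := by
        refine integral_mono_of_nonneg (Filter.Eventually.of_forall fun x => (Real.exp_pos _).le)
          hi (Filter.Eventually.of_forall fun x => ?_)
        refine (exp_neg_le_quadratic (by positivity)).trans (le_of_eq ?_)
        ring
    _ = 1 - c * (u ⬝ᵥ u) + c ^ 2 / 2 * (3 * (u ⬝ᵥ u) ^ 2) := by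
        rw [integral_add hi' ((integrable_dot_pow u 4).const_mul _),
          integral_sub (integrable_const _) ((integrable_dot_pow u 2).const_mul _),
          integral_const_mul, integral_const_mul, integral_dot_sq, integral_dot_pow_four]
        simp
    _ ≤ _ := by
        have := Real.add_one_le_exp (-(c * (u ⬝ᵥ u)) + 3 / 2 * (c * (u ⬝ᵥ u)) ^ 2)
        linarith

/-- Chernoff bound. Nonnegativity of `lam` is essential: it makes the lower tail subgaussian at
every scale, which pays for the union bound over exponentially many grid points. -/
lemma quadratic_diagSketch_lower_tail (lam : κ → ℝ) (hlam : ∀ i, 0 ≤ lam i) (x : ι → ℝ) {F t : ℝ}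
    (hF : F ^ 2 = ∑ i, lam i ^ 2) (hF0 : 0 ≤ F) (ht : 0 < t) :
    (gaussRows κ ι).real {G | x ⬝ᵥ (diagSketch lam G *ᵥ x) < -(t * F * (x ⬝ᵥ x))} ≤
      Real.exp (-(t ^ 2 / 6)) := by
  have hx := dotProduct_self_nonneg' x
  rcases hx.eq_or_lt with h0 | hx
  · have h0' : x = 0 := dotProduct_self_eq_zero.1 h0.symm
    subst h0'
    simp [Real.exp_nonneg]
  rcases hF0.eq_or_lt with h0 | hF0
  · have h1 : ∀ i, lam i = 0 := by
      intro i
      rw [← h0] at hF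
      have h2 := (Finset.sum_eq_zero_iff_of_nonneg (fun i _ => sq_nonneg (lam i))).1
        (by rw [← hF]; norm_num) i (Finset.mem_univ i)
      exact pow_eq_zero_iff (two_ne_zero) |>.1 h2
    simp [quadratic_diagSketch, h1, ← h0, Real.exp_nonneg]
  set X := x ⬝ᵥ x with hX
  -- Minimizes the exponent `-s t F X + (3/2)(s X F)²`, whose minimum is `-t²/6`.
  set s := t / (3 * F * X) with hs
  have hs0 : 0 < s := by positivity
  have h1 : ∀ G : κ → ι → ℝ, Real.exp (-(s * (x ⬝ᵥ (diagSketch lam G *ᵥ x)))) =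
      Real.exp (s * ∑ i, lam i * X) * ∏ i, Real.exp (-(s * lam i * (x ⬝ᵥ G i) ^ 2)) := by
    intro G
    rw [quadratic_diagSketch, ← Real.exp_sum, ← Real.exp_add]
    congr 1
    simp only [mul_sub, Finset.sum_sub_distrib, Finset.sum_neg_distrib, ← hX]
    rw [Finset.mul_sum, Finset.mul_sum]
    simp only [mul_assoc]
    ring
  have hint : Integrable (fun G : κ → ι → ℝ => Real.exp (-(s * (x ⬝ᵥ (diagSketch lam G *ᵥ x)))))
      (gaussRows κ ι) := by
    simp only [h1]
    refine Integrable.const_mul ?_ _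
    refine Integrable.of_bound (C := 1) ?_ (Filter.Eventually.of_forall fun G => ?_)
    · refine Measurable.aestronglyMeasurable ?_
      refine Finset.measurable_prod _ fun i _ => ?_
      exact (((((measurable_dot x).comp (measurable_pi_apply i)).pow_const 2).const_mul _).neg).exp
    · rw [Real.norm_of_nonneg (Finset.prod_nonneg fun i _ => (Real.exp_pos _).le)]
      refine Finset.prod_le_one (fun i _ => (Real.exp_pos _).le) fun i _ => ?_
      rw [Real.exp_le_one_iff]
      have := mul_nonneg (mul_nonneg hs0.le (hlam i)) (sq_nonneg (x ⬝ᵥ G i))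
      linarith
  have hE : ∫ G, Real.exp (-(s * (x ⬝ᵥ (diagSketch lam G *ᵥ x)))) ∂(gaussRows κ ι) ≤
      Real.exp (3 / 2 * (s * X) ^ 2 * F ^ 2) := by
    simp only [h1]
    rw [integral_const_mul, gaussRows, integral_fintype_prod_eq_prod
      (f := fun i (r : ι → ℝ) => Real.exp (-(s * lam i * (x ⬝ᵥ r) ^ 2)))]
    have h2 : ∏ i, ∫ r, Real.exp (-(s * lam i * (x ⬝ᵥ r) ^ 2)) ∂(gauss ι) ≤
        ∏ i, Real.exp (-(s * lam i * X) + 3 / 2 * (s * lam i * X) ^ 2) :=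
      Finset.prod_le_prod (fun i _ => integral_nonneg fun r => (Real.exp_pos _).le)
        fun i _ => integral_exp_neg_dot_sq_le x (mul_nonneg hs0.le (hlam i))
    refine (mul_le_mul_of_nonneg_left h2 (Real.exp_pos _).le).trans (le_of_eq ?_)
    rw [← Real.exp_sum, ← Real.exp_add, Finset.sum_add_distrib, Finset.sum_neg_distrib, hF,
      Finset.mul_sum, Finset.mul_sum]
    congr 1
    rw [← add_assoc]
    have e1 : ∑ i, s * (lam i * X) = ∑ i, s * lam i * X := by simp only [mul_assoc]
    rw [e1, add_neg_cancel, zero_add]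
    exact Finset.sum_congr rfl fun i _ => by ring
  have h3 := mul_meas_ge_le_integral_of_nonneg (μ := gaussRows κ ι)
    (Filter.Eventually.of_forall fun G => (Real.exp_pos _).le) hint (Real.exp (s * (t * F * X)))
  have h4 : {G : κ → ι → ℝ | x ⬝ᵥ (diagSketch lam G *ᵥ x) < -(t * F * X)} ⊆
      {G | Real.exp (s * (t * F * X)) ≤ Real.exp (-(s * (x ⬝ᵥ (diagSketch lam G *ᵥ x))))} := by
    intro G hG
    simp only [Set.mem_ofPred_eq, Real.exp_le_exp] at hG ⊢
    nlinarith
  have h5 := measureReal_mono (μ := gaussRows κ ι) h4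
  refine h5.trans ?_
  rw [← mul_le_mul_iff_right₀ (Real.exp_pos (s * (t * F * X)))]
  refine (h3.trans hE).trans ?_
  rw [← Real.exp_add, Real.exp_le_exp]
  have e1 : s * X * F = t / 3 := by rw [hs]; field_simp
  have e2 : s * (t * F * X) = t * (t / 3) := by rw [← e1]; ring
  have e3 : 3 / 2 * (s * X) ^ 2 * F ^ 2 = 3 / 2 * (t / 3) ^ 2 := by rw [← e1]; ring
  rw [e2, e3]
  nlinarith

end DiagonalSketch

/-! ### Uniform lower bound over a grid, and the negative direction. -/

section Grid
variable {ι κ : Type*} [Fintype ι]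

/-- The points of the cubic grid of mesh `1 / k` in `[-1, 1]^k`, where `k` is the dimension. -/
noncomputable def gridPoint (j : ι → Fin (2 * Fintype.card ι + 1)) : ι → ℝ :=
  fun a => ((j a : ℕ) - (Fintype.card ι : ℝ)) / Fintype.card ι

lemma exists_gridPoint_near (hk : 0 < Fintype.card ι) {x : ι → ℝ} (hx : x ⬝ᵥ x = 1) :
    ∃ j : ι → Fin (2 * Fintype.card ι + 1),
      (x - gridPoint j) ⬝ᵥ (x - gridPoint j) ≤ 1 / Fintype.card ι := by
  set k := Fintype.card ι with hkdef
  have hk' : (0 : ℝ) < k := by exact_mod_cast hk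
  have habs : ∀ a, |x a| ≤ 1 := by
    intro a
    rw [← sq_le_one_iff_abs_le_one, ← hx, sq]
    exact Finset.single_le_sum (f := fun b => x b * x b) (fun b _ => mul_self_nonneg _)
      (Finset.mem_univ a)
  have hfl : ∀ a, -(k : ℤ) ≤ ⌊k * x a⌋ ∧ ⌊k * x a⌋ ≤ k := by
    intro a
    have := abs_le.1 (habs a)
    constructor
    · rw [Int.le_floor]; push_cast; nlinarith
    · have h1 : (⌊k * x a⌋ : ℝ) ≤ k := (Int.floor_le _).trans (by nlinarith)
      exact_mod_cast h1
  -- Each coordinate is rounded down to a multiple of `1/k`; the shift by `k` makes the index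
  -- nonnegative.
  refine ⟨fun a => ⟨(⌊k * x a⌋ + k).toNat, by have := hfl a; omega⟩, ?_⟩
  have hd : ∀ a, |x a - (((⌊k * x a⌋ + k).toNat : ℝ) - k) / k| ≤ 1 / k := by
    intro a
    have h1 : (((⌊k * x a⌋ + k).toNat : ℤ) : ℝ) = ((⌊k * x a⌋ + k : ℤ) : ℝ) := by
      rw [Int.toNat_of_nonneg (by have := hfl a; omega)]
    rw [Int.cast_natCast] at h1
    rw [h1]
    push_cast
    have h2 := Int.floor_le (k * x a)
    have h3 := Int.lt_floor_add_one (k * x a)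
    have h4 : x a - ((⌊k * x a⌋ : ℝ) + k - k) / k = (k * x a - ⌊k * x a⌋) / k := by
      field_simp; ring
    rw [h4, abs_div, abs_of_pos hk']
    apply div_le_div_of_nonneg_right _ hk'.le
    rw [abs_le]; constructor <;> linarith
  refine (Finset.sum_le_sum (g := fun _ => (1 / (k : ℝ)) ^ 2) fun a _ => ?_).trans (le_of_eq ?_)
  · rw [← sq, ← sq_abs]
    exact pow_le_pow_left₀ (abs_nonneg _) (hd a) 2
  · rw [Finset.sum_const, Finset.card_univ, ← hkdef, nsmul_eq_mul]
    field_simp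

/-- For a unit vector `y` and a grid point `p` within `1/√k`, `yᵀMy - pᵀMp = (y-p)ᵀM(y+p)`, where
`‖y+p‖ ≤ 3`, and `‖p‖² ≤ 4` gives the factor of `b`. The crude Frobenius bound `R` is enough because
it is divided by `√k`. -/
lemma quadratic_ge_of_gridPoint (hk : 0 < Fintype.card ι) {M : Matrix ι ι ℝ} (hM : M.IsSymm)
    {R b : ℝ} (hR0 : 0 ≤ R) (hR : frobSq M ≤ R ^ 2) (hb : 0 ≤ b)
    (hgrid : ∀ j, -(b * (gridPoint j ⬝ᵥ gridPoint j)) ≤ gridPoint j ⬝ᵥ (M *ᵥ gridPoint j))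
    (x : ι → ℝ) :
    -((4 * b + 3 * R / √(Fintype.card ι)) * (x ⬝ᵥ x)) ≤ x ⬝ᵥ (M *ᵥ x) := by
  have hk' : (1 : ℝ) ≤ Fintype.card ι := by exact_mod_cast hk
  have key : ∀ y : ι → ℝ, y ⬝ᵥ y = 1 →
      -(4 * b + 3 * R / √(Fintype.card ι)) ≤ y ⬝ᵥ (M *ᵥ y) := by
    intro y hy
    obtain ⟨j, hj⟩ := exists_gridPoint_near hk hy
    set p := gridPoint j with hp
    have hj1 : (y - p) ⬝ᵥ (y - p) ≤ 1 := hj.trans (by rw [div_le_one (by linarith)]; exact hk')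
    have e1 : (y - p) ⬝ᵥ (y - p) = 1 - 2 * (y ⬝ᵥ p) + p ⬝ᵥ p := by
      simp only [dotProduct_sub, sub_dotProduct, hy, dotProduct_comm p y]; ring
    have e2 : (y + p) ⬝ᵥ (y + p) = 1 + 2 * (y ⬝ᵥ p) + p ⬝ᵥ p := by
      simp only [dotProduct_add, add_dotProduct, hy, dotProduct_comm p y]; ring
    have hp0 := dotProduct_self_nonneg' p
    have hcs := dotProduct_sq_le y p
    rw [hy, one_mul] at hcs
    have hp4 : p ⬝ᵥ p ≤ 4 := by nlinarith [sq_nonneg (y ⬝ᵥ p - 2)]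
    have h9 : (y + p) ⬝ᵥ (y + p) ≤ 9 := by
      rw [e2]; nlinarith [sq_nonneg (y ⬝ᵥ p - 2)]
    have e3 : y ⬝ᵥ (M *ᵥ y) = p ⬝ᵥ (M *ᵥ p) + (y - p) ⬝ᵥ (M *ᵥ (y + p)) := by
      have : y ⬝ᵥ (M *ᵥ p) = p ⬝ᵥ (M *ᵥ y) := by
        rw [dotProduct_mulVec_symm hM, dotProduct_comm]
      simp only [Matrix.mulVec_add, dotProduct_add, sub_dotProduct, this]
      ring
    have h5 : |(y - p) ⬝ᵥ (M *ᵥ (y + p))| ≤ 3 * R / √(Fintype.card ι) := by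
      apply abs_le_of_sq_le_sq _ (by positivity)
      refine (quadratic_sq_le M (y - p) (y + p)).trans ?_
      rw [div_pow, Real.sq_sqrt (by linarith)]
      have hd0 := dotProduct_self_nonneg' (y - p)
      calc frobSq M * ((y - p) ⬝ᵥ (y - p)) * ((y + p) ⬝ᵥ (y + p))
          ≤ R ^ 2 * (1 / Fintype.card ι) * 9 := by
            refine mul_le_mul (mul_le_mul hR hj hd0 (sq_nonneg _)) h9
              (dotProduct_self_nonneg' _) (by positivity)
        _ = _ := by ring
    have h6 := neg_le_of_abs_le h5
    have h7 := hgrid j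
    rw [e3]
    nlinarith
  have hx := dotProduct_self_nonneg' x
  rcases hx.eq_or_lt with h0 | hx
  · have h0' : x = 0 := dotProduct_self_eq_zero.1 h0.symm
    subst h0'; simp
  have hs : √(x ⬝ᵥ x) ^ 2 = x ⬝ᵥ x := Real.sq_sqrt hx.le
  have hs0 : 0 < √(x ⬝ᵥ x) := Real.sqrt_pos.2 hx
  have h1 := key ((√(x ⬝ᵥ x))⁻¹ • x) (by
    simp only [smul_dotProduct, dotProduct_smul, smul_eq_mul]
    rw [← mul_assoc, ← sq, inv_pow, hs, inv_mul_cancel₀ hx.ne'])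
  simp only [Matrix.mulVec_smul, smul_dotProduct, dotProduct_smul, smul_eq_mul] at h1
  rw [← mul_assoc, ← sq, inv_pow, hs, inv_mul_eq_div, le_div_iff₀ hx] at h1
  linarith

variable [DecidableEq ι] [Fintype κ] [DecidableEq κ]

lemma diagSketch_isSymm (lam : κ → ℝ) (G : κ → ι → ℝ) : (diagSketch lam G).IsSymm := by
  refine Matrix.IsSymm.ext fun a b => ?_
  simp only [diagSketch_apply]
  refine Finset.sum_congr rfl fun i _ => ?_
  rw [dotProduct_comm (Pi.single b (1 : ℝ)) (Pi.single a 1)]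
  ring

lemma diagSketch_uniform_lower_tail (hk : 0 < Fintype.card ι) (lam : κ → ℝ)
    (hlam : ∀ i, 0 ≤ lam i) {F t R : ℝ} (hF : F ^ 2 = ∑ i, lam i ^ 2) (hF0 : 0 ≤ F) (ht : 0 < t)
    (hR : 0 ≤ R) :
    (gaussRows κ ι).real {G | frobSq (diagSketch lam G) ≤ R ^ 2 ∧
      ¬ ∀ x, -((4 * (t * F) + 3 * R / √(Fintype.card ι)) * (x ⬝ᵥ x)) ≤
        x ⬝ᵥ (diagSketch lam G *ᵥ x)} ≤
      (2 * Fintype.card ι + 1 : ℝ) ^ (Fintype.card ι) * Real.exp (-(t ^ 2 / 6)) := by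
  have h1 : {G : κ → ι → ℝ | frobSq (diagSketch lam G) ≤ R ^ 2 ∧
      ¬ ∀ x, -((4 * (t * F) + 3 * R / √(Fintype.card ι)) * (x ⬝ᵥ x)) ≤
        x ⬝ᵥ (diagSketch lam G *ᵥ x)} ⊆
      ⋃ j, {G | gridPoint j ⬝ᵥ (diagSketch lam G *ᵥ gridPoint j) <
        -(t * F * (gridPoint j ⬝ᵥ gridPoint j))} := by
    rintro G ⟨hG1, hG2⟩
    by_contra hG
    simp only [Set.mem_iUnion, Set.mem_ofPred_eq, not_exists, not_lt] at hG
    exact hG2 (quadratic_ge_of_gridPoint hk (diagSketch_isSymm lam G) hR hG1 (by positivity) hG)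
  refine (measureReal_mono h1).trans ((measureReal_iUnion_fintype_le _).trans ?_)
  refine (Finset.sum_le_sum fun j _ =>
    quadratic_diagSketch_lower_tail lam hlam (gridPoint j) hF hF0 ht).trans (le_of_eq ?_)
  simp

lemma gauss_norm_lower_tail (hk : 0 < Fintype.card ι) :
    (gauss ι).real {x | x ⬝ᵥ x ≤ Fintype.card ι / 2} ≤ 8 / Fintype.card ι := by
  have hk' : (0 : ℝ) < Fintype.card ι := by exact_mod_cast hk
  have hm : MemLp (fun z : ℝ => z ^ 2 - 1) 2 (gaussianReal 0 1) := by
    have h1 := memLp_dot_sq_sub (fun _ : Unit => (1 : ℝ))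
    have h2 : (fun z : ℝ => z ^ 2 - 1) ∘ (fun x : Unit → ℝ => (fun _ : Unit => (1 : ℝ)) ⬝ᵥ x) =
        fun x => ((fun _ : Unit => (1 : ℝ)) ⬝ᵥ x) ^ 2 -
          (fun _ : Unit => (1 : ℝ)) ⬝ᵥ (fun _ : Unit => (1 : ℝ)) := by
      ext x; simp [dotProduct]
    rw [← h2] at h1
    have h3 := (memLp_map_measure_iff (by fun_prop) (measurable_dot _).aemeasurable).2 h1
    rw [gauss_map_dot] at h3
    simpa [dotProduct] using h3
  have hi4 : Integrable (fun z : ℝ => z ^ 4) (gaussianReal 0 1) := by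
    -- The integral of a non-integrable function is 0 by convention, while this one is 3.
    by_contra h
    have := integral_undef h
    rw [integral_pow_four_gaussianReal] at this
    norm_num at this
  have hi2 : Integrable (fun z : ℝ => z ^ 2) (gaussianReal 0 1) := by
    by_contra h
    have := integral_undef h
    rw [integral_sq_gaussianReal] at this
    norm_num at this
  have h0 : ∫ z, (z ^ 2 - 1) ∂(gaussianReal 0 1) = 0 := by
    rw [integral_sub hi2 (integrable_const _), integral_sq_gaussianReal]
    simp
  have hv : ∫ z, (z ^ 2 - 1) ^ 2 ∂(gaussianReal 0 1) ≤ 2 := by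
    have h : ∀ z : ℝ, (z ^ 2 - 1) ^ 2 = z ^ 4 - 2 * z ^ 2 + 1 := fun z => by ring
    simp only [h]
    have hi : Integrable (fun z : ℝ => z ^ 4 - 2 * z ^ 2) (gaussianReal 0 1) :=
      hi4.sub (hi2.const_mul _)
    rw [integral_add hi (integrable_const _), integral_sub hi4 (hi2.const_mul _),
      integral_const_mul, integral_sq_gaussianReal, integral_pow_four_gaussianReal]
    simp
    norm_num
  have h1 := chebyshev_sum_pi (κ := ι) hm h0 (fun _ => 1) hv
    (t := Fintype.card ι / 2) (by positivity)
  refine (measureReal_mono ?_).trans (h1.trans (le_of_eq ?_))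
  · intro x hx
    simp only [Set.mem_ofPred_eq, one_mul, Finset.sum_sub_distrib] at hx ⊢
    have e : ∑ i, x i ^ 2 = x ⬝ᵥ x := by simp [dotProduct, sq]
    rw [e]
    simp only [Finset.sum_const, Finset.card_univ, nsmul_eq_mul, mul_one]
    rw [le_abs]; right; linarith
  · simp
    field_simp
    norm_num

/-- The direction is the row `g = G i₀`. With `X = ‖g‖²`, which is about `k`, it contributes
`λ_{i₀}(X² - X)`, whereas the other rows, independent of `g`, contribute a centred sum of standard
deviation at most `√2 F X`. -/
lemma diagSketch_negative_direction (lam : κ → ℝ) (i₀ : κ) {F ε : ℝ}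
    (hF : F ^ 2 = ∑ i, lam i ^ 2) (hF0 : 0 < F) (hε : 0 < ε) (hε1 : ε ≤ 1)
    (hi : lam i₀ ≤ -ε * F)
    (hk : 100 ≤ ε * Fintype.card ι) :
    (gaussRows κ ι).real {G | ¬ ∃ x : ι → ℝ, 0 < x ⬝ᵥ x ∧
      x ⬝ᵥ (diagSketch lam G *ᵥ x) ≤ -(ε * Fintype.card ι / 4 * F * (x ⬝ᵥ x))} ≤
      8 / Fintype.card ι + 1 / 200 := by
  set k : ℝ := (Fintype.card ι : ℝ) with hkdef
  have hk0 : 0 < k := by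
    by_contra h
    nlinarith
  have hkk : 100 ≤ k := by nlinarith
  have hkn : 0 < Fintype.card ι := by rw [hkdef] at hk0; exact_mod_cast hk0
  -- Zeroing the weight of `i₀` makes the noise independent of row `i₀` of the matrix, so that row
  -- can be resampled at the end.
  set c : κ → ℝ := Function.update lam i₀ 0 with hc
  have hci : c i₀ = 0 := by simp [hc]
  have hcj : ∀ j, j ≠ i₀ → c j = lam j := fun j hj => by simp [hc, hj]
  have hcs : ∑ i, c i ^ 2 ≤ F ^ 2 := by
    rw [hF]
    refine Finset.sum_le_sum fun j _ => ?_
    by_cases hj : j = i₀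
    · subst hj; rw [hci]; simpa using sq_nonneg (lam j)
    · rw [hcj j hj]
  have hmp := measurePreserving_update_pi (ν := gauss ι) (κ := κ) i₀
  -- the bad event, for the row `i₀` and the other rows
  set S : Set ((ι → ℝ) × (κ → ι → ℝ)) := {p | p.1 ⬝ᵥ p.1 ≤ k / 2 ∨
    20 * F * (p.1 ⬝ᵥ p.1) ≤ |∑ i, c i * ((p.1 ⬝ᵥ p.2 i) ^ 2 - p.1 ⬝ᵥ p.1)|} with hS
  have hmeas1 : Measurable fun p : (ι → ℝ) × (κ → ι → ℝ) => p.1 ⬝ᵥ p.1 := by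
    unfold dotProduct; fun_prop
  have hmeas2 : Measurable fun p : (ι → ℝ) × (κ → ι → ℝ) =>
      |∑ i, c i * ((p.1 ⬝ᵥ p.2 i) ^ 2 - p.1 ⬝ᵥ p.1)| := by
    unfold dotProduct; fun_prop
  have hSm : MeasurableSet S :=
    (measurableSet_le hmeas1 measurable_const).union
      (measurableSet_le (hmeas1.const_mul _) hmeas2)
  have hSle : ((gauss ι).prod (gaussRows κ ι)).real S ≤ 8 / k + 1 / 200 := by
    refine measureReal_prod_le hSm (by norm_num) (gauss_norm_lower_tail hkn) fun x hx => ?_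
    simp only [Set.mem_ofPred_eq, not_le] at hx
    have hx0 : 0 < x ⬝ᵥ x := lt_trans (by positivity) hx
    have h1 := chebyshev_sum_pi (κ := κ) (memLp_dot_sq_sub x) (integral_dot_sq_sub x) c
      (integral_sq_dot_sq_sub x).le (t := 20 * F * (x ⬝ᵥ x)) (by positivity)
    refine (measureReal_mono ?_).trans (h1.trans ?_)
    · rintro G (hG | hG)
      · exact absurd hG (not_le.2 hx)
      · exact hG
    · rw [div_le_iff₀ (by positivity)]
      have := mul_le_mul_of_nonneg_left hcs (by positivity : 0 ≤ 2 * (x ⬝ᵥ x) ^ 2)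
      nlinarith
  refine le_trans ?_ hSle
  have hup : {G : κ → ι → ℝ | ¬ ∃ x : ι → ℝ, 0 < x ⬝ᵥ x ∧
      x ⬝ᵥ (diagSketch lam G *ᵥ x) ≤ -(ε * k / 4 * F * (x ⬝ᵥ x))} ⊆
      {G | (G i₀, G) ∈ S} := by
    intro G hG
    by_contra hGS
    simp only [hS, Set.mem_ofPred_eq, not_or, not_le] at hGS
    obtain ⟨h1, h2⟩ := hGS
    have hx0 : 0 < G i₀ ⬝ᵥ G i₀ := lt_trans (by positivity) h1
    refine hG ⟨G i₀, hx0, ?_⟩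
    rw [quadratic_diagSketch]
    set X := G i₀ ⬝ᵥ G i₀ with hX
    have e1 : ∑ i, lam i * ((G i₀ ⬝ᵥ G i) ^ 2 - X) =
        lam i₀ * (X ^ 2 - X) + ∑ i, c i * ((G i₀ ⬝ᵥ G i) ^ 2 - X) := by
      rw [← Finset.add_sum_erase _ _ (Finset.mem_univ i₀),
        ← Finset.add_sum_erase (Finset.univ) (fun i => c i * ((G i₀ ⬝ᵥ G i) ^ 2 - X))
          (Finset.mem_univ i₀), hci, zero_mul, zero_add]
      congr 1
      refine Finset.sum_congr rfl fun j hj => ?_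
      rw [hcj j (Finset.ne_of_mem_erase hj)]
    have h3 := (le_abs_self _).trans h2.le
    have h4 : lam i₀ * (X ^ 2 - X) ≤ -ε * F * (X ^ 2 - X) :=
      mul_le_mul_of_nonneg_right hi (by nlinarith)
    rw [e1]
    -- Half of the main term `εkFX/2` absorbs the noise `20FX` and the centring `εFX`, since `εk/4 ≥
    -- 25`.
    have h5 : ε * (k / 4) * (F * X) ≥ (20 + ε) * (F * X) :=
      mul_le_mul_of_nonneg_right (by linarith) (by positivity)
    have h6 : ε * F * X * X ≥ ε * F * X * (k / 2) :=
      mul_le_mul_of_nonneg_left h1.le (by positivity)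
    nlinarith
  have hmeas3 : MeasurableSet {G : κ → ι → ℝ | (G i₀, G) ∈ S} :=
    ((measurable_pi_apply i₀).prodMk measurable_id) hSm
  refine (measureReal_mono hup).trans (le_of_eq ?_)
  rw [Measure.real, Measure.real, gaussRows, ← hmp.measure_preimage hmeas3.nullMeasurableSet]
  congr 2
  ext p
  simp only [hS, Set.mem_preimage, Set.mem_ofPred_eq, Function.update_self]
  have : ∑ i, c i * ((p.1 ⬝ᵥ Function.update p.2 i₀ p.1 i) ^ 2 - p.1 ⬝ᵥ p.1) =
      ∑ i, c i * ((p.1 ⬝ᵥ p.2 i) ^ 2 - p.1 ⬝ᵥ p.1) := by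
    refine Finset.sum_congr rfl fun j _ => ?_
    by_cases hj : j = i₀
    · subst hj; rw [hci, zero_mul, zero_mul]
    · rw [Function.update_of_ne hj]
  rw [this]

end Grid

/-! ### Estimating the Frobenius norm from Gaussian bilinear queries. -/

section NormEstimate
variable {κ : Type*} [Fintype κ]

lemma mulVec_dot_self_eq (A : Matrix κ κ ℝ) (h : κ → ℝ) :
    (A *ᵥ h) ⬝ᵥ (A *ᵥ h) = ∑ i, (A.row i ⬝ᵥ h) ^ 2 := by
  simp only [dotProduct, Matrix.mulVec, Matrix.row_apply, sq]

lemma sum_dot_self_eq_frobSq (A : Matrix κ κ ℝ) : ∑ i, A.row i ⬝ᵥ A.row i = frobSq A := by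
  simp only [frobSq, dotProduct, Matrix.row_apply, sq]

lemma integrable_mulVec_dot_self (A : Matrix κ κ ℝ) :
    Integrable (fun h => (A *ᵥ h) ⬝ᵥ (A *ᵥ h)) (gauss κ) := by
  simp only [mulVec_dot_self_eq]
  exact integrable_finsetSum _ fun i _ => integrable_dot_pow _ 2

lemma integral_mulVec_dot_self (A : Matrix κ κ ℝ) :
    ∫ h, (A *ᵥ h) ⬝ᵥ (A *ᵥ h) ∂(gauss κ) = frobSq A := by
  simp only [mulVec_dot_self_eq]
  rw [integral_finsetSum _ fun i _ => integrable_dot_pow _ 2]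
  simp only [integral_dot_sq, sum_dot_self_eq_frobSq]

lemma integrable_mulVec_dot_self_sq (A : Matrix κ κ ℝ) :
    Integrable (fun h => ((A *ᵥ h) ⬝ᵥ (A *ᵥ h)) ^ 2) (gauss κ) := by
  simp only [mulVec_dot_self_eq, sq (∑ i, _), Finset.sum_mul_sum]
  exact integrable_finsetSum _ fun i _ => integrable_finsetSum _ fun j _ =>
    integrable_dot_sq_mul_dot_sq _ _

lemma integral_mulVec_dot_self_sq_le (A : Matrix κ κ ℝ) :
    ∫ h, ((A *ᵥ h) ⬝ᵥ (A *ᵥ h)) ^ 2 ∂(gauss κ) ≤ 3 * frobSq A ^ 2 := by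
  simp only [mulVec_dot_self_eq, sq (∑ i, _), Finset.sum_mul_sum]
  rw [integral_finsetSum _ fun i _ => integrable_finsetSum _ fun j _ =>
    integrable_dot_sq_mul_dot_sq _ _]
  have h1 : ∀ i ∈ (Finset.univ : Finset κ),
      ∫ h, ∑ j, (A.row i ⬝ᵥ h) ^ 2 * (A.row j ⬝ᵥ h) ^ 2 ∂(gauss κ) ≤
      ∑ j, 3 * ((A.row i ⬝ᵥ A.row i) * (A.row j ⬝ᵥ A.row j)) := by
    intro i _
    rw [integral_finsetSum _ fun j _ => integrable_dot_sq_mul_dot_sq _ _]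
    exact Finset.sum_le_sum fun j _ => integral_dot_sq_mul_dot_sq_le _ _
  refine (Finset.sum_le_sum h1).trans (le_of_eq ?_)
  rw [sq, ← sum_dot_self_eq_frobSq, Finset.sum_mul_sum]
  simp only [Finset.mul_sum]

lemma measurable_bilinear (A : Matrix κ κ ℝ) :
    Measurable (fun p : (κ → ℝ) × (κ → ℝ) => (A *ᵥ p.1) ⬝ᵥ p.2) := by
  unfold dotProduct Matrix.mulVec dotProduct; fun_prop

lemma integrable_bilinear_pow_four (A : Matrix κ κ ℝ) :
    Integrable (fun p : (κ → ℝ) × (κ → ℝ) => ((A *ᵥ p.1) ⬝ᵥ p.2) ^ 4)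
      ((gauss κ).prod (gauss κ)) := by
  rw [integrable_prod_iff ((measurable_bilinear A).pow_const 4).aestronglyMeasurable]
  refine ⟨Filter.Eventually.of_forall fun h => integrable_dot_pow (A *ᵥ h) 4, ?_⟩
  have : ∀ h g : κ → ℝ, ‖((A *ᵥ h) ⬝ᵥ g) ^ 4‖ = ((A *ᵥ h) ⬝ᵥ g) ^ 4 := fun h g =>
    Real.norm_of_nonneg (by positivity)
  simp only [this, integral_dot_pow_four]
  exact (integrable_mulVec_dot_self_sq A).const_mul _

lemma integrable_bilinear_sq (A : Matrix κ κ ℝ) :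
    Integrable (fun p : (κ → ℝ) × (κ → ℝ) => ((A *ᵥ p.1) ⬝ᵥ p.2) ^ 2)
      ((gauss κ).prod (gauss κ)) := by
  have h1 : MemLp (fun p : (κ → ℝ) × (κ → ℝ) => ((A *ᵥ p.1) ⬝ᵥ p.2) ^ 2) 2
      ((gauss κ).prod (gauss κ)) := by
    rw [memLp_two_iff_integrable_sq ((measurable_bilinear A).pow_const 2).aestronglyMeasurable]
    simpa [← pow_mul] using integrable_bilinear_pow_four A
  exact h1.integrable (by norm_num)

lemma integral_bilinear_sq (A : Matrix κ κ ℝ) :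
    ∫ p : (κ → ℝ) × (κ → ℝ), ((A *ᵥ p.1) ⬝ᵥ p.2) ^ 2 ∂((gauss κ).prod (gauss κ)) =
      frobSq A := by
  rw [integral_prod _ (integrable_bilinear_sq A)]
  simp only [integral_dot_sq]
  exact integral_mulVec_dot_self A

lemma integral_bilinear_pow_four_le (A : Matrix κ κ ℝ) :
    ∫ p : (κ → ℝ) × (κ → ℝ), ((A *ᵥ p.1) ⬝ᵥ p.2) ^ 4 ∂((gauss κ).prod (gauss κ)) ≤
      9 * frobSq A ^ 2 := by
  rw [integral_prod _ (integrable_bilinear_pow_four A)]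
  simp only [integral_dot_pow_four]
  rw [integral_const_mul]
  have := integral_mulVec_dot_self_sq_le A
  linarith

lemma frobSq_eq_zero {A : Matrix κ κ ℝ} (h : frobSq A = 0) : A = 0 := by
  ext i j
  have h1 := (Finset.sum_eq_zero_iff_of_nonneg
    (fun i _ => Finset.sum_nonneg fun j _ => sq_nonneg (A i j))).1 h i (Finset.mem_univ i)
  have h2 := (Finset.sum_eq_zero_iff_of_nonneg (fun j _ => sq_nonneg (A i j))).1 h1 j
    (Finset.mem_univ j)
  exact (pow_eq_zero_iff two_ne_zero).1 h2

/-- For independent Gaussians `g`, `h`, the square of `gᵀAh` has mean `‖A‖_F²` and second moment at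
most `9‖A‖_F⁴`; Chebyshev gives `9/(R(3/4)²) = 16/R`. The strict inequality in the event covers `A =
0`. -/
lemma frobSq_estimate_tail (A : Matrix κ κ ℝ) {R : ℕ} (hR : 0 < R) :
    (Measure.pi fun _ : Fin R => (gauss κ).prod (gauss κ)).real
      {H | 3 / 4 * frobSq A <
        |(∑ r, ((A *ᵥ (H r).1) ⬝ᵥ (H r).2) ^ 2) / R - frobSq A|} ≤ 16 / R := by
  have hR' : (0 : ℝ) < R := by exact_mod_cast hR
  rcases (frobSq_nonneg A).eq_or_lt with h0 | hF
  · have hA := frobSq_eq_zero h0.symm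
    subst hA
    simp [frobSq]
    positivity
  have hm : MemLp (fun p : (κ → ℝ) × (κ → ℝ) => ((A *ᵥ p.1) ⬝ᵥ p.2) ^ 2 - frobSq A) 2
      ((gauss κ).prod (gauss κ)) := by
    refine MemLp.sub ?_ (memLp_const _)
    rw [memLp_two_iff_integrable_sq ((measurable_bilinear A).pow_const 2).aestronglyMeasurable]
    simpa [← pow_mul] using integrable_bilinear_pow_four A
  have h0 : ∫ p : (κ → ℝ) × (κ → ℝ), (((A *ᵥ p.1) ⬝ᵥ p.2) ^ 2 - frobSq A)
      ∂((gauss κ).prod (gauss κ)) = 0 := by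
    rw [integral_sub (integrable_bilinear_sq A) (integrable_const _), integral_bilinear_sq]
    simp
  have hv : ∫ p : (κ → ℝ) × (κ → ℝ), (((A *ᵥ p.1) ⬝ᵥ p.2) ^ 2 - frobSq A) ^ 2
      ∂((gauss κ).prod (gauss κ)) ≤ 9 * frobSq A ^ 2 := by
    have h : ∀ p : (κ → ℝ) × (κ → ℝ), (((A *ᵥ p.1) ⬝ᵥ p.2) ^ 2 - frobSq A) ^ 2 =
        ((A *ᵥ p.1) ⬝ᵥ p.2) ^ 4 - 2 * frobSq A * ((A *ᵥ p.1) ⬝ᵥ p.2) ^ 2 + frobSq A ^ 2 :=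
      fun p => by ring
    simp only [h]
    have hi : Integrable (fun p : (κ → ℝ) × (κ → ℝ) => ((A *ᵥ p.1) ⬝ᵥ p.2) ^ 4 -
        2 * frobSq A * ((A *ᵥ p.1) ⬝ᵥ p.2) ^ 2) ((gauss κ).prod (gauss κ)) :=
      (integrable_bilinear_pow_four A).sub ((integrable_bilinear_sq A).const_mul _)
    rw [integral_add hi (integrable_const _), integral_sub (integrable_bilinear_pow_four A)
      ((integrable_bilinear_sq A).const_mul _), integral_const_mul, integral_bilinear_sq]
    have := integral_bilinear_pow_four_le A
    simp
    nlinarith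
  have h1 := chebyshev_sum_pi (κ := Fin R) hm h0 (fun _ => 1 / (R : ℝ)) hv
    (t := 3 / 4 * frobSq A) (by positivity)
  refine (measureReal_mono ?_).trans (h1.trans (le_of_eq ?_))
  · intro H hH
    simp only [Set.mem_ofPred_eq] at hH ⊢
    rw [← Finset.mul_sum, Finset.sum_sub_distrib]
    simp only [Finset.sum_const, Finset.card_univ, nsmul_eq_mul, Fintype.card_fin]
    refine hH.le.trans (le_of_eq ?_)
    congr 1
    rw [mul_sub, ← mul_assoc, one_div, inv_mul_cancel₀ hR'.ne', one_mul, inv_mul_eq_div]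
  · simp
    field_simp
    norm_num

end NormEstimate

/-! ### Spectral decomposition, singular values and comparison of Schatten norms. -/

section Spectral
variable {d : ℕ}

lemma frobSq_eq_trace {κ : Type*} [Fintype κ] (A : Matrix κ κ ℝ) : frobSq A = (Aᵀ * A).trace := by
  simp only [frobSq, Matrix.trace, Matrix.diag, Matrix.mul_apply, Matrix.transpose_apply, ← sq]
  exact Finset.sum_comm

lemma exists_spectral {κ : Type*} [Fintype κ] [DecidableEq κ] {A : Matrix κ κ ℝ} (hA : A.IsSymm) :
    ∃ (O : Matrix κ κ ℝ) (lam : κ → ℝ), O * Oᵀ = 1 ∧ A = Oᵀ * Matrix.diagonal lam * O ∧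
      A.trace = ∑ i, lam i ∧ frobSq A = ∑ i, lam i ^ 2 ∧ (A.PosSemidef → ∀ i, 0 ≤ lam i) ∧
      ∀ l, Module.End.HasEigenvalue (Matrix.toLin' A) l → ∃ i, lam i = l := by
  have hH : A.IsHermitian := by rw [Matrix.IsHermitian, Matrix.conjTranspose_eq_transpose_of_trivial, hA.eq]
  set U : Matrix κ κ ℝ := (hH.eigenvectorUnitary : Matrix κ κ ℝ) with hU
  have hU1 : Uᵀ * U = 1 := by
    have := (Matrix.mem_unitaryGroup_iff' (A := U)).1 hH.eigenvectorUnitary.2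
    rwa [Matrix.star_eq_conjTranspose, Matrix.conjTranspose_eq_transpose_of_trivial] at this
  have hdec : A = Uᵀᵀ * Matrix.diagonal hH.eigenvalues * Uᵀ := by
    have h := hH.spectral_theorem
    rw [Unitary.conjStarAlgAut_apply, ← hU, Matrix.star_eq_conjTranspose,
      Matrix.conjTranspose_eq_transpose_of_trivial] at h
    rw [Matrix.transpose_transpose]
    exact h
  refine ⟨Uᵀ, hH.eigenvalues, by rw [Matrix.transpose_transpose, hU1], hdec, ?_, ?_, ?_, ?_⟩
  · simpa using hH.trace_eq_sum_eigenvalues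
  · rw [Matrix.transpose_transpose] at hdec
    have h0 := congrArg₂ (· * ·) hdec hdec
    rw [frobSq_eq_trace, hA.eq, h0]
    have h1 : U * Matrix.diagonal hH.eigenvalues * Uᵀ * (U * Matrix.diagonal hH.eigenvalues * Uᵀ) =
        U * (Matrix.diagonal hH.eigenvalues * (Uᵀ * U) * Matrix.diagonal hH.eigenvalues * Uᵀ) := by
      simp only [Matrix.mul_assoc]
    rw [h1, hU1, Matrix.mul_one, Matrix.trace_mul_comm, Matrix.mul_assoc, hU1, Matrix.mul_one,
      Matrix.diagonal_mul_diagonal, Matrix.trace_diagonal]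
    simp only [sq]
  · exact fun h i => h.eigenvalues_nonneg i
  · intro l hl
    have h1 := hl.mem_spectrum
    rw [Matrix.spectrum_toLin', hH.spectrum_real_eq_range_eigenvalues] at h1
    exact h1

lemma sum_sq_singularValues (A : Matrix (Fin d) (Fin d) ℝ) :
    ∑ i : Fin d, (Matrix.toEuclideanLin A).singularValues i ^ 2 = frobSq A := by
  have h1 := fun i => (Matrix.toEuclideanLin A).sq_singularValues_fin
    (finrank_euclideanSpace_fin (𝕜 := ℝ) (n := d)) i
  simp only [h1]
  have h2 := (Matrix.toEuclideanLin A).isSymmetric_adjoint_comp_self.trace_eq_sum_eigenvalues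
    (finrank_euclideanSpace_fin (𝕜 := ℝ) (n := d))
  simp only [RCLike.ofReal_real_eq_id, id_eq] at h2
  rw [← h2, ← Matrix.toEuclideanLin_conjTranspose_eq_adjoint, frobSq_eq_trace]
  have e : (Matrix.toEuclideanLin : Matrix (Fin d) (Fin d) ℝ ≃ₗ[ℝ] _) =
      Matrix.toLin (PiLp.basisFun 2 ℝ (Fin d)) (PiLp.basisFun 2 ℝ (Fin d)) :=
    Matrix.toLpLin_eq_toLin 2 2
  rw [e, ← Matrix.toLin_mul, Matrix.trace_toLin_eq]
  rfl

lemma schattenNorm_two (A : Matrix (Fin d) (Fin d) ℝ) : schattenNorm 2 A = √(frobSq A) := by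
  rw [schattenNorm, EuclideanSpace.norm_eq, ← sum_sq_singularValues]
  simp

/-- Power mean inequality with exponent `p/2` for the squared singular values; for `p = ∞`, each of
them is bounded by the largest. -/
lemma schattenNorm_two_le {p : ℝ≥0∞} (hp : 2 ≤ p) (A : Matrix (Fin d) (Fin d) ℝ) :
    schattenNorm 2 A ≤ (d : ℝ) ^ (1 / 2 - (p⁻¹).toReal) * schattenNorm p A := by
  rw [schattenNorm_two, ← sum_sq_singularValues, schattenNorm]
  set σ : Fin d → ℝ := fun i => (Matrix.toEuclideanLin A).singularValues i with hσ
  have hσ0 : ∀ i, 0 ≤ σ i := fun i => LinearMap.singularValues_nonneg _ _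
  change √(∑ i, σ i ^ 2) ≤ _
  rcases eq_or_ne p ∞ with rfl | hpt
  · rw [PiLp.norm_eq_ciSup]
    simp only [ENNReal.inv_top, ENNReal.toReal_zero, sub_zero]
    rw [← Real.sqrt_eq_rpow]
    have hb : ∀ i, σ i ≤ ⨆ i, ‖σ i‖ := fun i =>
      (le_abs_self _).trans (le_ciSup (f := fun i => ‖σ i‖) (Set.finite_range _).bddAbove i)
    have h0 : 0 ≤ ⨆ i, ‖σ i‖ := Real.iSup_nonneg fun i => norm_nonneg _
    apply Real.sqrt_le_iff.2 ⟨by positivity, ?_⟩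
    rw [mul_pow, Real.sq_sqrt (Nat.cast_nonneg d)]
    refine (Finset.sum_le_sum fun i _ => pow_le_pow_left₀ (hσ0 i) (hb i) 2).trans (le_of_eq ?_)
    simp
  · have hp2 : 2 ≤ p.toReal := by
      have := ENNReal.toReal_mono hpt hp
      simpa using this
    rw [PiLp.norm_eq_sum (by linarith), ENNReal.toReal_inv]
    set q := p.toReal with hq
    have h1 := Real.rpow_sum_le_const_mul_sum_rpow (s := Finset.univ) (fun i => σ i ^ 2)
      (p := q / 2) (by linarith)
    have h2 : ∀ i, |σ i ^ 2| ^ (q / 2) = ‖σ i‖ ^ q := by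
      intro i
      rw [abs_of_nonneg (sq_nonneg _), Real.norm_of_nonneg (hσ0 i), ← Real.rpow_natCast,
        ← Real.rpow_mul (hσ0 i)]
      congr 1
      push_cast; ring
    simp only [h2] at h1
    simp only [abs_sq, Finset.card_univ, Fintype.card_fin] at h1
    have hS : 0 ≤ ∑ i, σ i ^ 2 := Finset.sum_nonneg fun i _ => sq_nonneg _
    have h3 := Real.rpow_le_rpow (by positivity) h1 (by positivity : 0 ≤ 1 / q)
    rw [← Real.rpow_mul hS, Real.mul_rpow (by positivity)
      (Finset.sum_nonneg fun i _ => by positivity), ← Real.rpow_mul (Nat.cast_nonneg d)] at h3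
    have hq0 : q ≠ 0 := by linarith
    rw [Real.sqrt_eq_rpow]
    have e1 : q / 2 * (1 / q) = 1 / 2 := by field_simp
    have e2 : (q / 2 - 1) * (1 / q) = 1 / 2 - q⁻¹ := by field_simp
    rw [e1, e2] at h3
    exact h3

end Spectral

/-! ### Sketches of symmetric matrices: centring and shifting. -/

section SymmetricSketch
variable {ι κ : Type*} [Fintype ι] [DecidableEq ι] [Fintype κ] [DecidableEq κ]

/-- The bilinear sketch `Gᵀ A G`, centred at its mean. -/
def centredSketch (A : Matrix κ κ ℝ) (G : κ → ι → ℝ) : Matrix ι ι ℝ :=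
  sketch A G - A.trace • 1

lemma exists_diagSketch {A : Matrix κ κ ℝ} (hA : A.IsSymm) :
    ∃ lam : κ → ℝ, frobSq A = ∑ i, lam i ^ 2 ∧ (A.PosSemidef → ∀ i, 0 ≤ lam i) ∧
      (∀ l, Module.End.HasEigenvalue (Matrix.toLin' A) l → ∃ i, lam i = l) ∧
      ∀ P : Matrix ι ι ℝ → Prop, (gaussRows κ ι).real {G | P (centredSketch A G)} =
        (gaussRows κ ι).real {G | P (diagSketch lam G)} := by
  obtain ⟨O, lam, hO, hdec, htr, hfr, hpsd, heig⟩ := exists_spectral hA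
  refine ⟨lam, hfr, hpsd, heig, fun P => ?_⟩
  have := gaussRows_sketch_eq (ι := ι) O (Matrix.diagonal lam) hO
    {W | P (W - (∑ i, lam i) • 1)}
  rw [← hdec] at this
  simp only [Set.mem_ofPred_eq] at this
  simp only [centredSketch, diagSketch, htr]
  exact this

lemma centredSketch_frobSq_tail {A : Matrix κ κ ℝ} (hA : A.IsSymm) {t : ℝ} (ht : 0 < t) :
    (gaussRows κ ι).real {G | t ≤ frobSq (centredSketch A G)} ≤
      3 * (Fintype.card ι : ℝ) ^ 2 * frobSq A / t := by
  obtain ⟨lam, hfr, -, -, hP⟩ := exists_diagSketch (ι := ι) hA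
  rw [hP fun M => t ≤ frobSq M, hfr]
  exact frobSq_diagSketch_tail lam ht

lemma centredSketch_uniform_lower_tail (hk : 0 < Fintype.card ι) {A : Matrix κ κ ℝ}
    (hA : A.IsSymm) (hpsd : A.PosSemidef) {t R : ℝ} (ht : 0 < t) (hR : 0 ≤ R) :
    (gaussRows κ ι).real {G | frobSq (centredSketch A G) ≤ R ^ 2 ∧
      ¬ ∀ x, -((4 * (t * √(frobSq A)) + 3 * R / √(Fintype.card ι)) * (x ⬝ᵥ x)) ≤
        x ⬝ᵥ (centredSketch A G *ᵥ x)} ≤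
      (2 * Fintype.card ι + 1 : ℝ) ^ (Fintype.card ι) * Real.exp (-(t ^ 2 / 6)) := by
  obtain ⟨lam, hfr, h0, -, hP⟩ := exists_diagSketch (ι := ι) hA
  rw [hP fun M => frobSq M ≤ R ^ 2 ∧
      ¬ ∀ x, -((4 * (t * √(frobSq A)) + 3 * R / √(Fintype.card ι)) * (x ⬝ᵥ x)) ≤ x ⬝ᵥ (M *ᵥ x)]
  exact diagSketch_uniform_lower_tail hk lam (h0 hpsd)
    (by rw [Real.sq_sqrt (frobSq_nonneg A), hfr]) (Real.sqrt_nonneg _) ht hR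

lemma centredSketch_negative_direction {A : Matrix κ κ ℝ} (hA : A.IsSymm) (hA0 : A ≠ 0) {ε l : ℝ}
    (hε : 0 < ε) (hε1 : ε ≤ 1) (hl : Module.End.HasEigenvalue (Matrix.toLin' A) l)
    (hlε : l ≤ -ε * √(frobSq A)) (hk : 100 ≤ ε * Fintype.card ι) :
    (gaussRows κ ι).real {G | ¬ ∃ x : ι → ℝ, 0 < x ⬝ᵥ x ∧
      x ⬝ᵥ (centredSketch A G *ᵥ x) ≤
        -(ε * Fintype.card ι / 4 * √(frobSq A) * (x ⬝ᵥ x))} ≤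
      8 / Fintype.card ι + 1 / 200 := by
  obtain ⟨lam, hfr, -, heig, hP⟩ := exists_diagSketch (ι := ι) hA
  obtain ⟨i₀, hi₀⟩ := heig l hl
  rw [hP fun M => ¬ ∃ x : ι → ℝ, 0 < x ⬝ᵥ x ∧
      x ⬝ᵥ (M *ᵥ x) ≤ -(ε * Fintype.card ι / 4 * √(frobSq A) * (x ⬝ᵥ x))]
  have hpos : 0 < frobSq A := (frobSq_nonneg A).lt_of_ne fun h => hA0 (frobSq_eq_zero h.symm)
  exact diagSketch_negative_direction lam i₀ (by rw [Real.sq_sqrt (frobSq_nonneg A), hfr])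
    (Real.sqrt_pos.2 hpos) hε hε1 (by rw [hi₀]; exact hlε) hk

lemma trace_sq_le_frobSq (M : Matrix ι ι ℝ) : M.trace ^ 2 ≤ Fintype.card ι * frobSq M := by
  have h1 : M.trace ^ 2 ≤ Fintype.card ι * ∑ a, M a a ^ 2 :=
    sq_sum_le_card_mul_sum_sq (s := Finset.univ) (f := fun a => M a a)
  refine h1.trans (mul_le_mul_of_nonneg_left ?_ (Nat.cast_nonneg _))
  exact Finset.sum_le_sum fun a _ =>
    Finset.single_le_sum (f := fun b => M a b ^ 2) (fun b _ => sq_nonneg _) (Finset.mem_univ a)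

/-- The sketch shifted so that its trace is `s` times the dimension. -/
noncomputable def shiftedSketch (s : ℝ) (A : Matrix κ κ ℝ) (G : κ → ι → ℝ) : Matrix ι ι ℝ :=
  sketch A G + (s - (sketch A G).trace / Fintype.card ι) • 1

lemma sketch_isSymm {A : Matrix κ κ ℝ} (hA : A.IsSymm) (G : κ → ι → ℝ) : (sketch A G).IsSymm := by
  rw [Matrix.IsSymm, sketch, Matrix.transpose_mul, Matrix.transpose_mul, Matrix.transpose_transpose,
    hA.eq, Matrix.mul_assoc]

lemma smul_one_isSymm (c : ℝ) : (c • (1 : Matrix ι ι ℝ)).IsSymm := by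
  rw [Matrix.IsSymm, Matrix.transpose_smul, Matrix.transpose_one]

lemma shiftedSketch_isSymm {A : Matrix κ κ ℝ} (hA : A.IsSymm) (s : ℝ) (G : κ → ι → ℝ) :
    (shiftedSketch s A G).IsSymm :=
  (sketch_isSymm hA G).add (smul_one_isSymm _)

variable (hk : 0 < Fintype.card ι)
include hk

lemma shiftedSketch_trace (s : ℝ) (A : Matrix κ κ ℝ) (G : κ → ι → ℝ) :
    (shiftedSketch s A G).trace = Fintype.card ι * s := by
  have hk' : (Fintype.card ι : ℝ) ≠ 0 := by exact_mod_cast hk.ne'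
  rw [shiftedSketch, Matrix.trace_add, Matrix.trace_smul, Matrix.trace_one, smul_eq_mul]
  field_simp
  ring

/-- The tester centres with the observable trace of the sketch divided by `k`, the analysis with `tr
A`. The discrepancy is the normalized trace of the centred sketch, which is small by
`abs_trace_div_card_le`. -/
lemma shiftedSketch_eq (s : ℝ) (A : Matrix κ κ ℝ) (G : κ → ι → ℝ) :
    shiftedSketch s A G = centredSketch A G +
      (s - (centredSketch A G).trace / Fintype.card ι) • 1 := by
  have hk' : (Fintype.card ι : ℝ) ≠ 0 := by exact_mod_cast hk.ne'
  rw [shiftedSketch, centredSketch, Matrix.trace_sub, Matrix.trace_smul, Matrix.trace_one,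
    smul_eq_mul, sub_div, mul_div_assoc, div_self hk', mul_one, sub_add, ← sub_smul]
  rw [sub_eq_add_neg (sketch A G), ← neg_smul]
  congr 2
  ring

lemma shiftedSketch_quadratic (s : ℝ) (A : Matrix κ κ ℝ) (G : κ → ι → ℝ) (x : ι → ℝ) :
    x ⬝ᵥ (shiftedSketch s A G *ᵥ x) = x ⬝ᵥ (centredSketch A G *ᵥ x) +
      (s - (centredSketch A G).trace / Fintype.card ι) * (x ⬝ᵥ x) := by
  rw [shiftedSketch_eq hk, Matrix.add_mulVec, dotProduct_add, Matrix.smul_mulVec,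
    Matrix.one_mulVec, dotProduct_smul, smul_eq_mul]

lemma abs_trace_div_card_le {M : Matrix ι ι ℝ} {b : ℝ} (hb : 0 ≤ b)
    (hM : frobSq M ≤ Fintype.card ι * b ^ 2) : |M.trace / Fintype.card ι| ≤ b := by
  have hk' : (0 : ℝ) < Fintype.card ι := by exact_mod_cast hk
  apply abs_le_of_sq_le_sq _ hb
  rw [div_pow, div_le_iff₀ (by positivity)]
  refine (trace_sq_le_frobSq M).trans ?_
  nlinarith

lemma frobSq_shiftedSketch_le (s : ℝ) (A : Matrix κ κ ℝ) (G : κ → ι → ℝ) :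
    frobSq (shiftedSketch s A G) ≤
      6 * frobSq (centredSketch A G) + 4 * Fintype.card ι * s ^ 2 := by
  have hk' : (0 : ℝ) < Fintype.card ι := by exact_mod_cast hk
  have hadd : ∀ (M : Matrix ι ι ℝ) (c : ℝ), frobSq (M + c • 1) ≤
      2 * frobSq M + 2 * (Fintype.card ι * c ^ 2) := by
    intro M c
    have h1 : ∀ a b, (M + c • (1 : Matrix ι ι ℝ)) a b ^ 2 ≤
        2 * M a b ^ 2 + 2 * (if a = b then c ^ 2 else 0) := by
      intro a b
      rw [Matrix.add_apply, Matrix.smul_apply, Matrix.one_apply, smul_eq_mul]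
      split_ifs
      · nlinarith [sq_nonneg (M a b - c)]
      · simp; nlinarith [sq_nonneg (M a b)]
    refine (Finset.sum_le_sum fun a _ => Finset.sum_le_sum fun b _ => h1 a b).trans (le_of_eq ?_)
    simp only [Finset.sum_add_distrib, ← Finset.mul_sum, Finset.sum_ite_eq, Finset.mem_univ,
      if_true, frobSq]
    simp
  rw [shiftedSketch_eq hk]
  refine (hadd _ _).trans ?_
  set M := centredSketch A G
  set k : ℝ := (Fintype.card ι : ℝ)
  have h2 : k * (M.trace / k) ^ 2 ≤ frobSq M := by
    have := trace_sq_le_frobSq M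
    rw [div_pow, mul_div_assoc', div_le_iff₀ (by positivity)]
    nlinarith
  nlinarith [mul_nonneg hk'.le (sq_nonneg (s + M.trace / k))]

end SymmetricSketch

/-! ### The bottom eigenvector. -/

section MinEigen
variable {ι : Type*} [Fintype ι] [DecidableEq ι]

lemma exists_min_eigenvector [Nonempty ι] {N : Matrix ι ι ℝ} (hN : N.IsSymm) {b : ℝ} {x : ι → ℝ}
    (hx : 0 < x ⬝ᵥ x) (hxN : x ⬝ᵥ (N *ᵥ x) ≤ -b * (x ⬝ᵥ x)) :
    ∃ (l : ℝ) (u : ι → ℝ), b ≤ l ∧ N *ᵥ u = -l • u ∧ u ⬝ᵥ u = 1 ∧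
      ∀ y : ι → ℝ, -l * (y ⬝ᵥ y) ≤ y ⬝ᵥ (N *ᵥ y) := by
  obtain ⟨O, lam, hO, hdec, -⟩ := exists_spectral hN
  have hO' : Oᵀ * O = 1 := mul_eq_one_comm.1 hO
  obtain ⟨i, hi⟩ := Finite.exists_min lam
  have hq : ∀ y : ι → ℝ, lam i * (y ⬝ᵥ y) ≤ y ⬝ᵥ (N *ᵥ y) := by
    intro y
    have e1 : y ⬝ᵥ y = (O *ᵥ y) ⬝ᵥ (O *ᵥ y) := by
      rw [Matrix.dotProduct_mulVec, ← Matrix.mulVec_transpose, Matrix.mulVec_mulVec, hO',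
        Matrix.one_mulVec]
    have e2 : y ⬝ᵥ (N *ᵥ y) = (O *ᵥ y) ⬝ᵥ (Matrix.diagonal lam *ᵥ (O *ᵥ y)) := by
      rw [hdec, ← Matrix.mulVec_mulVec, ← Matrix.mulVec_mulVec, Matrix.dotProduct_mulVec,
        Matrix.vecMul_transpose]
    rw [e1, e2]
    simp only [dotProduct, Matrix.mulVec_diagonal, Finset.mul_sum]
    refine Finset.sum_le_sum fun j _ => ?_
    nlinarith [mul_le_mul_of_nonneg_right (hi j) (mul_self_nonneg ((O *ᵥ y) j))]
  refine ⟨-lam i, Oᵀ *ᵥ Pi.single i 1, ?_, ?_, ?_, ?_⟩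
  · have := (hq x).trans hxN
    have := le_of_mul_le_mul_right this hx
    linarith
  · rw [hdec, Matrix.mulVec_mulVec, Matrix.mul_assoc, hO, Matrix.mul_one, ← Matrix.mulVec_mulVec,
      Matrix.diagonal_mulVec_single, mul_one, neg_neg, ← Matrix.mulVec_smul]
    congr 1
    ext j
    simp [Pi.single_apply]
  · rw [Matrix.dotProduct_mulVec, ← Matrix.mulVec_transpose, Matrix.transpose_transpose,
      Matrix.mulVec_mulVec, hO, Matrix.one_mulVec]
    simp
  · intro y; rw [neg_neg]; exact hq y

end MinEigen

/-! ### Composing adaptive query algorithms. -/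

section QueryComputable
variable {d : ℕ} {Ω α β : Type} [MeasurableSpace Ω] [MeasurableSpace α] [MeasurableSpace β]

/-- The answers to the first `k` queries of the strategy `q` on input `A`, with coins `ω`. -/
def queryAnswers (q : (k : ℕ) → Ω → (Fin k → ℝ) → (Fin d → ℝ) × (Fin d → ℝ))
    (A : Matrix (Fin d) (Fin d) ℝ) (ω : Ω) : (k : ℕ) → (Fin k → ℝ)
  | 0 => Fin.elim0
  | k + 1 => Fin.snoc (α := fun _ => ℝ) (queryAnswers q A ω k)
      ((q k ω (queryAnswers q A ω k)).1 ⬝ᵥ (A *ᵥ (q k ω (queryAnswers q A ω k)).2))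

/-- The function `f` of the input matrix and the coins can be computed by an adaptive randomized
algorithm that makes `n` vector-matrix-vector queries. -/
def QueryComputable (n : ℕ) (f : Matrix (Fin d) (Fin d) ℝ → Ω → α) : Prop :=
  ∃ (q : (k : ℕ) → Ω → (Fin k → ℝ) → (Fin d → ℝ) × (Fin d → ℝ)) (dec : Ω → (Fin n → ℝ) → α),
    (∀ k, Measurable fun x : Ω × (Fin k → ℝ) => q k x.1 x.2) ∧
    (Measurable fun x : Ω × (Fin n → ℝ) => dec x.1 x.2) ∧
    ∀ A ω, f A ω = dec ω (queryAnswers q A ω n)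

lemma QueryComputable.of_measurable {g : Ω → α} (hg : Measurable g) :
    QueryComputable (d := d) 0 fun _ ω => g ω :=
  ⟨fun _ _ _ => 0, fun ω _ => g ω, fun _ => measurable_const, hg.comp measurable_fst,
    fun _ _ => rfl⟩

lemma QueryComputable.map {n : ℕ} {f : Matrix (Fin d) (Fin d) ℝ → Ω → α}
    (hf : QueryComputable n f) {h : Ω × α → β} (hh : Measurable h) :
    QueryComputable n fun A ω => h (ω, f A ω) := by
  obtain ⟨q, dec, hq, hdec, hfe⟩ := hf
  exact ⟨q, fun ω a => h (ω, dec ω a), hq, hh.comp (measurable_fst.prodMk hdec),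
    fun A ω => by simp only [hfe]⟩

lemma queryAnswers_congr {n : ℕ}
    {q q' : (k : ℕ) → Ω → (Fin k → ℝ) → (Fin d → ℝ) × (Fin d → ℝ)}
    (h : ∀ k < n, q' k = q k) (A : Matrix (Fin d) (Fin d) ℝ) (ω : Ω) :
    queryAnswers q' A ω n = queryAnswers q A ω n := by
  induction n with
  | zero => rfl
  | succ n ih =>
    rw [queryAnswers, queryAnswers, ih fun k hk => h k (Nat.lt_succ_of_lt hk), h n n.lt_succ_self]

/-- The new query takes position `n`, where it may depend on all that has been computed so far.
Positions beyond `n` keep their old values and are never read. -/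
lemma QueryComputable.query {n : ℕ} {f : Matrix (Fin d) (Fin d) ℝ → Ω → α}
    (hf : QueryComputable n f) {v w : Ω × α → (Fin d → ℝ)} (hv : Measurable v)
    (hw : Measurable w) :
    QueryComputable (n + 1) fun A ω =>
      (f A ω, v (ω, f A ω) ⬝ᵥ (A *ᵥ w (ω, f A ω))) := by
  obtain ⟨q, dec, hq, hdec, hfe⟩ := hf
  let q' : (k : ℕ) → Ω → (Fin k → ℝ) → (Fin d → ℝ) × (Fin d → ℝ) := fun k ω a =>
    if h : k = n then (v (ω, dec ω fun i => a (i.cast h.symm)), w (ω, dec ω fun i => a (i.cast h.symm)))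
    else q k ω a
  have hq' : ∀ k < n, q' k = q k := fun k hk => by
    funext ω a; exact dif_neg hk.ne
  have hq'n : ∀ ω a, q' n ω a = (v (ω, dec ω a), w (ω, dec ω a)) := fun ω a => dif_pos rfl
  refine ⟨q', fun ω a => (dec ω (Fin.init a), a (Fin.last n)), fun k => ?_, ?_, fun A ω => ?_⟩
  · by_cases hk : k = n
    · subst hk
      simp only [hq'n]
      exact (hv.comp (measurable_fst.prodMk hdec)).prodMk (hw.comp (measurable_fst.prodMk hdec))
    · have : q' k = q k := by funext ω a; exact dif_neg hk
      rw [this]; exact hq k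
  · refine Measurable.prodMk (hdec.comp (measurable_fst.prodMk ?_)) ?_
    · exact measurable_pi_lambda _ fun i => (measurable_pi_apply _).comp measurable_snd
    · exact (measurable_pi_apply _).comp measurable_snd
  · dsimp only
    rw [queryAnswers, Fin.init_snoc, Fin.snoc_last, queryAnswers_congr hq', hq'n, hfe]

lemma QueryComputable.queries {n : ℕ} {f : Matrix (Fin d) (Fin d) ℝ → Ω → α}
    (hf : QueryComputable n f) (m : ℕ) {v w : Fin m → Ω × α → (Fin d → ℝ)}
    (hv : ∀ i, Measurable (v i)) (hw : ∀ i, Measurable (w i)) :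
    QueryComputable (n + m) fun A ω =>
      (f A ω, fun i => v i (ω, f A ω) ⬝ᵥ (A *ᵥ w i (ω, f A ω))) := by
  induction m with
  | zero =>
    have h1 := hf.map (h := fun p => (p.2, fun i : Fin 0 => (i.elim0 : ℝ)))
      (measurable_snd.prodMk measurable_const)
    have e : (fun (A : Matrix (Fin d) (Fin d) ℝ) ω =>
        (f A ω, fun i : Fin 0 => v i (ω, f A ω) ⬝ᵥ (A *ᵥ w i (ω, f A ω)))) =
        fun A ω => (f A ω, fun i : Fin 0 => (i.elim0 : ℝ)) := by
      funext A ω; congr 1; funext i; exact i.elim0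
    rw [e]; exact h1
  | succ m ih =>
    have h1 := ih (fun i => hv i.castSucc) (fun i => hw i.castSucc)
    have hfst : Measurable fun p : Ω × (α × (Fin m → ℝ)) => (p.1, p.2.1) :=
      measurable_fst.prodMk (measurable_fst.comp measurable_snd)
    have h2 := h1.query ((hv (Fin.last m)).comp hfst) ((hw (Fin.last m)).comp hfst)
    have hsn : Measurable fun p : Ω × ((α × (Fin m → ℝ)) × ℝ) =>
        (p.2.1.1, (Fin.snoc (α := fun _ => ℝ) p.2.1.2 p.2.2 : Fin (m + 1) → ℝ)) := by
      refine Measurable.prodMk (by fun_prop) (measurable_pi_lambda _ fun i => ?_)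
      refine Fin.lastCases ?_ (fun j => ?_) i
      · simp only [Fin.snoc_last]; fun_prop
      · simp only [Fin.snoc_castSucc]; fun_prop
    have h3 := h2.map hsn
    have e : (fun (A : Matrix (Fin d) (Fin d) ℝ) ω =>
        (f A ω, fun i : Fin (m + 1) => v i (ω, f A ω) ⬝ᵥ (A *ᵥ w i (ω, f A ω)))) =
        fun A ω => (f A ω, Fin.snoc (α := fun _ => ℝ)
          (fun i : Fin m => v i.castSucc (ω, f A ω) ⬝ᵥ (A *ᵥ w i.castSucc (ω, f A ω)))
          (v (Fin.last m) (ω, f A ω) ⬝ᵥ (A *ᵥ w (Fin.last m) (ω, f A ω)))) := by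
      funext A ω
      congr 1
      funext i
      refine Fin.lastCases ?_ (fun j => ?_) i
      · simp only [Fin.snoc_last]
      · simp only [Fin.snoc_castSucc]
    rw [e]; exact h3

/-- Measurability of the output is recorded as well, since the error analysis passes to complements
and to product sections. -/
lemma QueryComputable.exists_algorithm (μ : Measure Ω) [IsProbabilityMeasure μ] {n : ℕ}
    {f : Matrix (Fin d) (Fin d) ℝ → Ω → Bool} (hf : QueryComputable n f) :
    (∀ A, Measurable (f A)) ∧ ∃ T : VMVAlgorithm d, T.numQueries = n ∧ ∀ A (b : Bool),
      T.μ.real {ω | T.run A ω = b} = μ.real {ω | f A ω = b} := by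
  obtain ⟨q, dec, hq, hdec, hfe⟩ := hf
  have hmeas : ∀ A k, Measurable fun ω => queryAnswers q A ω k := by
    intro A k
    induction k with
    | zero => exact measurable_const
    | succ k ih =>
      have h1 : Measurable fun ω => q k ω (queryAnswers q A ω k) :=
        (hq k).comp (measurable_id.prodMk ih)
      refine measurable_pi_lambda _ fun i => ?_
      simp only [queryAnswers]
      refine Fin.lastCases ?_ (fun j => ?_) i
      · simp only [Fin.snoc_last]
        have h2 : Measurable fun p : (Fin d → ℝ) × (Fin d → ℝ) => p.1 ⬝ᵥ (A *ᵥ p.2) := by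
          unfold Matrix.mulVec dotProduct; fun_prop
        exact h2.comp h1
      · simp only [Fin.snoc_castSucc]
        exact (measurable_pi_apply j).comp ih
  refine ⟨fun A => ?_, ?_⟩
  · have : f A = fun ω => dec ω (queryAnswers q A ω n) := funext fun ω => hfe A ω
    rw [this]
    exact hdec.comp (measurable_id.prodMk (hmeas A n))
  · let T : VMVAlgorithm d :=
      { Ω := Ω, μ := μ, numQueries := n, query := q, measurable_query := hq, output := dec
        measurable_output := hdec }
    have hans : ∀ A ω k, T.answers A ω k = queryAnswers q A ω k := by
      intro A ω k
      induction k with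
      | zero => rfl
      | succ k ih => rw [VMVAlgorithm.answers, queryAnswers, ih]
    refine ⟨T, rfl, fun A b => ?_⟩
    have : ∀ ω, T.run A ω = f A ω := fun ω => by
      rw [VMVAlgorithm.run, hans, hfe]
    have h2 : {ω | T.run A ω = b} = {ω | f A ω = b} := by
      ext ω; exact Eq.congr_left (this ω)
    rw [h2]

end QueryComputable

/-! ### The tester and its number of queries. -/

section Tester
variable {d k R T : ℕ}

lemma dotProduct_sketch_mulVec {ι κ : Type*} [Fintype ι] [Fintype κ] (A : Matrix κ κ ℝ)
    (G : κ → ι → ℝ) (x y : ι → ℝ) :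
    x ⬝ᵥ (sketch A G *ᵥ y) = (Matrix.of G *ᵥ x) ⬝ᵥ (A *ᵥ (Matrix.of G *ᵥ y)) := by
  rw [sketch, ← Matrix.mulVec_mulVec, ← Matrix.mulVec_mulVec, Matrix.dotProduct_mulVec,
    Matrix.vecMul_transpose]

lemma dotProduct_sketch_add_mulVec {ι κ : Type*} [Fintype ι] [DecidableEq ι] [Fintype κ]
    (A : Matrix κ κ ℝ) (G : κ → ι → ℝ) (c : ℝ) (x y : ι → ℝ) :
    x ⬝ᵥ ((sketch A G + c • 1) *ᵥ y) =
      (Matrix.of G *ᵥ x) ⬝ᵥ (A *ᵥ (Matrix.of G *ᵥ y)) + c * (x ⬝ᵥ y) := by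
  rw [Matrix.add_mulVec, dotProduct_add, dotProduct_sketch_mulVec, Matrix.smul_mulVec,
    Matrix.one_mulVec, dotProduct_smul, smul_eq_mul]

lemma measurable_signVec : Measurable (signVec : (Fin k → Bool) → Fin k → ℝ) :=
  measurable_of_countable _

lemma Measurable.of_mulVec {X ι κ : Type*} [MeasurableSpace X] [Fintype ι] [Fintype κ]
    {G : X → κ → ι → ℝ} {x : X → ι → ℝ} (hG : Measurable G) (hx : Measurable x) :
    Measurable fun ω => Matrix.of (G ω) *ᵥ x ω := by
  refine measurable_pi_lambda _ fun i => ?_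
  simp only [Matrix.mulVec, dotProduct, Matrix.of_apply]
  refine Finset.measurable_sum _ fun a _ => ?_
  exact ((measurable_pi_apply a).comp ((measurable_pi_apply i).comp hG)).mul
    ((measurable_pi_apply a).comp hx)

lemma Measurable.dot {X ι : Type*} [MeasurableSpace X] [Fintype ι]
    {x y : X → ι → ℝ} (hx : Measurable x) (hy : Measurable y) :
    Measurable fun ω => x ω ⬝ᵥ y ω := by
  simp only [dotProduct]
  refine Finset.measurable_sum _ fun a _ => ?_
  exact ((measurable_pi_apply a).comp hx).mul ((measurable_pi_apply a).comp hy)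

/-- A step needs only the scalar `gᵀNx = (Gg)ᵀA(Gx) + off · gᵀx`, hence one query. The data `p`
carry the earlier answers, on which the offset and the step size depend. -/
lemma QueryComputable.gradIter {Ω α : Type} [MeasurableSpace Ω] [MeasurableSpace α]
    {G : Ω → Fin d → Fin k → ℝ} (hG : Measurable G) {off η : α → ℝ} (hoff : Measurable off)
    (hη : Measurable η) {p : Matrix (Fin d) (Fin d) ℝ → Ω → α} (m : ℕ) {n : ℕ}
    {s : Fin m → Ω → Fin k → Bool} (hs : ∀ i, Measurable (s i))
    {x : Matrix (Fin d) (Fin d) ℝ → Ω → Fin k → ℝ}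
    (hf : QueryComputable n fun A ω => (p A ω, x A ω)) :
    QueryComputable (n + m) fun A ω => (p A ω,
      gradIter (sketch A (G ω) + off (p A ω) • 1) (η (p A ω)) m (fun i => s i ω) (x A ω)) := by
  induction m generalizing n x with
  | zero => exact hf
  | succ m ih =>
    have hsv : Measurable fun ω => signVec (s 0 ω) := measurable_signVec.comp (hs 0)
    have h1 := hf.query (v := fun q => Matrix.of (G q.1) *ᵥ signVec (s 0 q.1))
      (w := fun q => Matrix.of (G q.1) *ᵥ q.2.2)
      (Measurable.of_mulVec (hG.comp measurable_fst) (hsv.comp measurable_fst))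
      (Measurable.of_mulVec (hG.comp measurable_fst) (measurable_snd.comp measurable_snd))
    have hm : Measurable fun q : Ω × ((α × (Fin k → ℝ)) × ℝ) =>
        (q.2.1.1, q.2.1.2 - (η q.2.1.1 * (q.2.2 + off q.2.1.1 * (signVec (s 0 q.1) ⬝ᵥ q.2.1.2))) •
          signVec (s 0 q.1)) := by
      have ha : Measurable fun q : Ω × ((α × (Fin k → ℝ)) × ℝ) => q.2.1.1 := by fun_prop
      have hx : Measurable fun q : Ω × ((α × (Fin k → ℝ)) × ℝ) => q.2.1.2 := by fun_prop
      have hb : Measurable fun q : Ω × ((α × (Fin k → ℝ)) × ℝ) => q.2.2 := by fun_prop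
      have hv : Measurable fun q : Ω × ((α × (Fin k → ℝ)) × ℝ) => signVec (s 0 q.1) :=
        hsv.comp measurable_fst
      exact ha.prodMk (hx.sub (((hη.comp ha).mul
        (hb.add ((hoff.comp ha).mul (Measurable.dot hv hx)))).smul hv))
    have h2 := ih (fun i => hs i.succ) (h1.map hm)
    have e : n + (m + 1) = n + 1 + m := by omega
    rw [e]
    convert h2 using 4 with A ω
    rw [_root_.gradIter, gradStep, dotProduct_sketch_add_mulVec]
    rfl

/-- The random coins of the tester: the Gaussian sketch, the Gaussian pairs for the estimation of the
Frobenius norm, the starting point and the directions of the stochastic gradient iteration. -/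
abbrev TesterCoins (d k R T : ℕ) : Type :=
  ((Fin d → Fin k → ℝ) × (Fin R → (Fin d → ℝ) × (Fin d → ℝ))) ×
    ((Fin k → ℝ) × (Fin T → Fin k → Bool))

/-- An estimate of the Frobenius norm, multiplied by `b`. -/
noncomputable def normShift (b : ℝ) (A : Matrix (Fin d) (Fin d) ℝ)
    (H : Fin R → (Fin d → ℝ) × (Fin d → ℝ)) : ℝ :=
  b * √((∑ r, ((A *ᵥ (H r).1) ⬝ᵥ (H r).2) ^ 2) / R)

/-- The candidate for a direction in which the quadratic form of `N` is negative. -/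
noncomputable def candidate {ι : Type*} [Fintype ι] (N : Matrix ι ι ℝ) (η α : ℝ)
    (x : ι → ℝ) (s : Fin T → ι → Bool) : ι → ℝ :=
  gradIter N η T s x - α • (N *ᵥ gradIter N η T s x)

/-- The output of the tester. -/
noncomputable def testerOutput (b c a : ℝ) (A : Matrix (Fin d) (Fin d) ℝ)
    (ω : TesterCoins d k R T) : Bool :=
  let s := normShift b A ω.1.2
  let N := shiftedSketch s A ω.1.1
  let y := candidate N (c / s) (a / s) ω.2.1 ω.2.2
  decide (0 ≤ y ⬝ᵥ (N *ᵥ y))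

lemma trace_sketch_eq (A : Matrix (Fin d) (Fin d) ℝ) (G : Fin d → Fin k → ℝ) :
    (sketch A G).trace = ∑ a, (fun i => G i a) ⬝ᵥ (A *ᵥ fun i => G i a) := by
  simp only [Matrix.trace, Matrix.diag]
  refine Finset.sum_congr rfl fun a _ => ?_
  have h1 := dotProduct_sketch_mulVec A G (Pi.single a 1) (Pi.single a 1)
  simp only [Matrix.mulVec_single_one, single_one_dotProduct] at h1
  exact h1

/-- `R` queries estimate the norm, `k` give the diagonal of the sketch and so its trace, `T` run the
iteration, `k` give all coordinates of `Nz` for the last gradient step, and one evaluates the form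
at the candidate. -/
lemma testerOutput_queryComputable (b c a : ℝ) :
    QueryComputable (R + k + T + k + 1) (testerOutput (d := d) (k := k) (R := R) (T := T) b c a) := by
  have hG : Measurable fun ω : TesterCoins d k R T => ω.1.1 := by fun_prop
  have hcol : ∀ j : Fin k, Measurable fun ω : TesterCoins d k R T => fun i => ω.1.1 i j := by
    intro j; fun_prop
  have h0 : QueryComputable (d := d) 0 fun _ (_ : TesterCoins d k R T) => () :=
    QueryComputable.of_measurable measurable_const
  have h1 := h0.queries R (v := fun r q => (q.1.1.2 r).2) (w := fun r q => (q.1.1.2 r).1)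
    (fun r => by fun_prop) (fun r => by fun_prop)
  have h2 := h1.queries k (v := fun j q => fun i => q.1.1.1 i j)
    (w := fun j q => fun i => q.1.1.1 i j)
    (fun j => (hcol j).comp measurable_fst) (fun j => (hcol j).comp measurable_fst)
  set sh : (Unit × (Fin R → ℝ)) × (Fin k → ℝ) → ℝ :=
    fun p => b * √((∑ r, p.1.2 r ^ 2) / R) with hsh
  have hshm : Measurable sh := by rw [hsh]; fun_prop
  set off : (Unit × (Fin R → ℝ)) × (Fin k → ℝ) → ℝ := fun p => sh p - (∑ j, p.2 j) / k with hoff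
  have hoffm : Measurable off := by rw [hoff]; fun_prop
  have h3 := h2.map (h := fun q => (q.2, q.1.2.1)) (by fun_prop)
  have h4 := QueryComputable.gradIter hG hoffm (η := fun p => c / sh p)
    (hshm.const_div c) T (s := fun t ω => ω.2.2 t) (fun t => by fun_prop) h3
  have h5 := h4.queries k (v := fun j q => fun i => q.1.1.1 i j)
    (w := fun _ q => Matrix.of q.1.1.1 *ᵥ q.2.2)
    (fun j => (hcol j).comp measurable_fst)
    (fun j => Measurable.of_mulVec (hG.comp measurable_fst) (by fun_prop))
  have hm : Measurable fun q : TesterCoins d k R T ×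
      ((((Unit × (Fin R → ℝ)) × (Fin k → ℝ)) × (Fin k → ℝ)) × (Fin k → ℝ)) =>
      (q.2.1.1, q.2.1.2 - (a / sh q.2.1.1) • (q.2.2 + off q.2.1.1 • q.2.1.2)) := by
    have e1 : Measurable fun q : TesterCoins d k R T ×
      ((((Unit × (Fin R → ℝ)) × (Fin k → ℝ)) × (Fin k → ℝ)) × (Fin k → ℝ)) => q.2.1.1 := by fun_prop
    have e2 : Measurable fun q : TesterCoins d k R T ×
      ((((Unit × (Fin R → ℝ)) × (Fin k → ℝ)) × (Fin k → ℝ)) × (Fin k → ℝ)) => q.2.1.2 := by fun_prop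
    have e3 : Measurable fun q : TesterCoins d k R T ×
      ((((Unit × (Fin R → ℝ)) × (Fin k → ℝ)) × (Fin k → ℝ)) × (Fin k → ℝ)) => q.2.2 := by fun_prop
    exact e1.prodMk (e2.sub (((hshm.comp e1).const_div a).smul
      (e3.add ((hoffm.comp e1).smul e2))))
  have h6 := h5.map hm
  have h7 := h6.query (v := fun q => Matrix.of q.1.1.1 *ᵥ q.2.2)
    (w := fun q => Matrix.of q.1.1.1 *ᵥ q.2.2)
    (Measurable.of_mulVec (hG.comp measurable_fst) (by fun_prop))
    (Measurable.of_mulVec (hG.comp measurable_fst) (by fun_prop))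
  have hout : Measurable fun q : TesterCoins d k R T ×
      ((((Unit × (Fin R → ℝ)) × (Fin k → ℝ)) × (Fin k → ℝ)) × ℝ) =>
      decide (0 ≤ q.2.2 + off q.2.1.1 * (q.2.1.2 ⬝ᵥ q.2.1.2)) := by
    refine measurable_to_bool ?_
    have e1 : Measurable fun q : TesterCoins d k R T ×
      ((((Unit × (Fin R → ℝ)) × (Fin k → ℝ)) × (Fin k → ℝ)) × ℝ) => q.2.1.1 := by fun_prop
    have e2 : Measurable fun q : TesterCoins d k R T ×
      ((((Unit × (Fin R → ℝ)) × (Fin k → ℝ)) × (Fin k → ℝ)) × ℝ) => q.2.1.2 := by fun_prop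
    have e3 : Measurable fun q : TesterCoins d k R T ×
      ((((Unit × (Fin R → ℝ)) × (Fin k → ℝ)) × (Fin k → ℝ)) × ℝ) => q.2.2 := by fun_prop
    have h8 := measurableSet_le (measurable_const (a := (0 : ℝ)))
      (e3.add ((hoffm.comp e1).mul (Measurable.dot e2 e2)))
    convert h8 using 1
    ext q; simp
  have h8 := h7.map hout
  have e : R + k + T + k + 1 = 0 + R + k + T + k + 1 := by omega
  rw [e]
  convert h8 using 2 with A
  funext ω
  have hs : normShift b A ω.1.2 = sh (((), fun r => (ω.1.2 r).2 ⬝ᵥ (A *ᵥ (ω.1.2 r).1)),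
      fun j => (fun i => ω.1.1 i j) ⬝ᵥ (A *ᵥ fun i => ω.1.1 i j)) := by
    simp only [normShift, hsh, dotProduct_comm (A *ᵥ _)]
  have hN : shiftedSketch (normShift b A ω.1.2) A ω.1.1 = sketch A ω.1.1 +
      off (((), fun r => (ω.1.2 r).2 ⬝ᵥ (A *ᵥ (ω.1.2 r).1)),
      fun j => (fun i => ω.1.1 i j) ⬝ᵥ (A *ᵥ fun i => ω.1.1 i j)) • 1 := by
    rw [shiftedSketch, trace_sketch_eq, hs, Fintype.card_fin]
  have hvec : ∀ (o : ℝ) (x : Fin k → ℝ), (sketch A ω.1.1 + o • 1) *ᵥ x =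
      (fun j => (fun i => ω.1.1 i j) ⬝ᵥ (A *ᵥ (Matrix.of ω.1.1 *ᵥ x))) + o • x := by
    intro o x
    ext j
    have h1 := dotProduct_sketch_add_mulVec A ω.1.1 o (Pi.single j 1) x
    simp only [Matrix.mulVec_single_one, single_one_dotProduct] at h1
    exact h1
  refine decide_eq_decide.2 ?_
  simp only [candidate]
  rw [hN, hs, dotProduct_sketch_add_mulVec]
  simp only [hvec]

end Tester

/-! ### Uniform law on a finite type. -/

section Uniform

/-- The uniform probability measure on a finite type. -/
noncomputable def uniformLaw (α : Type*) [MeasurableSpace α] : Measure α :=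
  ProbabilityTheory.uniformOn Set.univ

instance (α : Type*) [MeasurableSpace α] [MeasurableSingletonClass α] [Finite α] [Nonempty α] :
    IsProbabilityMeasure (uniformLaw α) :=
  ProbabilityTheory.isProbabilityMeasure_uniformOn Set.finite_univ Set.univ_nonempty

lemma uniformLaw_real {α : Type*} [Fintype α] [MeasurableSpace α] [MeasurableSingletonClass α]
    (p : α → Prop) [DecidablePred p] :
    (uniformLaw α).real {x | p x} = 𝔼 x, (if p x then (1 : ℝ) else 0) := by
  rw [Measure.real, uniformLaw, ProbabilityTheory.uniformOn_univ, ENNReal.toReal_div,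
    Measure.count_apply_finite _ (Set.toFinite _)]
  rw [Fintype.expect_eq_sum_div_card, Finset.sum_boole]
  simp only [ENNReal.toReal_natCast]
  congr 3
  ext x; simp

end Uniform

/-! ### Choice of the iteration parameters; failure probability of the candidate. -/

section Candidate
variable {k T : ℕ}

lemma gauss_markov {ι : Type*} [Fintype ι] {f : (ι → ℝ) → ℝ} (hf : Integrable f (gauss ι))
    (h0 : ∀ x, 0 ≤ f x) {m c : ℝ} (hm : ∫ x, f x ∂gauss ι = m) (hm0 : 0 < m) (hc : 0 < c) :
    (gauss ι).real {x | c * m ≤ f x} ≤ 1 / c := by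
  have h := mul_meas_ge_le_integral_of_nonneg (Filter.Eventually.of_forall h0) hf (c * m)
  rw [hm] at h
  rw [le_div_iff₀ hc]
  have := le_of_mul_le_mul_right (a := m) (b := c * (gauss ι).real {x | c * m ≤ f x}) (c := 1)
    (by linarith) hm0
  linarith

/-- A generic start has a component along `u` that is not tiny, and typical values of `‖x‖²` and
`‖Nx‖²`. Each condition fails with probability at most `1/300`. -/
lemma gauss_start_bad {N : Matrix (Fin k) (Fin k) ℝ} (hk : 0 < k) (hN : 0 < frobSq N)
    {u : Fin k → ℝ} (hu : u ⬝ᵥ u = 1) :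
    (gauss (Fin k)).real {x | ¬ ((1 / 300 : ℝ) ^ 2 < (u ⬝ᵥ x) ^ 2 ∧ x ⬝ᵥ x ≤ 300 * k ∧
      (N *ᵥ x) ⬝ᵥ (N *ᵥ x) ≤ 300 * frobSq N)} ≤ 1 / 100 := by
  have h1 := gauss_small_ball hu (s := 1 / 300) (by norm_num)
  have hk' : (0 : ℝ) < k := by exact_mod_cast hk
  have h2 := gauss_markov (c := 300) (integrable_mulVec_dot_self (1 : Matrix (Fin k) (Fin k) ℝ))
    (fun _ => dotProduct_self_nonneg' _) (integral_mulVec_dot_self _) (by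
      rw [frobSq_eq_trace]; simpa using hk) (by norm_num)
  have h3 := gauss_markov (c := 300) (integrable_mulVec_dot_self N)
    (fun _ => dotProduct_self_nonneg' _) (integral_mulVec_dot_self _) hN (by norm_num)
  simp only [frobSq_eq_trace, Matrix.one_mulVec, Matrix.transpose_one, mul_one, Matrix.trace_one,
    Fintype.card_fin] at h2
  refine (measureReal_mono (s₂ := {x | (u ⬝ᵥ x) ^ 2 ≤ (1 / 300 : ℝ) ^ 2} ∪
    ({x | 300 * (k : ℝ) ≤ x ⬝ᵥ x} ∪
      {x | 300 * frobSq N ≤ (N *ᵥ x) ⬝ᵥ (N *ᵥ x)})) ?_).trans ?_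
  · intro x hx
    simp only [Set.mem_ofPred_eq, Set.mem_union] at hx ⊢
    by_contra h
    push Not at h
    exact hx ⟨h.1, h.2.1.le, h.2.2.le⟩
  · refine (measureReal_union_le _ _).trans ?_
    have := measureReal_union_le (μ := gauss (Fin k)) {x | 300 * (k : ℝ) ≤ x ⬝ᵥ x}
      {x | 300 * frobSq N ≤ (N *ᵥ x) ⬝ᵥ (N *ᵥ x)}
    linarith

/-- The relations between the parameters of the stochastic gradient iteration. -/
structure IterationParams (K k L c T : ℝ) : Prop where
  one_le_K : 1 ≤ K
  one_le_k : 1 ≤ k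
  hL : L = 20 + Real.log K + 2 * Real.log k
  hc : c = 1 / (2 * 10 ^ 11 * K * L)
  le_T : k * L / c ≤ T
  T_le : T ≤ k * L / c + 1

namespace IterationParams
variable {K k L c T : ℝ} (h : IterationParams K k L c T)
include h

lemma twenty_le_L : 20 ≤ L := by
  rw [h.hL]
  have := Real.log_nonneg h.one_le_K
  have := Real.log_nonneg h.one_le_k
  linarith

lemma c_pos : 0 < c := by
  have := h.twenty_le_L
  have := h.one_le_K
  rw [h.hc]; positivity

lemma KLc : K * L * c = 1 / (2 * 10 ^ 11) := by
  have := h.twenty_le_L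
  have := h.one_le_K
  rw [h.hc]
  field_simp

lemma c_le : c ≤ 1 / 10 ^ 12 := by
  have h1 := h.KLc
  have h2 : 20 * c ≤ K * L * c := by
    apply mul_le_mul_of_nonneg_right _ h.c_pos.le
    nlinarith [h.twenty_le_L, h.one_le_K]
  linarith

lemma T_pos : 0 < T := by
  have := h.twenty_le_L
  have := h.one_le_k
  have := h.c_pos
  exact lt_of_lt_of_le (by positivity) h.le_T

/-- With `η = c/(ks)` and `‖N‖_F² ≤ Kks²`, this quantity bounds `η² T ‖N‖_F²`, which governs both
the relative variance of the growth and the chance of a bad step. It is about `KLc`, which explains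
the choice of `c`. -/
lemma theta_le : K * c ^ 2 * T / k ≤ 1 / 10 ^ 11 := by
  have hk : 0 < k := by linarith [h.one_le_k]
  have hK : 0 < K := by linarith [h.one_le_K]
  have hc := h.c_pos
  have hL := h.twenty_le_L
  rw [div_le_iff₀ hk]
  have h1 : K * c ^ 2 * T ≤ K * c ^ 2 * (k * L / c + 1) :=
    mul_le_mul_of_nonneg_left h.T_le (by positivity)
  have h2 : K * c ^ 2 * (k * L / c + 1) = (K * L * c) * k + K * c * c := by
    field_simp
  have h3 : K * c ≤ 1 / (2 * 10 ^ 11) := by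
    rw [← h.KLc]; nlinarith [mul_pos hK hc]
  have h4 : K * c * c ≤ 1 / (2 * 10 ^ 11) * 1 := by
    apply mul_le_mul h3 _ hc.le (by norm_num)
    linarith [h.c_le]
  rw [h2, h.KLc] at h1
  nlinarith [h.one_le_k]

/-- The growth `(1 + ηl)^(2T) ≥ exp(2L)` has to beat factors polynomial in `K` and `k`; this fixes
`L`. -/
lemma exp_two_mul_L : 10 ^ 12 * K ^ 2 * k ^ 4 ≤ Real.exp (2 * L) := by
  have hk : 0 < k := by linarith [h.one_le_k]
  have hK : 0 < K := by linarith [h.one_le_K]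
  have e : 2 * L = 40 * 1 + 2 * Real.log K + 4 * Real.log k := by rw [h.hL]; ring
  rw [e, Real.exp_add, Real.exp_add]
  have e1 : Real.exp (2 * Real.log K) = K ^ 2 := by
    rw [← Real.exp_log hK, Real.log_exp, ← Real.exp_nat_mul]; norm_num
  have e2 : Real.exp (4 * Real.log k) = k ^ 4 := by
    rw [← Real.exp_log hk, Real.log_exp, ← Real.exp_nat_mul]; norm_num
  rw [e1, e2]
  have h2 : (2 : ℝ) ^ 40 ≤ Real.exp (40 * 1) := by
    have := Real.exp_nat_mul (1 : ℝ) 40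
    push_cast at this
    rw [this]
    refine pow_le_pow_left₀ (by norm_num) ?_ _
    have := Real.add_one_le_exp (1 : ℝ)
    linarith
  gcongr
  refine le_trans ?_ h2
  norm_num

end IterationParams

lemma exp_half_le_one_add {y : ℝ} (h0 : 0 ≤ y) (h1 : y ≤ 1) : Real.exp (y / 2) ≤ 1 + y := by
  have := Real.exp_bound_div_one_sub_of_interval (x := y / 2) (by linarith) (by linarith)
  refine this.trans ?_
  rw [div_le_iff₀ (by linarith)]
  nlinarith

lemma candidate_sign_bound {K L c : ℝ} (h : IterationParams K k L c T)
    {N : Matrix (Fin k) (Fin k) ℝ} (hN : N.IsSymm) {s : ℝ} (hs : 0 < s)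
    (htr : N.trace = k * s) (hfr : frobSq N ≤ K * k * s ^ 2) {l : ℝ} {u : Fin k → ℝ}
    (hl2 : 2 * s ≤ l) (hu : N *ᵥ u = -l • u) (hu1 : u ⬝ᵥ u = 1)
    (hl : ∀ y : Fin k → ℝ, -l * (y ⬝ᵥ y) ≤ y ⬝ᵥ (N *ᵥ y)) {x : Fin k → ℝ}
    (hx1 : (1 / 300 : ℝ) ^ 2 < (u ⬝ᵥ x) ^ 2) (hx2 : x ⬝ᵥ x ≤ 300 * k)
    (hx3 : (N *ᵥ x) ⬝ᵥ (N *ᵥ x) ≤ 300 * frobSq N) :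
    (uniformLaw (Fin T → Fin k → Bool)).real
      {σ | 0 ≤ candidate N (c / k / s) (1 / (K * k) / s) x σ ⬝ᵥ
        (N *ᵥ candidate N (c / k / s) (1 / (K * k) / s) x σ)} ≤ 1 / 100 := by
  classical
  have hk1 := h.one_le_k
  have hk : (0 : ℝ) < k := by linarith
  have hK1 := h.one_le_K
  have hK : (0 : ℝ) < K := by linarith
  have hc := h.c_pos
  have hc12 := h.c_le
  have hT := h.T_pos
  have hfr0 := frobSq_nonneg N
  have hsq : √(frobSq N) ≤ K * k * s := by
    rw [← Real.sqrt_sq (by positivity : 0 ≤ K * k * s)]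
    apply Real.sqrt_le_sqrt
    refine hfr.trans ?_
    have : 1 ≤ K * k := by nlinarith
    have : K * k * s ^ 2 * 1 ≤ K * k * s ^ 2 * (K * k) :=
      mul_le_mul_of_nonneg_left this (by positivity)
    nlinarith
  have hY : u ⬝ᵥ x ≠ 0 := by
    intro h0; rw [h0] at hx1; norm_num at hx1
  -- With this `Δ`, `η(tr N + Δ) = c + 1/2 ≤ 1`, so `gᵀNg` may exceed its mean by the large factor
  -- `1/(2c)`. The value of `α` is the inverse of the bound `Kks` on `‖N‖_F`.
  have key := expect_gradIter_nonneg_le (N := N) (l := l) (u := u) (η := c / k / s) hN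
    (by positivity) (by linarith) hl hu hu1 T x (Δ := k * s / (2 * c))
    (α := 1 / (K * k) / s) (by positivity) ?_ (by positivity) ?_ hY ?_
  · rw [uniformLaw_real]
    refine key.trans ?_
    have hq : (1 + 3 * (c / k / s) ^ 2 * frobSq N) ^ T ≤ Real.exp 1 := by
      have h1 : 3 * (c / k / s) ^ 2 * frobSq N ≤ 3 * (K * c ^ 2 / k) := by
        have : 3 * (c / k / s) ^ 2 * frobSq N ≤ 3 * (c / k / s) ^ 2 * (K * k * s ^ 2) := by gcongr
        refine this.trans (le_of_eq ?_)
        field_simp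
      have h2 : 1 + 3 * (c / k / s) ^ 2 * frobSq N ≤ Real.exp (3 * (K * c ^ 2 / k)) :=
        le_trans (by linarith) (Real.add_one_le_exp _)
      refine (pow_le_pow_left₀ (by positivity) h2 T).trans ?_
      rw [← Real.exp_nat_mul]
      apply Real.exp_le_exp.2
      have := h.theta_le
      have e : (T : ℝ) * (3 * (K * c ^ 2 / k)) = 3 * (K * c ^ 2 * T / k) := by ring
      rw [e]; linarith
    have hq3 : (1 + 3 * (c / k / s) ^ 2 * frobSq N) ^ T ≤ 3 := by
      linarith [Real.exp_one_lt_d9]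
    have ht1 : 4 * (2 * (c / k / s) ^ 2 * T * (1 + 3 * (c / k / s) ^ 2 * frobSq N) ^ T *
        ((N *ᵥ x) ⬝ᵥ (N *ᵥ x))) / (u ⬝ᵥ x) ^ 2 ≤ 1 / 125 := by
      rw [div_le_iff₀ (by positivity)]
      have h1 : 4 * (2 * (c / k / s) ^ 2 * T * (1 + 3 * (c / k / s) ^ 2 * frobSq N) ^ T *
        ((N *ᵥ x) ⬝ᵥ (N *ᵥ x))) ≤ 4 * (2 * (c / k / s) ^ 2 * T * 3 *
          (300 * (K * k * s ^ 2))) := by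
        have h0 := dotProduct_self_nonneg' (N *ᵥ x)
        have h3 : (N *ᵥ x) ⬝ᵥ (N *ᵥ x) ≤ 300 * (K * k * s ^ 2) := by linarith
        gcongr
      have h2 : 4 * (2 * (c / k / s) ^ 2 * T * 3 * (300 * (K * k * s ^ 2))) =
          7200 * (K * c ^ 2 * T / k) := by field_simp; ring
      have := h.theta_le
      rw [h2] at h1
      have h4 : 1 / 125 * (1 / 300 : ℝ) ^ 2 ≤ 1 / 125 * (u ⬝ᵥ x) ^ 2 := by linarith
      refine le_trans ?_ h4
      refine h1.trans ?_
      norm_num at this ⊢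
      linarith
    have ht2 : T * (2 * frobSq N / (k * s / (2 * c)) ^ 2) ≤ 1 / 1000 := by
      have h1 : T * (2 * frobSq N / (k * s / (2 * c)) ^ 2) ≤
          T * (2 * (K * k * s ^ 2) / (k * s / (2 * c)) ^ 2) := by gcongr
      have h2 : T * (2 * (K * k * s ^ 2) / (k * s / (2 * c)) ^ 2) =
          8 * (K * c ^ 2 * T / k) := by field_simp; ring
      have := h.theta_le
      rw [h2] at h1
      linarith
    linarith
  · rw [htr]
    have : c / k / s * (k * s + k * s / (2 * c)) = c + 1 / 2 := by field_simp
    rw [this]; linarith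
  · have : 1 / (K * k) / s * √(frobSq N) ≤ 1 / (K * k) / s * (K * k * s) := by gcongr
    refine this.trans (le_of_eq ?_)
    field_simp
  · have h1 : x ⬝ᵥ (N *ᵥ x) ≤ K * k * s * (300 * k) := by
      refine (le_abs_self _).trans ((abs_quadratic_le N x).trans ?_)
      have := dotProduct_self_nonneg' x
      gcongr
    have hrho : Real.exp (2 * L) ≤ ((1 + c / k / s * l) ^ T) ^ 2 := by
      have hy : 2 * c / k ≤ c / k / s * l := by
        have : c / k / s * (2 * s) ≤ c / k / s * l := by gcongr
        refine le_trans (le_of_eq ?_) this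
        field_simp
      have hy1 : 2 * c / k ≤ 1 := by
        rw [div_le_one hk]; linarith
      have h2 := exp_half_le_one_add (y := 2 * c / k) (by positivity) hy1
      have h3 : Real.exp (2 * c / k / 2) ≤ 1 + c / k / s * l := by linarith
      have h4 := pow_le_pow_left₀ (Real.exp_pos _).le h3 (T * 2)
      rw [← Real.exp_nat_mul, pow_mul] at h4
      refine le_trans (Real.exp_le_exp.2 ?_) h4
      push_cast
      have h5 := h.le_T
      rw [div_le_iff₀ hc] at h5
      have : (T : ℝ) * 2 * (2 * c / k / 2) = 2 * (T * c) / k := by ring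
      rw [this, le_div_iff₀ hk]
      linarith
    have hexp := h.exp_two_mul_L
    have h6 : 10 ^ 12 * K ^ 2 * k ^ 4 * (1 / 300) ^ 2 ≤ ((1 + c / k / s * l) ^ T * (u ⬝ᵥ x)) ^ 2 := by
      rw [mul_pow]
      exact mul_le_mul (hexp.trans hrho) hx1.le (by positivity) (by positivity)
    -- The guaranteed decrease is of order `K s k³`, with constant `10^12/300²`; the initial value
    -- of the form is at most `300 K s k²`.
    have h7 : 1 / (K * k) / s * ((2 * s) ^ 2 * (10 ^ 12 * K ^ 2 * k ^ 4 * (1 / 300) ^ 2 / 4)) ≤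
        1 / (K * k) / s * (l ^ 2 * (((1 + c / k / s * l) ^ T * (u ⬝ᵥ x)) ^ 2 / 4)) := by
      gcongr
    refine lt_of_le_of_lt h1 (lt_of_lt_of_le ?_ h7)
    have h8 : 1 / (K * k) / s * ((2 * s) ^ 2 * (10 ^ 12 * K ^ 2 * k ^ 4 * (1 / 300) ^ 2 / 4)) =
        (10 ^ 12 / 300 ^ 2) * (K * s * k ^ 2 * k) := by field_simp; norm_num
    rw [h8]
    have h9 : 0 < K * s * k ^ 2 := by positivity
    have h10 : K * s * k ^ 2 * 1 ≤ K * s * k ^ 2 * k := mul_le_mul_of_nonneg_left hk1 h9.le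
    have h11 : K * k * s * (300 * k) = 300 * (K * s * k ^ 2) := by ring
    rw [h11]
    nlinarith

lemma candidate_failure {K L c : ℝ} (h : IterationParams K k L c T)
    {N : Matrix (Fin k) (Fin k) ℝ} (hN : N.IsSymm) {s : ℝ} (hs : 0 < s)
    (htr : N.trace = k * s) (hfr : frobSq N ≤ K * k * s ^ 2) {x : Fin k → ℝ}
    (hx : 0 < x ⬝ᵥ x) (hxN : x ⬝ᵥ (N *ᵥ x) ≤ -(2 * s) * (x ⬝ᵥ x))
    (hmeas : MeasurableSet {ω : (Fin k → ℝ) × (Fin T → Fin k → Bool) |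
      0 ≤ candidate N (c / k / s) (1 / (K * k) / s) ω.1 ω.2 ⬝ᵥ
        (N *ᵥ candidate N (c / k / s) (1 / (K * k) / s) ω.1 ω.2)}) :
    ((gauss (Fin k)).prod (uniformLaw (Fin T → Fin k → Bool))).real
      {ω | 0 ≤ candidate N (c / k / s) (1 / (K * k) / s) ω.1 ω.2 ⬝ᵥ
        (N *ᵥ candidate N (c / k / s) (1 / (K * k) / s) ω.1 ω.2)} ≤ 1 / 50 := by
  have hk : 0 < k := by
    have := h.one_le_k
    exact_mod_cast lt_of_lt_of_le one_pos this
  have : Nonempty (Fin k) := ⟨⟨0, hk⟩⟩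
  obtain ⟨l, u, hl2, hu, hu1, hl⟩ := exists_min_eigenvector hN hx hxN
  have hfr0 : 0 < frobSq N := by
    refine (frobSq_nonneg N).lt_of_ne fun h0 => ?_
    have hk' : (0 : ℝ) < k := by exact_mod_cast hk
    have : N = 0 := frobSq_eq_zero h0.symm
    rw [this, Matrix.trace_zero] at htr
    have : 0 < k * s := by positivity
    linarith
  refine (measureReal_prod_le hmeas (by norm_num) (gauss_start_bad hk hfr0 hu1)
    (b := 1 / 100) fun y hy => ?_).trans (by norm_num)
  simp only [Set.mem_ofPred_eq, not_not] at hy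
  exact candidate_sign_bound h hN hs htr hfr hl2 hu hu1 hl hy.1 hy.2.1 hy.2.2

end Candidate

/-! ### With high probability the sketch separates the two cases. -/

section GoodSketch
variable {d k R : ℕ}

lemma measureReal_prod_or_le {α β : Type*} [MeasurableSpace α] [MeasurableSpace β] {μ : Measure α}
    {ν : Measure β} [IsProbabilityMeasure μ] [IsProbabilityMeasure ν] {p : α → Prop}
    {q : β → Prop} {a b : ℝ} (ha : μ.real {x | p x} ≤ a) (hb : ν.real {y | q y} ≤ b) :
    (μ.prod ν).real {z | p z.1 ∨ q z.2} ≤ a + b := by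
  have h : {z : α × β | p z.1 ∨ q z.2} = {x | p x} ×ˢ Set.univ ∪ Set.univ ×ˢ {y | q y} := by
    ext z; simp
  rw [h]
  refine (measureReal_union_le _ _).trans ?_
  rw [measureReal_prod_prod, measureReal_prod_prod]
  simp only [probReal_univ, mul_one, one_mul]
  linarith

lemma measureReal_or_le {α : Type*} [MeasurableSpace α] {μ : Measure α}
    [IsProbabilityMeasure μ] {p q : α → Prop} {a b : ℝ} (ha : μ.real {x | p x} ≤ a)
    (hb : μ.real {x | q x} ≤ b) : μ.real {x | p x ∨ q x} ≤ a + b :=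
  (measureReal_union_le {x | p x} {x | q x}).trans (add_le_add ha hb)

/-- The dimension `k` of the sketch is large enough for the distance `ε`. -/
structure SketchParams (ε k : ℝ) : Prop where
  pos : 0 < ε
  le_one : ε ≤ 1
  one_le_k : 1 ≤ k
  log_le : 4 * 10 ^ 7 * Real.log (2 * k + 1) ≤ ε ^ 2 * k

namespace SketchParams
variable {ε κ : ℝ} (h : SketchParams ε κ)
include h

lemma one_le_log : 1 ≤ Real.log (2 * κ + 1) := by
  have := h.one_le_k
  rw [Real.le_log_iff_exp_le (by linarith)]
  linarith [Real.exp_one_lt_d9]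

lemma le_sq_mul : 4 * 10 ^ 7 ≤ ε ^ 2 * κ := by
  have := h.one_le_log
  have := h.log_le
  linarith

lemma le_mul : 4 * 10 ^ 7 ≤ ε * κ := by
  have := h.le_sq_mul
  have h1 := h.pos
  have h2 := h.le_one
  have h3 := h.one_le_k
  have : ε * (ε * κ) ≤ 1 * (ε * κ) := mul_le_mul_of_nonneg_right h2 (by positivity)
  nlinarith

lemma le_k : 4 * 10 ^ 7 ≤ κ := by
  have := h.le_mul
  have h1 := h.pos
  have h2 := h.le_one
  have h3 := h.one_le_k
  nlinarith

lemma mul_sqrt_le : 1152 * √κ ≤ ε * κ / 4 := by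
  have h1 := h.le_sq_mul
  have h0 := h.pos
  have h3 := h.one_le_k
  have hs : √κ * √κ = κ := Real.mul_self_sqrt (by linarith)
  have hp : 0 < √κ := Real.sqrt_pos.2 (by linarith)
  have h4 : 4608 ≤ ε * √κ := by
    refine le_of_sq_le_sq ?_ (by positivity)
    rw [mul_pow, sq √κ, hs]
    linarith
  nlinarith

lemma mul_sqrt_log_le : 96 * √(κ * Real.log (2 * κ + 1)) ≤ ε * κ / 64 := by
  have h1 := h.log_le
  have h0 := h.pos
  have h3 := h.one_le_k
  have hl := h.one_le_log
  have h4 : √(κ * Real.log (2 * κ + 1)) ≤ ε * κ / 6144 := by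
    apply Real.sqrt_le_iff.2
    refine ⟨by positivity, ?_⟩
    have : κ * (6144 ^ 2 * Real.log (2 * κ + 1)) ≤ κ * (ε ^ 2 * κ) := by
      apply mul_le_mul_of_nonneg_left _ (by linarith)
      linarith
    rw [div_pow, le_div_iff₀ (by norm_num)]
    linarith
  linarith

end SketchParams

/-- The estimate of `‖A‖_F²` lies between `1/4` and `7/4` of the truth; the roots lie between `1/2`
and `4/3`. -/
lemma normShift_bounds {b : ℝ} (hb : 0 ≤ b) {A : Matrix (Fin d) (Fin d) ℝ}
    {H : Fin R → (Fin d → ℝ) × (Fin d → ℝ)}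
    (h : ¬ 3 / 4 * frobSq A < |(∑ r, ((A *ᵥ (H r).1) ⬝ᵥ (H r).2) ^ 2) / R - frobSq A|) :
    b * √(frobSq A) / 2 ≤ normShift b A H ∧ normShift b A H ≤ 4 / 3 * (b * √(frobSq A)) := by
  rw [not_lt, abs_le] at h
  have h0 := frobSq_nonneg A
  set E := (∑ r, ((A *ᵥ (H r).1) ⬝ᵥ (H r).2) ^ 2) / (R : ℝ) with hE
  have h1 : √(frobSq A) / 2 ≤ √E := by
    apply Real.le_sqrt_of_sq_le
    rw [div_pow, Real.sq_sqrt h0]; linarith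
  have h2 : √E ≤ 4 / 3 * √(frobSq A) := by
    apply Real.sqrt_le_iff.2
    refine ⟨by positivity, ?_⟩
    rw [mul_pow, Real.sq_sqrt h0]; linarith
  have e : normShift b A H = b * √E := rfl
  rw [e]
  constructor
  · have := mul_le_mul_of_nonneg_left h1 hb; linarith
  · have := mul_le_mul_of_nonneg_left h2 hb; linarith

lemma abs_trace_centredSketch_le (hk : 0 < k) {A : Matrix (Fin d) (Fin d) ℝ}
    {G : Fin d → Fin k → ℝ} (hG : frobSq (centredSketch A G) ≤ (18 * k * √(frobSq A)) ^ 2) :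
    |(centredSketch A G).trace / k| ≤ 18 * √k * √(frobSq A) := by
  have := abs_trace_div_card_le (ι := Fin k) (by simpa using hk) (M := centredSketch A G)
    (b := 18 * √k * √(frobSq A)) (by positivity) (by
      refine hG.trans (le_of_eq ?_)
      rw [Fintype.card_fin, mul_pow, mul_pow, mul_pow, mul_pow, Real.sq_sqrt (Nat.cast_nonneg k)]
      ring)
  simpa using this

lemma shiftedSketch_nonneg {ε : ℝ} (h : SketchParams ε k) {A : Matrix (Fin d) (Fin d) ℝ}
    {G : Fin d → Fin k → ℝ} {s : ℝ} (hs : ε * k / 32 * √(frobSq A) / 2 ≤ s)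
    (hG : frobSq (centredSketch A G) ≤ (18 * k * √(frobSq A)) ^ 2)
    (hlow : ∀ x, -((4 * (6 * √(k * Real.log (2 * k + 1)) * √(frobSq A)) +
      3 * (18 * k * √(frobSq A)) / √k) * (x ⬝ᵥ x)) ≤ x ⬝ᵥ (centredSketch A G *ᵥ x))
    (x : Fin k → ℝ) : 0 ≤ x ⬝ᵥ (shiftedSketch s A G *ᵥ x) := by
  have hk1 := h.one_le_k
  have hk : 0 < k := by exact_mod_cast (by linarith : (0 : ℝ) < k)
  have hk' : (0 : ℝ) < k := by linarith
  have h1 := (abs_le.1 (abs_trace_centredSketch_le hk hG)).2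
  have h2 := hlow x
  have h3 := h.mul_sqrt_log_le
  have h3l : √k ≤ √(k * Real.log (2 * k + 1)) := by
    apply Real.sqrt_le_sqrt
    have := h.one_le_log
    nlinarith
  have hF := Real.sqrt_nonneg (frobSq A)
  have hx := dotProduct_self_nonneg' x
  have e1 : 3 * (18 * k * √(frobSq A)) / √k = 54 * √k * √(frobSq A) := by
    have : √(k : ℝ) * √k = k := Real.mul_self_sqrt hk'.le
    have hp : 0 < √(k : ℝ) := Real.sqrt_pos.2 hk'
    rw [div_eq_iff hp.ne']
    linear_combination (-54) * √(frobSq A) * this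
  rw [e1] at h2
  rw [shiftedSketch_quadratic (by simpa using hk), Fintype.card_fin]
  set τ := (centredSketch A G).trace / (k : ℝ)
  set F := √(frobSq A)
  set q := √(k * Real.log (2 * k + 1))
  have h4 : 96 * q * F ≤ ε * k / 64 * F := mul_le_mul_of_nonneg_right h3 hF
  have h5 : √k * F ≤ q * F := mul_le_mul_of_nonneg_right h3l hF
  -- Grid bound 24, rounding error 54 and trace fluctuation 18 add up to `96qF ≤ (εk/64)F ≤ s`.
  have h6 : 4 * (6 * q * F) + 54 * √k * F ≤ s - τ := by linarith
  have h7 := mul_le_mul_of_nonneg_right h6 hx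
  linarith

lemma centredSketch_frobSq_bad {A : Matrix (Fin d) (Fin d) ℝ} (hA : A.IsSymm) (hk : 0 < k) :
    (gaussRows (Fin d) (Fin k)).real
      {G | (18 * k * √(frobSq A)) ^ 2 < frobSq (centredSketch A G)} ≤ 1 / 100 := by
  have hk' : (0 : ℝ) < k := by exact_mod_cast hk
  rcases (frobSq_nonneg A).eq_or_lt with h0 | h0
  · have hA0 : A = 0 := frobSq_eq_zero h0.symm
    have : {G : Fin d → Fin k → ℝ | (18 * k * √(frobSq A)) ^ 2 < frobSq (centredSketch A G)} = ∅ := by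
      ext G
      simp [hA0, centredSketch, sketch, frobSq]
    rw [this]; simp
  · refine (measureReal_mono (s₂ := {G | (18 * k * √(frobSq A)) ^ 2 ≤
      frobSq (centredSketch A G)}) fun G hG => le_of_lt (Set.mem_ofPred_eq ▸ hG)).trans ?_
    refine (centredSketch_frobSq_tail hA (by have := Real.sqrt_pos.2 h0; positivity)).trans ?_
    rw [Fintype.card_fin, mul_pow, Real.sq_sqrt h0.le, div_le_iff₀ (by positivity)]
    have : 0 < (k : ℝ) ^ 2 * frobSq A := by positivity
    nlinarith

lemma frobSq_estimate_bad (hR : 1600 ≤ R) (A : Matrix (Fin d) (Fin d) ℝ) :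
    (Measure.pi fun _ : Fin R => (gauss (Fin d)).prod (gauss (Fin d))).real
      {H | 3 / 4 * frobSq A < |(∑ r, ((A *ᵥ (H r).1) ⬝ᵥ (H r).2) ^ 2) / R - frobSq A|} ≤
      1 / 100 := by
  refine (frobSq_estimate_tail A (by omega)).trans ?_
  have : (1600 : ℝ) ≤ R := by exact_mod_cast hR
  rw [div_le_iff₀ (by linarith)]
  linarith

lemma sketch_bad_of_posSemidef {ε : ℝ} (h : SketchParams ε k) (hR : 1600 ≤ R)
    {A : Matrix (Fin d) (Fin d) ℝ} (hA : A.IsSymm) (hpsd : A.PosSemidef) :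
    ((gaussRows (Fin d) (Fin k)).prod (Measure.pi fun _ : Fin R =>
      (gauss (Fin d)).prod (gauss (Fin d)))).real {z | ¬ ∀ x : Fin k → ℝ,
        0 ≤ x ⬝ᵥ (shiftedSketch (normShift (ε * k / 32) A z.2) A z.1 *ᵥ x)} ≤ 3 / 100 := by
  have hk1 := h.one_le_k
  have hk : 0 < k := by exact_mod_cast (by linarith : (0 : ℝ) < k)
  have hk' : (0 : ℝ) < k := by linarith
  have hl := h.one_le_log
  have hlow : (gaussRows (Fin d) (Fin k)).real
      {G | frobSq (centredSketch A G) ≤ (18 * k * √(frobSq A)) ^ 2 ∧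
      ¬ ∀ x, -((4 * (6 * √(k * Real.log (2 * k + 1)) * √(frobSq A)) +
      3 * (18 * k * √(frobSq A)) / √k) * (x ⬝ᵥ x)) ≤ x ⬝ᵥ (centredSketch A G *ᵥ x)} ≤ 1 / 100 := by
    have h1 := centredSketch_uniform_lower_tail (ι := Fin k) (by simpa using hk) hA hpsd
      (t := 6 * √(k * Real.log (2 * k + 1))) (R := 18 * k * √(frobSq A))
      (by have := Real.sqrt_pos.2 (show 0 < k * Real.log (2 * k + 1) by positivity); positivity)
      (by positivity)
    simp only [Fintype.card_fin] at h1
    refine h1.trans ?_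
    have e1 : ((2 * k + 1 : ℝ)) ^ k = Real.exp (k * Real.log (2 * k + 1)) := by
      rw [Real.exp_nat_mul, Real.exp_log (by positivity)]
    -- This `t` makes the exponent six times the logarithm of the number of grid points.
    have e2 : (6 * √(k * Real.log (2 * k + 1))) ^ 2 / 6 = 6 * (k * Real.log (2 * k + 1)) := by
      rw [mul_pow, Real.sq_sqrt (by positivity)]; ring
    rw [e1, e2, ← Real.exp_add]
    have e3 : k * Real.log (2 * k + 1) + -(6 * (k * Real.log (2 * k + 1))) ≤ -(100 : ℝ) := by
      have := h.le_k
      nlinarith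
    refine (Real.exp_le_exp.2 e3).trans ?_
    rw [Real.exp_neg, ← one_div]
    apply one_div_le_one_div_of_le (by norm_num)
    linarith [Real.add_one_le_exp (100 : ℝ)]
  have hG := measureReal_or_le (centredSketch_frobSq_bad hA hk) hlow
  have hGH := measureReal_prod_or_le hG (frobSq_estimate_bad hR A)
  refine (measureReal_mono ?_).trans (hGH.trans (by norm_num))
  intro z hz
  simp only [Set.mem_ofPred_eq] at hz ⊢
  by_contra hc
  rw [not_or, not_or, not_and_not_right] at hc
  refine hz (shiftedSketch_nonneg h (normShift_bounds ?_ hc.2).1 (not_lt.1 hc.1.1)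
    (hc.1.2 (not_lt.1 hc.1.1)))
  have := h.pos
  positivity

lemma shiftedSketch_far {ε : ℝ} (h : SketchParams ε k) {A : Matrix (Fin d) (Fin d) ℝ}
    {G : Fin d → Fin k → ℝ} {s : ℝ} (hF : 0 < √(frobSq A))
    (hs : ε * k / 32 * √(frobSq A) / 2 ≤ s) (hs' : s ≤ 4 / 3 * (ε * k / 32 * √(frobSq A)))
    (hG : frobSq (centredSketch A G) ≤ (18 * k * √(frobSq A)) ^ 2)
    (hneg : ∃ x : Fin k → ℝ, 0 < x ⬝ᵥ x ∧
      x ⬝ᵥ (centredSketch A G *ᵥ x) ≤ -(ε * k / 4 * √(frobSq A) * (x ⬝ᵥ x))) :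
    0 < s ∧ frobSq (shiftedSketch s A G) ≤ 10 ^ 7 * k * s ^ 2 ∧ ∃ x : Fin k → ℝ, 0 < x ⬝ᵥ x ∧
        x ⬝ᵥ (shiftedSketch s A G *ᵥ x) ≤ -(2 * s) * (x ⬝ᵥ x) := by
  have hk1 := h.one_le_k
  have hk : 0 < k := by exact_mod_cast (by linarith : (0 : ℝ) < k)
  have hk' : (0 : ℝ) < k := by linarith
  have hε := h.pos
  have h1 := (abs_le.1 (abs_trace_centredSketch_le hk hG)).1
  set F := √(frobSq A)
  refine ⟨lt_of_lt_of_le (by positivity) hs, ?_, ?_⟩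
  · refine (frobSq_shiftedSketch_le (by simpa using hk) s A G).trans ?_
    rw [Fintype.card_fin]
    have h2 : (ε * k / 32 * F / 2) ^ 2 ≤ s ^ 2 := pow_le_pow_left₀ (by positivity) hs 2
    have h3 : 1 ≤ ε ^ 2 * k := by linarith [h.le_sq_mul]
    have h4 : k * (ε * k / 32 * F / 2) ^ 2 ≤ k * s ^ 2 := mul_le_mul_of_nonneg_left h2 hk'.le
    have h5 : (18 * k * F) ^ 2 * 1 ≤ (18 * k * F) ^ 2 * (ε ^ 2 * k) :=
      mul_le_mul_of_nonneg_left h3 (by positivity)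
    have h6 : (18 * k * F) ^ 2 * (ε ^ 2 * k) =
      18 ^ 2 * 64 ^ 2 * (k * (ε * k / 32 * F / 2) ^ 2) := by ring
    have h7 : 0 ≤ k * s ^ 2 := by positivity
    -- The constant is `6 · 18² · 64² + 4 < 10^7`, from `‖N‖_F² ≤ 6‖M‖_F² + 4ks²` for the centred
    -- sketch `M`.
    linarith
  · obtain ⟨x, hx, hxM⟩ := hneg
    refine ⟨x, hx, ?_⟩
    rw [shiftedSketch_quadratic (by simpa using hk), Fintype.card_fin]
    set τ := (centredSketch A G).trace / (k : ℝ)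
    have h2 : 1152 * √k * F ≤ ε * k / 4 * F := mul_le_mul_of_nonneg_right h.mul_sqrt_le hF.le
    have h3 : 0 ≤ ε * k * F := by positivity
    -- In units of `εkF`: `3s ≤ 1/8` and `|τ| ≤ 1/256`, together less than `1/4`.
    have h4 : -(ε * k / 4 * F) + (s - τ) ≤ -(2 * s) := by linarith
    have h5 := mul_le_mul_of_nonneg_right h4 hx.le
    linarith

lemma sketch_bad_of_isFarFromPSD {ε : ℝ} (h : SketchParams ε k) (hR : 1600 ≤ R)
    {A : Matrix (Fin d) (Fin d) ℝ} (hA : A.IsSymm) (hfar : IsFarFromPSD ε 2 A) :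
    ((gaussRows (Fin d) (Fin k)).prod (Measure.pi fun _ : Fin R =>
      (gauss (Fin d)).prod (gauss (Fin d)))).real {z | ¬ (0 < normShift (ε * k / 32) A z.2 ∧
        frobSq (shiftedSketch (normShift (ε * k / 32) A z.2) A z.1) ≤
          10 ^ 7 * k * normShift (ε * k / 32) A z.2 ^ 2 ∧ ∃ x : Fin k → ℝ, 0 < x ⬝ᵥ x ∧
        x ⬝ᵥ (shiftedSketch (normShift (ε * k / 32) A z.2) A z.1 *ᵥ x) ≤
          -(2 * normShift (ε * k / 32) A z.2) * (x ⬝ᵥ x))} ≤ 3 / 100 := by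
  have hk1 := h.one_le_k
  have hk : 0 < k := by exact_mod_cast (by linarith : (0 : ℝ) < k)
  have hk' : (0 : ℝ) < k := by linarith
  obtain ⟨hA0, l, hl, hlε⟩ := hfar
  rw [schattenNorm_two] at hlε
  have hF : 0 < √(frobSq A) :=
    Real.sqrt_pos.2 ((frobSq_nonneg A).lt_of_ne fun h0 => hA0 (frobSq_eq_zero h0.symm))
  have hneg : (gaussRows (Fin d) (Fin k)).real {G | ¬ ∃ x : Fin k → ℝ, 0 < x ⬝ᵥ x ∧
      x ⬝ᵥ (centredSketch A G *ᵥ x) ≤ -(ε * k / 4 * √(frobSq A) * (x ⬝ᵥ x))} ≤ 1 / 100 := by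
    have h1 := centredSketch_negative_direction (ι := Fin k) hA hA0 h.pos h.le_one hl hlε
      (by rw [Fintype.card_fin]; linarith [h.le_mul])
    simp only [Fintype.card_fin] at h1
    refine h1.trans ?_
    have : (8 : ℝ) / k ≤ 1 / 200 := by
      rw [div_le_iff₀ hk']; linarith [h.le_k]
    linarith
  have hG := measureReal_or_le (centredSketch_frobSq_bad hA hk) hneg
  have hGH := measureReal_prod_or_le hG (frobSq_estimate_bad hR A)
  refine (measureReal_mono ?_).trans (hGH.trans (by norm_num))
  intro z hz
  simp only [Set.mem_ofPred_eq] at hz ⊢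
  by_contra hc
  rw [not_or, not_or, not_not] at hc
  have hb := normShift_bounds (b := ε * k / 32) (by have := h.pos; positivity) hc.2
  exact hz (shiftedSketch_far h hF hb.1 hb.2 (not_lt.1 hc.1.1) hc.1.2)

end GoodSketch

/-! ### Correctness of the tester. -/

section Tester
variable {d k R T : ℕ}

/-- In the PSD case the only error is a bad sketch, at most `3/100`: on a good one no candidate can
have a negative value. In the far case the iteration may fail too, adding `1/50`. -/
lemma exists_tester {ε : ℝ} (h : SketchParams ε k) {L c : ℝ}
    (hI : IterationParams (10 ^ 7) k L c T) (hR : 1600 ≤ R) :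
    ∃ V : VMVAlgorithm d, V.IsTester ε 2 ∧ V.numQueries = R + k + T + k + 1 := by
  set μ₁ : Measure ((Fin d → Fin k → ℝ) × (Fin R → (Fin d → ℝ) × (Fin d → ℝ))) :=
    (gaussRows (Fin d) (Fin k)).prod (Measure.pi fun _ : Fin R =>
      (gauss (Fin d)).prod (gauss (Fin d))) with hμ₁
  set μ₂ : Measure ((Fin k → ℝ) × (Fin T → Fin k → Bool)) :=
    (gauss (Fin k)).prod (uniformLaw (Fin T → Fin k → Bool)) with hμ₂
  obtain ⟨hmeas, V, hn, hV⟩ := QueryComputable.exists_algorithm (μ₁.prod μ₂)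
    (testerOutput_queryComputable (d := d) (k := k) (R := R) (T := T) (ε * k / 32) (c / k)
      (1 / (10 ^ 7 * k)))
  refine ⟨V, fun A hA => ?_, hn⟩
  have hms : ∀ b : Bool, MeasurableSet {ω : TesterCoins d k R T |
      testerOutput (ε * k / 32) (c / k) (1 / (10 ^ 7 * k)) A ω = b} := fun b =>
    hmeas A (measurableSet_singleton b)
  have hcompl : ∀ b : Bool, (μ₁.prod μ₂).real {ω : TesterCoins d k R T |
      testerOutput (ε * k / 32) (c / k) (1 / (10 ^ 7 * k)) A ω = !b} ≤ 1 / 20 →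
      2 / 3 ≤ V.μ.real {ω | V.run A ω = b} := by
    intro b hb
    rw [hV]
    have h1 : {ω : TesterCoins d k R T |
        testerOutput (ε * k / 32) (c / k) (1 / (10 ^ 7 * k)) A ω = b} =
        {ω | testerOutput (ε * k / 32) (c / k) (1 / (10 ^ 7 * k)) A ω = !b}ᶜ := by
      ext ω
      simp only [Set.mem_ofPred_eq, Set.mem_compl_iff]
      cases testerOutput (ε * k / 32) (c / k) (1 / (10 ^ 7 * k)) A ω <;> cases b <;> simp
    rw [h1, probReal_compl_eq_one_sub (hms _)]
    linarith
  constructor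
  · intro hpsd
    apply hcompl true
    refine (measureReal_prod_le (hms _) le_rfl (sketch_bad_of_posSemidef h hR hA hpsd)
      fun z hz => ?_).trans (by norm_num)
    simp only [Set.mem_ofPred_eq, not_not] at hz
    have : {y : (Fin k → ℝ) × (Fin T → Fin k → Bool) | (z, y) ∈ {ω : TesterCoins d k R T |
        testerOutput (ε * k / 32) (c / k) (1 / (10 ^ 7 * k)) A ω = !true}} = ∅ := by
      ext y
      simpa [testerOutput] using hz _
    rw [this]; simp
  · intro hfar
    apply hcompl false
    refine (measureReal_prod_le (hms _) (by norm_num) (sketch_bad_of_isFarFromPSD h hR hA hfar)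
      (b := 1 / 50) fun z hz => ?_).trans (by norm_num)
    simp only [Set.mem_ofPred_eq, not_not] at hz
    obtain ⟨hs, hfr, x, hx, hxN⟩ := hz
    have hk : 0 < k := by exact_mod_cast lt_of_lt_of_le one_pos h.one_le_k
    have e : {y : (Fin k → ℝ) × (Fin T → Fin k → Bool) | (z, y) ∈ {ω : TesterCoins d k R T |
        testerOutput (ε * k / 32) (c / k) (1 / (10 ^ 7 * k)) A ω = !false}} =
        {ω | 0 ≤ candidate (shiftedSketch (normShift (ε * k / 32) A z.2) A z.1)
          (c / k / normShift (ε * k / 32) A z.2)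
          (1 / (10 ^ 7 * k) / normShift (ε * k / 32) A z.2) ω.1 ω.2 ⬝ᵥ
          (shiftedSketch (normShift (ε * k / 32) A z.2) A z.1 *ᵥ
            candidate (shiftedSketch (normShift (ε * k / 32) A z.2) A z.1)
          (c / k / normShift (ε * k / 32) A z.2)
          (1 / (10 ^ 7 * k) / normShift (ε * k / 32) A z.2) ω.1 ω.2)} := by
      ext y
      simp [testerOutput]
    have hm := measurable_prodMk_left (x := z) (hms !false)
    rw [e]
    refine candidate_failure hI (shiftedSketch_isSymm hA _ _) hs ?_ hfr hx hxN (e ▸ hm)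
    have := shiftedSketch_trace (ι := Fin k) (by simpa using hk) (normShift (ε * k / 32) A z.2) A z.1
    simpa using this

end Tester

/-! ### Choice of the parameters, and reduction from `p` to 2. -/

section Parameters

lemma log_le_of_le_two_pow {x : ℝ} (hx : 0 < x) (n : ℕ) (h : x ≤ 2 ^ n) : Real.log x ≤ n := by
  rw [Real.log_le_iff_le_exp hx]
  refine h.trans ?_
  have := Real.exp_nat_mul (1 : ℝ) n
  rw [mul_one] at this
  rw [this]
  exact pow_le_pow_left₀ (by norm_num) (by linarith [Real.add_one_le_exp (1 : ℝ)]) n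

lemma log_mul_mul_le {f a : ℝ} (hf : 1 ≤ f) (ha : 0 < a) (n : ℕ) (hn : 2 ≤ n) (h : a ≤ 2 ^ n) :
    Real.log (a * f * (1 + Real.log f)) ≤ n * (1 + Real.log f) := by
  have hl := Real.log_nonneg hf
  have h1 := log_le_of_le_two_pow ha n h
  have h2 := Real.log_le_sub_one_of_pos (x := 1 + Real.log f) (by linarith)
  rw [Real.log_mul (by positivity) (by positivity), Real.log_mul (by positivity) (by positivity)]
  have : (2 : ℝ) ≤ n := by exact_mod_cast hn
  nlinarith

lemma exists_tester_two {ε : ℝ} (hε : 0 < ε) (hε1 : ε < 1) (d : ℕ) :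
    ∃ V : VMVAlgorithm d, V.IsTester ε 2 ∧
      (V.numQueries : ℝ) ≤ softBound (10 ^ 34) 3 (1 / ε ^ 2) := by
  set f : ℝ := 1 / ε ^ 2 with hf
  have hf1 : 1 ≤ f := by
    rw [hf, le_div_iff₀ (by positivity), one_mul]
    exact pow_le_one₀ hε.le hε1.le
  have hl := Real.log_nonneg hf1
  set l : ℝ := 1 + Real.log f with hldef
  have hl1 : 1 ≤ l := by linarith
  have hfl : 1 ≤ f * l := by nlinarith
  set k : ℕ := ⌈10 ^ 10 * (f * l)⌉₊ with hkdef
  have hk1 : 10 ^ 10 * (f * l) ≤ k := Nat.le_ceil _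
  have hk2 : (k : ℝ) ≤ 2 * 10 ^ 10 * (f * l) := by
    have := Nat.ceil_lt_add_one (a := 10 ^ 10 * (f * l)) (by positivity)
    rw [← hkdef] at this
    linarith
  have hk0 : (0 : ℝ) < k := by linarith
  -- `2k + 1 ≤ 5 · 10^10 · f l` and `5 · 10^10 ≤ 2^36`.
  have hlogk : Real.log (2 * k + 1) ≤ 36 * l := by
    have h1 := log_mul_mul_le hf1 (a := 5 * 10 ^ 10) (by norm_num) 36 (by norm_num) (by norm_num)
    refine le_trans (Real.log_le_log (by linarith) ?_) h1
    rw [← hldef]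
    linarith
  have hS : SketchParams ε k := by
    refine ⟨hε, hε1.le, by linarith, ?_⟩
    have h1 : ε ^ 2 * (10 ^ 10 * (f * l)) ≤ ε ^ 2 * k :=
      mul_le_mul_of_nonneg_left hk1 (by positivity)
    have h2 : ε ^ 2 * (10 ^ 10 * (f * l)) = 10 ^ 10 * l := by
      rw [hf]; field_simp
    linarith
  set L : ℝ := 20 + Real.log (10 ^ 7) + 2 * Real.log k with hL
  have hlog7 : Real.log (10 ^ 7) ≤ 24 := by
    have := log_le_of_le_two_pow (x := 10 ^ 7) (by norm_num) 24 (by norm_num)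
    exact_mod_cast this
  have hlog7' : 0 ≤ Real.log ((10 : ℝ) ^ 7) := Real.log_nonneg (by norm_num)
  have hk0' : 0 ≤ Real.log k := Real.log_nonneg (by linarith)
  have hkk : Real.log k ≤ Real.log (2 * k + 1) := Real.log_le_log hk0 (by linarith)
  have hL1 : L ≤ 116 * l := by linarith
  have hL0 : 20 ≤ L := by linarith
  set c : ℝ := 1 / (2 * 10 ^ 11 * 10 ^ 7 * L) with hc
  -- As `1/c` is itself proportional to `L`, the number of steps is of order `kL²`. With `k` of
  -- order `f l` and `L` of order `l` this gives the cube of the logarithm in the final bound.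
  have hkLc : k * L / c = 2 * 10 ^ 18 * (k * L ^ 2) := by
    rw [hc]; field_simp
  set T : ℕ := ⌈k * L / c⌉₊ with hT
  have hT1 : (T : ℝ) ≤ k * L / c + 1 :=
    (Nat.ceil_lt_add_one (by rw [hkLc]; positivity)).le
  have hI : IterationParams (10 ^ 7) k L c T :=
    ⟨by norm_num, by linarith, hL, hc, Nat.le_ceil _, hT1⟩
  obtain ⟨V, hV, hn⟩ := exists_tester (d := d) hS hI (R := 1600) le_rfl
  refine ⟨V, hV, ?_⟩
  rw [hn, softBound, ← hldef]
  push_cast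
  have h1 : k * L ^ 2 ≤ 2 * 10 ^ 10 * (f * l) * (116 * l) ^ 2 := by gcongr
  have h2 : 2 * 10 ^ 10 * (f * l) * (116 * l) ^ 2 = 2 * 10 ^ 10 * 116 ^ 2 * (f * l ^ 3) := by ring
  have h3 : f * l ≤ f * l ^ 3 :=
    mul_le_mul_of_nonneg_left (le_self_pow₀ hl1 (by norm_num)) (by linarith)
  have h4 : (10 : ℝ) ^ 34 * f * l ^ 3 = 10 ^ 34 * (f * l ^ 3) := by ring
  rw [h4]
  rw [hkLc] at hT1
  linarith

/-- A matrix that is far in the `p`-norm is far in the 2-norm at the rescaled distance, because the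
ratio of the norms is at most `d^(1/2-1/p)`. -/
lemma VMVAlgorithm.IsTester.of_two {d : ℕ} {ε : ℝ} {p : ℝ≥0∞} (hp : 2 ≤ p) (hε : 0 < ε)
    (hd : 1 ≤ d) {V : VMVAlgorithm d}
    (hV : V.IsTester (ε / (d : ℝ) ^ (1 / 2 - (p⁻¹).toReal)) 2) : V.IsTester ε p := by
  intro A hA
  refine ⟨(hV A hA).1, fun hfar => (hV A hA).2 ⟨hfar.1, ?_⟩⟩
  obtain ⟨-, l, hl, hlε⟩ := hfar
  refine ⟨l, hl, hlε.trans ?_⟩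
  have hd' : (0 : ℝ) < d := by exact_mod_cast hd
  have hpos : 0 < (d : ℝ) ^ (1 / 2 - (p⁻¹).toReal) := Real.rpow_pos_of_pos hd' _
  have h1 : ε / (d : ℝ) ^ (1 / 2 - (p⁻¹).toReal) * schattenNorm 2 A ≤ ε * schattenNorm p A := by
    rw [div_mul_eq_mul_div, div_le_iff₀ hpos]
    have := mul_le_mul_of_nonneg_left (schattenNorm_two_le hp A) hε.le
    linarith
  linarith

end Parameters

theorem mainTheorem5 :
    (∃ (C : ℝ) (K : ℕ), ∀ (d : ℕ) (ε : ℝ), 1 ≤ d → 0 < ε → ε < 1 →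
      ∃ T : VMVAlgorithm d, T.IsTester ε 2 ∧
        (T.numQueries : ℝ) ≤ softBound C K (1 / ε ^ 2)) ∧
    (∃ (C : ℝ) (K : ℕ), ∀ (p : ℝ≥0∞) (d : ℕ) (ε : ℝ), 2 ≤ p → 1 ≤ d → 0 < ε → ε < 1 →
      ∃ T : VMVAlgorithm d, T.IsTester ε p ∧
        (T.numQueries : ℝ) ≤ softBound C K (1 / ε ^ 2 * (d : ℝ) ^ (1 - 2 * (p⁻¹).toReal))) := by
  refine ⟨⟨10 ^ 34, 3, fun d ε _ hε hε1 => exists_tester_two hε hε1 d⟩,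
    10 ^ 34, 3, fun p d ε hp hd hε hε1 => ?_⟩
  have hd0 : (0 : ℝ) < d := by exact_mod_cast hd
  have hd1 : (1 : ℝ) ≤ d := by exact_mod_cast hd
  have hp' : (p⁻¹).toReal ≤ 1 / 2 := by
    have h1 : p⁻¹ ≤ 2⁻¹ := ENNReal.inv_le_inv.2 hp
    have h2 := ENNReal.toReal_mono (by simp) h1
    simpa using h2
  have hone : 1 ≤ (d : ℝ) ^ (1 / 2 - (p⁻¹).toReal) :=
    Real.one_le_rpow hd1 (by linarith)
  have hpos : 0 < (d : ℝ) ^ (1 / 2 - (p⁻¹).toReal) := by linarith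
  obtain ⟨V, hV, hn⟩ := exists_tester_two (ε := ε / (d : ℝ) ^ (1 / 2 - (p⁻¹).toReal))
    (by positivity) (by rw [div_lt_one hpos]; linarith) d
  refine ⟨V, hV.of_two hp hε hd, ?_⟩
  have e : 1 / (ε / (d : ℝ) ^ (1 / 2 - (p⁻¹).toReal)) ^ 2 =
      1 / ε ^ 2 * (d : ℝ) ^ (1 - 2 * (p⁻¹).toReal) := by
    have h2 : ((d : ℝ) ^ (1 / 2 - (p⁻¹).toReal)) ^ 2 = (d : ℝ) ^ (1 - 2 * (p⁻¹).toReal) := by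
      rw [← Real.rpow_natCast, ← Real.rpow_mul hd0.le]
      congr 1; push_cast; ring
    rw [div_pow, h2]
    field_simp
  rwa [e] at hn
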